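/- Let $C$ be an elliptic curve with identity $e$ over a field $K$ of characteristic $0$. For $n\ge 1$ let $C\langle n\rangle$ be the set of closed points of exact order $n$, let $\mathcal{K}$ be the ring of rational functions on $C$ all of whose poles are at points of finite order, and for a ring $A$ of functions write $PA=\bigoplus_{k\in\mathbb{Z}}A\otimes\Omega_C^{\otimes k}=A[\omega^{\pm1}]$ for the graded ring with the invariant differential $\omega$ in degree $2$. Let coordinate data be given: nonzero rational functions $t_1,t_2,\dots$ with $t_n$ vanishing to first order at every point of $C\langle n\rangle$; let $Dt$ be the regular differential that agrees with $dt_1$ at $e$. For a diagram of graded commutative rings $R_1\to R_2\leftarrow R_3$, a module over it consists of graded modules $N,P,V$ over $R_1,R_2,R_3$ with degree-preserving linear maps $N\to P\leftarrow V$; call it extended if the induced maps $R_2\otimes_{R_1}N\to P$ and $R_2\otimes_{R_3}V\to P$ are isomorphisms. (a) Let $\mathcal{O}_{\mathcal F}=\prod_{n\ge1}\mathbb{Q}[c]$ (graded product, $c$ in degree $-2$) and $\mathcal{E}^{-1}\mathcal{O}_{\mathcal F}=\operatorname{colim}_v c^{-v}\mathcal{O}_{\mathcal F}$, where $v$ runs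 through the functions $\{1,2,\dots\}\to\mathbb{N}$ that vanish almost everywhere and $c^{v}=(c^{v(n)})_n$. The category $\mathcal{A}(\mathbb{T})$ consists of the extended modules over $\mathcal{O}_{\mathcal F}\to\mathcal{E}^{-1}\mathcal{O}_{\mathcal F}\leftarrow\mathbb{Q}$, with the objectwise tensor product. (b) $EC_a$ is the commutative monoid $NC\to\mathcal{E}^{-1}\mathcal{O}_{\mathcal F}\otimes_{\mathbb{Q}}P\mathcal{K}\leftarrow P\mathcal{K}$ in $\mathcal{A}(\mathbb{T})$, where $NC$ is the kernel of the principal part map $$p:\mathcal{E}^{-1}\mathcal{O}_{\mathcal F}\otimes_{\mathbb{Q}}P\mathcal{K}\longrightarrow\bigoplus_{n\ge1}H^1_{C\langle n\rangle}(C;P\mathcal{O}_C),$$ whose $n$-th component sends $c^v\otimes f$ (with $v:\{1,2,\dots\}\to\mathbb{Z}$ zero almost everywhere) to the class of $(t_n/Dt)^{v(n)}f$. (c) The category $\mathcal{A}(PC)$ consists of the extended modules over the periodic diagram of rings $$P\Big(\prod_{n}\Gamma\mathcal{O}^{\wedge}_{C\langle n\rangle}\Big)\longrightarrow P\Big(\mathcal{K}\otimes_{\mathcal{O}_C}\prod_n\Gamma\mathcal{O}^{\wedge}_{C\langle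 n\rangle}\Big)\longleftarrow P\mathcal{K},$$ where $\Gamma\mathcal{O}^{\wedge}_{C\langle n\rangle}=\prod_{x\in C\langle n\rangle}\mathcal{O}^{\wedge}_{C,x}$. Then $EC_a$ is an object of $\mathcal{A}(\mathbb{T})$, the category of $EC_a$-modules in $\mathcal{A}(\mathbb{T})$ and the category $\mathcal{A}(PC)$ are abelian, and there is an equivalence of abelian categories $$EC_a\text{-mod-in-}\mathcal{A}(\mathbb{T})\;\simeq\;\mathcal{A}(PC).$$ -/

import Mathlib

universe u v w

open CategoryTheory
open scoped TensorProduct LaurentPolynomial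

noncomputable section

set_option linter.unusedSectionVars false

namespace EllipticModel

/-! ## Graded rings and graded modules -/

/-- A `ℤ`-graded commutative ring.  All the rings used below are concentrated in even degrees, so
that graded commutativity is commutativity. -/
structure GrRing where
  carrier : Type u
  [commRing : CommRing carrier]
  piece : ℤ → AddSubgroup carrier
  gradedMonoid : SetLike.GradedMonoid piece
  internal : DirectSum.IsInternal piece

attribute [instance] GrRing.commRing GrRing.gradedMonoid

/-- Degree-preserving ring homomorphisms. -/
structure GrRing.Hom (R : GrRing.{u}) (S : GrRing.{v}) where
  toRingHom : R.carrier →+* S.carrier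
  map_mem : ∀ i x, x ∈ R.piece i → toRingHom x ∈ S.piece i

/-- A `ℤ`-graded module over a graded commutative ring. -/
structure GrMod (R : GrRing.{u}) where
  carrier : Type w
  [addCommGroup : AddCommGroup carrier]
  [module : Module R.carrier carrier]
  piece : ℤ → AddSubgroup carrier
  smul_mem : ∀ i j (r : R.carrier) (m : carrier),
    r ∈ R.piece i → m ∈ piece j → r • m ∈ piece (i + j)
  internal : DirectSum.IsInternal piece

attribute [instance] GrMod.addCommGroup GrMod.module

/-- Restriction of scalars. -/
def GrMod.restrict {R : GrRing.{u}} {S : GrRing.{v}} (f : R.Hom S) (M : GrMod.{v, w} S) :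
    GrMod.{u, w} R :=
  letI : Module R.carrier M.carrier := Module.compHom M.carrier f.toRingHom
  { carrier := M.carrier
    piece := M.piece
    smul_mem := fun i j r m hr hm => M.smul_mem i j (f.toRingHom r) m (f.map_mem i r hr) hm
    internal := M.internal }

/-- A graded ring as a graded module over itself. -/
def GrMod.self (R : GrRing.{u}) : GrMod.{u, u} R where
  carrier := R.carrier
  piece := R.piece
  smul_mem := fun _ _ _ _ hr hm => SetLike.mul_mem_graded hr hm
  internal := R.internal

/-! ## Modules over a diagram of rings `R₁ → R₂ ← R₃` -/

/-- A diagram of graded rings `R₁ → R₂ ← R₃`. -/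
structure RingFork where
  R₁ : GrRing.{u}
  R₂ : GrRing.{u}
  R₃ : GrRing.{u}
  l : R₁.Hom R₂
  ι : R₃.Hom R₂

/-- A map of diagrams of graded rings. -/
structure RingFork.Hom (F : RingFork.{u}) (G : RingFork.{v}) where
  h₁ : F.R₁.Hom G.R₁
  h₂ : F.R₂.Hom G.R₂
  h₃ : F.R₃.Hom G.R₃
  comm_l : ∀ r, h₂.toRingHom (F.l.toRingHom r) = G.l.toRingHom (h₁.toRingHom r)
  comm_ι : ∀ r, h₂.toRingHom (F.ι.toRingHom r) = G.ι.toRingHom (h₃.toRingHom r)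

/-- A module `N → P ← V` over a diagram of graded rings `R₁ → R₂ ← R₃`: graded modules over the
three rings, with a degree-preserving `R₁`-linear map `N → P` and a degree-preserving
`R₃`-linear map `V → P`. -/
structure ForkMod (F : RingFork.{u}) where
  N : GrMod.{u, w} F.R₁
  P : GrMod.{u, w} F.R₂
  V : GrMod.{u, w} F.R₃
  k : N.carrier →ₛₗ[F.l.toRingHom] P.carrier
  m : V.carrier →ₛₗ[F.ι.toRingHom] P.carrier
  k_mem : ∀ i x, x ∈ N.piece i → k x ∈ P.piece i
  m_mem : ∀ i x, x ∈ V.piece i → m x ∈ P.piece i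

namespace ForkMod

variable {F : RingFork.{u}}

/-- A morphism of modules over a diagram of rings: three degree-preserving linear maps making the
two squares commute. -/
@[ext]
structure Hom (X Y : ForkMod.{u, w} F) where
  a : X.N.carrier →ₗ[F.R₁.carrier] Y.N.carrier
  b : X.P.carrier →ₗ[F.R₂.carrier] Y.P.carrier
  c : X.V.carrier →ₗ[F.R₃.carrier] Y.V.carrier
  a_mem : ∀ i x, x ∈ X.N.piece i → a x ∈ Y.N.piece i
  b_mem : ∀ i x, x ∈ X.P.piece i → b x ∈ Y.P.piece i
  c_mem : ∀ i x, x ∈ X.V.piece i → c x ∈ Y.V.piece i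
  comm_k : ∀ x, b (X.k x) = Y.k (a x)
  comm_m : ∀ x, b (X.m x) = Y.m (c x)

instance : Category (ForkMod.{u, w} F) where
  Hom X Y := Hom X Y
  id X :=
    { a := LinearMap.id, b := LinearMap.id, c := LinearMap.id
      a_mem := fun _ _ h => h, b_mem := fun _ _ h => h, c_mem := fun _ _ h => h
      comm_k := fun _ => rfl, comm_m := fun _ => rfl }
  comp f g :=
    { a := g.a ∘ₗ f.a, b := g.b ∘ₗ f.b, c := g.c ∘ₗ f.c
      a_mem := fun i x h => g.a_mem i _ (f.a_mem i x h)
      b_mem := fun i x h => g.b_mem i _ (f.b_mem i x h)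
      c_mem := fun i x h => g.c_mem i _ (f.c_mem i x h)
      comm_k := fun x => by simp [f.comm_k, g.comm_k]
      comm_m := fun x => by simp [f.comm_m, g.comm_m] }

/-- Restriction of scalars along a map of diagrams of rings, on objects. -/
def restrict {G : RingFork.{v}} (h : F.Hom G) (X : ForkMod.{v, w} G) : ForkMod.{u, w} F where
  N := X.N.restrict h.h₁
  P := X.P.restrict h.h₂
  V := X.V.restrict h.h₃
  k :=
    { toFun := X.k
      map_add' := X.k.map_add
      map_smul' := fun r x => by
        refine (X.k.map_smulₛₗ (h.h₁.toRingHom r) x).trans ?_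
        rw [← h.comm_l]
        rfl }
  m :=
    { toFun := X.m
      map_add' := X.m.map_add
      map_smul' := fun r x => by
        refine (X.m.map_smulₛₗ (h.h₃.toRingHom r) x).trans ?_
        rw [← h.comm_ι]
        rfl }
  k_mem := X.k_mem
  m_mem := X.m_mem

/-- A diagram of rings as a module over itself. -/
def self (F : RingFork.{u}) : ForkMod.{u, u} F where
  N := GrMod.self F.R₁
  P := GrMod.self F.R₂
  V := GrMod.self F.R₃
  k :=
    { toFun := F.l.toRingHom
      map_add' := map_add F.l.toRingHom
      map_smul' := map_mul F.l.toRingHom }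
  m :=
    { toFun := F.ι.toRingHom
      map_add' := map_add F.ι.toRingHom
      map_smul' := map_mul F.ι.toRingHom }
  k_mem := F.l.map_mem
  m_mem := F.ι.map_mem

end ForkMod

/-- A semilinear map `f : M → N` over `l : R → S` is an extension of scalars if it induces an
isomorphism `S ⊗[R] M ≅ N`. -/
def IsExtensionOfScalars {R S M N : Type*} [CommRing R] [CommRing S] [AddCommGroup M]
    [AddCommGroup N] [Module R M] [Module S N] (l : R →+* S) (f : M →ₛₗ[l] N) : Prop :=
  letI : Algebra R S := l.toAlgebra
  letI : Module R N := Module.compHom N l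
  haveI : IsScalarTower R S N := ⟨fun r s n => mul_smul (l r) s n⟩
  IsBaseChange S
    ({ toFun := f, map_add' := f.map_add, map_smul' := f.map_smulₛₗ } : M →ₗ[R] N)

/-- The property of a module `N → P ← V` over `R₁ → R₂ ← R₃` that both structure maps are
extensions of scalars. -/
def RingFork.extended (F : RingFork.{u}) : ObjectProperty (ForkMod.{u, w} F) := fun X =>
  IsExtensionOfScalars F.l.toRingHom X.k ∧ IsExtensionOfScalars F.ι.toRingHom X.m

/-! ## Constructions of graded rings -/

theorem isInternal_of_proj {M J : Type*} [AddCommGroup M] (A : ℤ → AddSubgroup M) (δ : J → ℤ)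
    (π : J → M →+ M) (h₁ : ∀ j x, π j x ∈ A (δ j))
    (h₂ : ∀ i x, x ∈ A i → ∀ j, δ j ≠ i → π j x = 0)
    (h₃ : ∀ x, ∃ s : Finset J, x = ∑ j ∈ s, π j x) : DirectSum.IsInternal A := by
  classical
  constructor
  · rw [injective_iff_map_eq_zero]
    intro x hx
    have key : ∀ j, π j (x (δ j) : M) = 0 := by
      intro j
      have h0 : (DirectSum.coeAddMonoidHom A) x = ∑ i ∈ x.support, (x i : M) :=
        DirectSum.coeAddMonoidHom_eq_dfinsuppSum A x
      rw [hx] at h0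
      have h1 := congrArg (π j) h0
      rw [map_zero, map_sum] at h1
      by_cases hj : δ j ∈ x.support
      · rw [Finset.sum_eq_single_of_mem (δ j) hj] at h1
        · exact h1.symm
        · intro i _ hi
          exact h₂ i _ (x i).2 j (Ne.symm hi)
      · rw [DFinsupp.notMem_support_iff] at hj
        rw [hj]; simp
    refine DFinsupp.ext fun i => Subtype.ext ?_
    obtain ⟨s, hs⟩ := h₃ (x i : M)
    rw [hs]
    refine Finset.sum_eq_zero fun j _ => ?_
    by_cases hj : δ j = i
    · subst hj; exact key j
    · exact h₂ i _ (x i).2 j hj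
  · intro x
    obtain ⟨s, hs⟩ := h₃ x
    refine ⟨∑ j ∈ s, DirectSum.of (fun i => A i) (δ j) ⟨π j x, h₁ j x⟩, ?_⟩
    rw [map_sum]
    conv_rhs => rw [hs]
    exact Finset.sum_congr rfl fun j _ => DirectSum.coeAddMonoidHom_of _ _ _

/-- The projection of a graded ring to its homogeneous elements of degree `i`. -/
def GrRing.proj (R : GrRing.{u}) (i : ℤ) : R.carrier →+ R.carrier :=
  letI := R.internal.chooseDecomposition
  (R.piece i).subtype.comp
    ((DFinsupp.evalAddMonoidHom i).comp (DirectSum.decomposeAddEquiv R.piece).toAddMonoidHom)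

namespace GrRing

variable (R : GrRing.{u})

theorem proj_mem (i : ℤ) (x : R.carrier) : R.proj i x ∈ R.piece i := by
  let _ := R.internal.chooseDecomposition
  exact (DirectSum.decompose R.piece x i).2

theorem proj_of_mem {i : ℤ} {x : R.carrier} (hx : x ∈ R.piece i) : R.proj i x = x := by
  let _ := R.internal.chooseDecomposition
  exact DirectSum.decompose_of_mem_same R.piece hx

theorem proj_of_mem_ne {i j : ℤ} {x : R.carrier} (hx : x ∈ R.piece i) (h : i ≠ j) :
    R.proj j x = 0 := by
  let _ := R.internal.chooseDecomposition
  exact DirectSum.decompose_of_mem_ne R.piece hx h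

theorem exists_sum_proj (x : R.carrier) : ∃ s : Finset ℤ, x = ∑ i ∈ s, R.proj i x := by
  classical
  let _ := R.internal.chooseDecomposition
  exact ⟨_, (DirectSum.sum_support_decompose R.piece x).symm⟩

theorem exists_sum_proj_of_subset (x : R.carrier) :
    ∃ s : Finset ℤ, ∀ s', s ⊆ s' → x = ∑ i ∈ s', R.proj i x := by
  obtain ⟨s, hs⟩ := R.exists_sum_proj x
  refine ⟨s, fun s' h => ?_⟩
  conv_lhs => rw [hs]
  refine Finset.sum_subset h fun i _ hi => ?_
  conv_lhs => rw [hs]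
  rw [map_sum]
  exact Finset.sum_eq_zero fun j hj =>
    R.proj_of_mem_ne (R.proj_mem j x) fun h' => hi (h' ▸ hj)

/-- Composition. -/
def Hom.comp {R : GrRing.{u}} {S : GrRing.{v}} {B : GrRing.{w}} (g : S.Hom B) (f : R.Hom S) :
    R.Hom B where
  toRingHom := g.toRingHom.comp f.toRingHom
  map_mem := fun i x hx => g.map_mem i _ (f.map_mem i x hx)

theorem Hom.map_proj {R : GrRing.{u}} {S : GrRing.{v}} (f : R.Hom S) (i : ℤ) (x : R.carrier) :
    S.proj i (f.toRingHom x) = f.toRingHom (R.proj i x) := by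
  obtain ⟨s, hs⟩ := R.exists_sum_proj x
  have h : ∀ j, S.proj i (f.toRingHom (R.proj j x)) =
      f.toRingHom (R.proj i (R.proj j x)) := by
    intro j
    by_cases hj : j = i
    · subst hj
      rw [proj_of_mem _ (f.map_mem _ _ (R.proj_mem _ _)), proj_of_mem _ (R.proj_mem _ _)]
    · rw [proj_of_mem_ne _ (f.map_mem _ _ (R.proj_mem _ _)) hj,
        proj_of_mem_ne _ (R.proj_mem _ _) hj, map_zero]
  conv_lhs => rw [hs]
  conv_rhs => rw [hs]
  simp only [map_sum, h]

/-- A subring containing the homogeneous components of its elements, with the induced grading. -/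
def sub {𝕜 : Type*} [CommRing 𝕜] [Algebra 𝕜 R.carrier] (S : Subalgebra 𝕜 R.carrier)
    (hS : ∀ x ∈ S, ∀ i, R.proj i x ∈ S) : GrRing.{u} where
  carrier := S
  piece i := (R.piece i).comap (S.val : S →+ R.carrier)
  gradedMonoid :=
    { one_mem := SetLike.GradedOne.one_mem (A := R.piece)
      mul_mem := fun _ _ _ _ hx hy => SetLike.mul_mem_graded (A := R.piece) hx hy }
  internal := by
    refine isInternal_of_proj _ (fun i => i)
      (fun i => ((R.proj i).comp (S.val : S →+ R.carrier)).codRestrict S.toSubring.toAddSubgroup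
        fun x => hS x x.2 i) ?_ ?_ ?_
    · intro j x
      exact R.proj_mem j x
    · intro i x hx j hj
      exact Subtype.ext (R.proj_of_mem_ne hx (Ne.symm hj))
    · intro x
      obtain ⟨s, hs⟩ := R.exists_sum_proj x
      refine ⟨s, Subtype.ext ?_⟩
      change S.val x = S.val _
      rw [map_sum]
      exact hs

instance {𝕜 : Type*} [CommRing 𝕜] [Algebra 𝕜 R.carrier] (S : Subalgebra 𝕜 R.carrier)
    (hS : ∀ x ∈ S, ∀ i, R.proj i x ∈ S) : Algebra 𝕜 (R.sub S hS).carrier :=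
  inferInstanceAs (Algebra 𝕜 S)

/-- The inclusion of a homogeneous subring. -/
def subHom {𝕜 : Type*} [CommRing 𝕜] [Algebra 𝕜 R.carrier] (S : Subalgebra 𝕜 R.carrier)
    (hS : ∀ x ∈ S, ∀ i, R.proj i x ∈ S) : (R.sub S hS).Hom R where
  toRingHom := (S.val : S →+* R.carrier)
  map_mem := fun _ _ h => h

/-- A commutative ring in degree zero. -/
def concentrated (A : Type u) [CommRing A] : GrRing.{u} where
  carrier := A
  piece i := if i = 0 then ⊤ else ⊥
  gradedMonoid :=
    { one_mem := by simp
      mul_mem := by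
        intro i j x y hx hy
        by_cases hi : i = 0
        · by_cases hj : j = 0
          · simp [hi, hj]
          · simp only [hj, if_false, AddSubgroup.mem_bot] at hy
            simp [hy, zero_mem]
        · simp only [hi, if_false, AddSubgroup.mem_bot] at hx
          simp [hx, zero_mem] }
  internal := by
    refine isInternal_of_proj _ (fun _ : Unit => 0) (fun _ => AddMonoidHom.id A) ?_ ?_ ?_
    · intro j x; simp
    · intro i x hx j hj
      rw [if_neg (Ne.symm hj)] at hx
      simpa using hx
    · intro x; exact ⟨{()}, by simp⟩

/-- The unit of a graded `ℚ`-algebra. -/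
def ratHom (B : GrRing.{u}) [Algebra ℚ B.carrier] : (concentrated ℚ).Hom B where
  toRingHom := algebraMap ℚ B.carrier
  map_mem := by
    intro i (q : ℚ) hq
    by_cases hi : i = 0
    · subst hi
      have h1 : B.proj 0 1 = 1 := B.proj_of_mem (SetLike.GradedOne.one_mem (A := B.piece))
      have h2 : algebraMap ℚ B.carrier q ∈ B.piece 0 := by
        rw [Algebra.algebraMap_eq_smul_one, ← h1, ← map_rat_smul]
        exact B.proj_mem 0 _
      exact h2
    · have hq' : q ∈ (if i = 0 then ⊤ else ⊥ : AddSubgroup ℚ) := hq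
      rw [if_neg hi, AddSubgroup.mem_bot] at hq'
      subst hq'
      have h0 : algebraMap ℚ B.carrier 0 ∈ B.piece i := by
        rw [map_zero]
        exact zero_mem _
      exact h0

/-- The ring `A[T, T⁻¹]` with `A` in degree `0` and `T` in degree `d`. -/
def laurent (A : Type u) [CommRing A] (d : ℤ) : GrRing.{u} where
  carrier := A[T;T⁻¹]
  piece i :=
    { carrier := {f | ∀ j, f.coeff j ≠ 0 → d * j = i}
      zero_mem' := fun j h => absurd rfl h
      add_mem' := by
        intro f g hf hg j h
        by_contra hj
        have h1 : f.coeff j = 0 := by_contra fun h' => hj (hf j h')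
        have h2 : g.coeff j = 0 := by_contra fun h' => hj (hg j h')
        exact h (by simp [h1, h2])
      neg_mem' := by
        intro f hf j h
        exact hf j (by simpa using h) }
  gradedMonoid :=
    { one_mem := by
        intro j h
        have : j = 0 := by
          by_contra hj
          apply h
          rw [AddMonoidAlgebra.one_def, AddMonoidAlgebra.coeff_single]
          exact Finsupp.single_eq_of_ne hj
        simp [this]
      mul_mem := by
        classical
        intro i j f g hf hg m hm
        obtain ⟨a, ha, b, hb, rfl⟩ := Finset.mem_add.1
          (AddMonoidAlgebra.support_coeff_mul_subset f g (Finsupp.mem_support_iff.2 hm))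
        rw [mul_add, hf a (Finsupp.mem_support_iff.1 ha), hg b (Finsupp.mem_support_iff.1 hb)] }
  internal := by
    refine isInternal_of_proj _ (fun j : ℤ => d * j)
      (fun j => AddMonoidHom.mk' (fun f : A[T;T⁻¹] => AddMonoidAlgebra.single j (f.coeff j))
        (fun f g => by simp [AddMonoidAlgebra.single_add])) ?_ ?_ ?_
    · intro j f i hi
      by_cases h : j = i
      · rw [h]
      · exact absurd (Finsupp.single_eq_of_ne (Ne.symm h)) hi
    · intro i f hf j hj
      have : f.coeff j = 0 := by_contra fun h => hj (hf j h)
      simp [this]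
    · intro f
      refine ⟨f.coeff.support, LaurentPolynomial.ext fun a => ?_⟩
      simp only [AddMonoidHom.mk'_apply, AddMonoidAlgebra.coeff_sum, AddMonoidAlgebra.coeff_single,
        Finsupp.finsetSum_apply, Finsupp.single_apply, Finset.sum_ite_eq', Finsupp.mem_support_iff]
      split_ifs with h
      · rfl
      · exact Finsupp.notMem_support_iff.1 h

instance {𝕜 A : Type*} [CommRing 𝕜] [CommRing A] [Algebra 𝕜 A] (d : ℤ) :
    Algebra 𝕜 (laurent A d).carrier :=
  inferInstanceAs (Algebra 𝕜 A[T;T⁻¹])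

theorem coeff_proj_laurent {A : Type u} [CommRing A] {d : ℤ} (i : ℤ) (f : A[T;T⁻¹]) (j : ℤ) :
    ((laurent A d).proj i f : A[T;T⁻¹]).coeff j = if d * j = i then f.coeff j else 0 := by
  induction f using LaurentPolynomial.induction_on' with
  | add p q hp hq =>
    have h : ((laurent A d).proj i (p + q : A[T;T⁻¹]) : A[T;T⁻¹]).coeff j =
        ((laurent A d).proj i p : A[T;T⁻¹]).coeff j +
          ((laurent A d).proj i q : A[T;T⁻¹]).coeff j :=
      congrArg (fun z : A[T;T⁻¹] => z.coeff j) (map_add ((laurent A d).proj i) p q)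
    rw [h, hp, hq, AddMonoidAlgebra.coeff_add, Finsupp.add_apply]
    split_ifs <;> simp
  | C_mul_T n a =>
    rw [← LaurentPolynomial.single_eq_C_mul_T]
    have hmem : (AddMonoidAlgebra.single n a : A[T;T⁻¹]) ∈ (laurent A d).piece (d * n) := by
      intro m hm
      by_cases h : m = n
      · rw [h]
      · exact absurd (Finsupp.single_eq_of_ne h) hm
    by_cases hi : d * n = i
    · subst hi
      rw [(laurent A d).proj_of_mem hmem]
      split_ifs with h
      · rfl
      · rw [AddMonoidAlgebra.coeff_single]
        exact Finsupp.single_eq_of_ne fun h' => h (h' ▸ rfl)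
    · rw [(laurent A d).proj_of_mem_ne hmem hi]
      split_ifs with h
      · rw [AddMonoidAlgebra.coeff_single, Finsupp.single_eq_of_ne]
        · rfl
        · rintro rfl
          exact hi h
      · rfl

/-- A ring homomorphism on coefficients, extended by `T ↦ T`. -/
def laurentMap {A : Type u} {B : Type v} [CommRing A] [CommRing B] (f : A →+* B) (d : ℤ) :
    (laurent A d).Hom (laurent B d) where
  toRingHom := AddMonoidAlgebra.mapRingHom ℤ f
  map_mem := by
    intro i x hx j hj
    refine hx j fun h => hj ?_
    change f (AddMonoidAlgebra.coeff x j) = 0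
    rw [h, map_zero]

theorem zpow_mem (B : GrRing.{u}) {d : ℤ} (x : B.carrierˣ) (hx : (x : B.carrier) ∈ B.piece d)
    (hx' : ((x⁻¹ : B.carrierˣ) : B.carrier) ∈ B.piece (-d)) (j : ℤ) :
    ((x ^ j : B.carrierˣ) : B.carrier) ∈ B.piece (d * j) := by
  obtain ⟨n, rfl | rfl⟩ := j.eq_nat_or_neg
  · have := SetLike.pow_mem_graded n hx
    rw [nsmul_eq_mul, mul_comm] at this
    simpa using this
  · have := SetLike.pow_mem_graded n hx'
    rw [nsmul_eq_mul, mul_comm, neg_mul] at this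
    simpa using this

/-- The degree-preserving ring homomorphism on `A[T, T⁻¹]` that sends `T` to a unit `x` which is
homogeneous of degree `d`. -/
def laurentEval {A : Type u} [CommRing A] {B : GrRing.{v}} (g : A →+* B.carrier)
    (hg : ∀ a, g a ∈ B.piece 0) {d : ℤ} (x : B.carrierˣ) (hx : (x : B.carrier) ∈ B.piece d)
    (hx' : ((x⁻¹ : B.carrierˣ) : B.carrier) ∈ B.piece (-d)) : (laurent A d).Hom B where
  toRingHom := LaurentPolynomial.eval₂ g x
  map_mem := by
    intro i (f : A[T;T⁻¹]) hf
    have hsum : f = ∑ j ∈ f.coeff.support, LaurentPolynomial.C (f.coeff j) *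
        LaurentPolynomial.T j := by
      simp only [← LaurentPolynomial.single_eq_C_mul_T]
      exact (AddMonoidAlgebra.sum_coeff_single f).symm
    have h : LaurentPolynomial.eval₂ g x f ∈ B.piece i := by
      rw [hsum, map_sum]
      refine sum_mem fun j hj => ?_
      rw [LaurentPolynomial.eval₂_C_mul_T]
      have := SetLike.mul_mem_graded (hg (f.coeff j)) (B.zpow_mem x hx hx' j)
      rwa [zero_add, hf j (Finsupp.mem_support_iff.1 hj)] at this
    exact h

/-- The tensor product of two graded `ℚ`-algebras, with the total grading. -/
def tensor (R : GrRing.{u}) (S : GrRing.{v}) [Algebra ℚ R.carrier] [Algebra ℚ S.carrier] :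
    GrRing.{max u v} where
  carrier := R.carrier ⊗[ℚ] S.carrier
  piece k := AddSubgroup.closure
    {z | ∃ i j, ∃ a ∈ R.piece i, ∃ b ∈ S.piece j, i + j = k ∧ z = a ⊗ₜ[ℚ] b}
  gradedMonoid :=
    { one_mem := AddSubgroup.subset_closure ⟨0, 0, 1, SetLike.GradedOne.one_mem (A := R.piece), 1,
        SetLike.GradedOne.one_mem (A := S.piece), by simp, rfl⟩
      mul_mem := by
        intro k k' x y hx hy
        induction hx using AddSubgroup.closure_induction with
        | zero => simp [zero_mem]
        | add _ _ _ _ h₁ h₂ => rw [add_mul]; exact add_mem h₁ h₂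
        | neg _ _ h => rw [neg_mul]; exact neg_mem h
        | mem x hx =>
          obtain ⟨i, j, a, ha, b, hb, rfl, rfl⟩ := hx
          induction hy using AddSubgroup.closure_induction with
          | zero => simp [zero_mem]
          | add _ _ _ _ h₁ h₂ => rw [mul_add]; exact add_mem h₁ h₂
          | neg _ _ h => rw [mul_neg]; exact neg_mem h
          | mem y hy =>
            obtain ⟨i', j', a', ha', b', hb', rfl, rfl⟩ := hy
            exact AddSubgroup.subset_closure ⟨i + i', j + j', a * a',
              SetLike.mul_mem_graded ha ha', b * b', SetLike.mul_mem_graded hb hb', by ring,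
              Algebra.TensorProduct.tmul_mul_tmul a a' b b'⟩ }
  internal := by
    classical
    refine isInternal_of_proj _ (fun p : ℤ × ℤ => p.1 + p.2)
      (fun p => (TensorProduct.map (R.proj p.1).toRatLinearMap
        (S.proj p.2).toRatLinearMap).toAddMonoidHom) ?_ ?_ ?_
    · rintro ⟨i, j⟩ x
      induction x using TensorProduct.induction_on with
      | zero => simp [zero_mem]
      | add x y hx hy => rw [map_add]; exact add_mem hx hy
      | tmul a b =>
        exact AddSubgroup.subset_closure
          ⟨i, j, _, R.proj_mem i a, _, S.proj_mem j b, rfl, rfl⟩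
    · rintro k x hx ⟨i, j⟩ hij
      induction hx using AddSubgroup.closure_induction with
      | zero => simp
      | add x y _ _ hx hy => rw [map_add, hx, hy, add_zero]
      | neg x _ hx => rw [map_neg, hx, neg_zero]
      | mem x hx =>
        obtain ⟨i', j', a, ha, b, hb, rfl, rfl⟩ := hx
        change (R.proj i a) ⊗ₜ[ℚ] (S.proj j b) = 0
        by_cases hi : i' = i
        · have hj : j' ≠ j := fun hj => hij (by rw [hi, hj])
          rw [S.proj_of_mem_ne hb hj, TensorProduct.tmul_zero]
        · rw [R.proj_of_mem_ne ha hi, TensorProduct.zero_tmul]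
    · intro x
      suffices h : ∃ s : Finset (ℤ × ℤ), ∀ s', s ⊆ s' → x = ∑ p ∈ s', TensorProduct.map
          (R.proj p.1).toRatLinearMap (S.proj p.2).toRatLinearMap x by
        obtain ⟨s, hs⟩ := h
        exact ⟨s, hs s subset_rfl⟩
      induction x using TensorProduct.induction_on with
      | zero => exact ⟨∅, fun _ _ => by simp⟩
      | add x y hx hy =>
        obtain ⟨s, hs⟩ := hx
        obtain ⟨t, ht⟩ := hy
        refine ⟨s ∪ t, fun s' h => ?_⟩
        simp only [map_add, Finset.sum_add_distrib]
        rw [← hs s' (Finset.union_subset_left h), ← ht s' (Finset.union_subset_right h)]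
      | tmul a b =>
        obtain ⟨s, hs⟩ := R.exists_sum_proj_of_subset a
        obtain ⟨t, ht⟩ := S.exists_sum_proj_of_subset b
        have hst : a ⊗ₜ[ℚ] b = ∑ p ∈ s ×ˢ t, TensorProduct.map
            (R.proj p.1).toRatLinearMap (S.proj p.2).toRatLinearMap (a ⊗ₜ[ℚ] b) := by
          conv_lhs => rw [hs s subset_rfl, ht t subset_rfl]
          rw [TensorProduct.sum_tmul, Finset.sum_product]
          refine Finset.sum_congr rfl fun i _ => ?_
          rw [TensorProduct.tmul_sum]
          rfl
        refine ⟨s ×ˢ t, fun s' h => hst.trans (Finset.sum_subset h ?_)⟩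
        rintro ⟨i, j⟩ - hij
        change (R.proj i a) ⊗ₜ[ℚ] (S.proj j b) = 0
        by_cases hi : i ∈ s
        · have hj : j ∉ t := fun hj => hij (Finset.mem_product.2 ⟨hi, hj⟩)
          have h1 := ht _ (Finset.subset_insert j t)
          rw [Finset.sum_insert hj, ← ht t subset_rfl, right_eq_add] at h1
          rw [h1, TensorProduct.tmul_zero]
        · have h1 := hs _ (Finset.subset_insert i s)
          rw [Finset.sum_insert hi, ← hs s subset_rfl, right_eq_add] at h1
          rw [h1, TensorProduct.zero_tmul]

instance (R : GrRing.{u}) (S : GrRing.{v}) [Algebra ℚ R.carrier] [Algebra ℚ S.carrier] :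
    Algebra ℚ (R.tensor S).carrier :=
  inferInstanceAs (Algebra ℚ (R.carrier ⊗[ℚ] S.carrier))

/-- The inclusion of the left factor. -/
def tensorLeft (R : GrRing.{u}) (S : GrRing.{v}) [Algebra ℚ R.carrier] [Algebra ℚ S.carrier] :
    R.Hom (R.tensor S) where
  toRingHom := (Algebra.TensorProduct.includeLeft : R.carrier →ₐ[ℚ] R.carrier ⊗[ℚ] S.carrier).toRingHom
  map_mem := fun i x hx => AddSubgroup.subset_closure
    ⟨i, 0, x, hx, 1, SetLike.GradedOne.one_mem (A := S.piece), by simp, rfl⟩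

/-- The inclusion of the right factor. -/
def tensorRight (R : GrRing.{u}) (S : GrRing.{v}) [Algebra ℚ R.carrier] [Algebra ℚ S.carrier] :
    S.Hom (R.tensor S) where
  toRingHom := (Algebra.TensorProduct.includeRight : S.carrier →ₐ[ℚ] R.carrier ⊗[ℚ] S.carrier).toRingHom
  map_mem := fun i x hx => AddSubgroup.subset_closure
    ⟨0, i, 1, SetLike.GradedOne.one_mem (A := R.piece), x, hx, by simp, rfl⟩

/-- The degree-preserving ring homomorphism `a ⊗ b ↦ f a * g b`. -/
def tensorLift {R : GrRing.{u}} {S : GrRing.{v}} {B : GrRing.{w}} [Algebra ℚ R.carrier]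
    [Algebra ℚ S.carrier] [Algebra ℚ B.carrier] (f : R.Hom B) (g : S.Hom B) :
    (R.tensor S).Hom B where
  toRingHom := (Algebra.TensorProduct.productMap f.toRingHom.toRatAlgHom g.toRingHom.toRatAlgHom :
    R.carrier ⊗[ℚ] S.carrier →ₐ[ℚ] B.carrier).toRingHom
  map_mem := by
    intro k x hx
    refine (AddSubgroup.closure_le ((B.piece k).comap (Algebra.TensorProduct.productMap
      f.toRingHom.toRatAlgHom g.toRingHom.toRatAlgHom).toRingHom.toAddMonoidHom)).2 ?_ hx
    rintro _ ⟨i, j, a, ha, b, hb, rfl, rfl⟩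
    change f.toRingHom a * g.toRingHom b ∈ B.piece (i + j)
    exact SetLike.mul_mem_graded (f.map_mem _ _ ha) (g.map_mem _ _ hb)

end GrRing

/-! ## The diagram of rings of the algebraic model for rational circle spectra -/

/-- The product `∏ₙ ℚ` over the finite subgroups of the circle, indexed by their orders. -/
abbrev FinSub : Type := ℕ+ → ℚ

/-- For `v` zero almost everywhere, `c^{-v} 𝒪_𝓕` inside the graded product `∏ₙ ℚ[c, c⁻¹]` (whose
underlying ring is `(∏ₙ ℚ)[c, c⁻¹]`, as products of graded modules are formed degreewise). -/
def InLattice (v : ℕ+ →₀ ℕ) (f : FinSub[T;T⁻¹]) : Prop :=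
  ∀ (j : ℤ) (n : ℕ+), f.coeff j n ≠ 0 → -(v n : ℤ) ≤ j

theorem InLattice.add {v : ℕ+ →₀ ℕ} {f g : FinSub[T;T⁻¹]} (hf : InLattice v f)
    (hg : InLattice v g) : InLattice v (f + g) := by
  intro j n h
  by_contra hj
  have h1 : f.coeff j n = 0 := by_contra fun h' => hj (hf j n h')
  have h2 : g.coeff j n = 0 := by_contra fun h' => hj (hg j n h')
  exact h (by simp [h1, h2])

theorem InLattice.mono {v v' : ℕ+ →₀ ℕ} (h : v ≤ v') {f : FinSub[T;T⁻¹]} (hf : InLattice v f) :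
    InLattice v' f := by
  intro j n hj
  have := hf j n hj
  have := h n
  omega

theorem InLattice.mul {v v' : ℕ+ →₀ ℕ} {f g : FinSub[T;T⁻¹]} (hf : InLattice v f)
    (hg : InLattice v' g) : InLattice (v + v') (f * g) := by
  classical
  intro j n h
  by_contra hj
  apply h
  have hsum : (f * g).coeff j = ∑ a ∈ f.coeff.support, ∑ b ∈ g.coeff.support,
      if a + b = j then f.coeff a * g.coeff b else 0 := by
    rw [AddMonoidAlgebra.coeff_mul]
    simp only [Finsupp.sum]
  rw [hsum, Finset.sum_apply]
  refine Finset.sum_eq_zero fun a _ => ?_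
  rw [Finset.sum_apply]
  refine Finset.sum_eq_zero fun b _ => ?_
  split_ifs with hab
  · by_contra h0
    have h1 := hf a n (left_ne_zero_of_mul h0)
    have h2 := hg b n (right_ne_zero_of_mul h0)
    rw [Finsupp.add_apply] at hj
    push_cast at hj
    omega
  · rfl

theorem InLattice.algebraMap (q : ℚ) :
    InLattice 0 (algebraMap ℚ FinSub[T;T⁻¹] q) := by
  intro j n h
  have : j = 0 := by
    by_contra hj
    apply h
    rw [LaurentPolynomial.algebraMap_apply, LaurentPolynomial.C_apply, if_neg hj]
    rfl
  simp [this]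

/-- The subring `𝒪_𝓕 = ∏ₙ ℚ[c]` of `(∏ₙ ℚ)[c, c⁻¹]`. -/
def OFSub : Subalgebra ℚ FinSub[T;T⁻¹] where
  carrier := {f | InLattice 0 f}
  add_mem' := InLattice.add
  mul_mem' := fun hf hg => by simpa using InLattice.mul hf hg
  algebraMap_mem' := InLattice.algebraMap

/-- The subring `𝓔⁻¹𝒪_𝓕 = colim_v c^{-v} 𝒪_𝓕` of `(∏ₙ ℚ)[c, c⁻¹]`, where `v` runs through the
functions with finite support. -/
def EOFSub : Subalgebra ℚ FinSub[T;T⁻¹] where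
  carrier := {f | ∃ v, InLattice v f}
  add_mem' := by
    rintro f g ⟨v, hf⟩ ⟨v', hg⟩
    exact ⟨v ⊔ v', (hf.mono le_sup_left).add (hg.mono le_sup_right)⟩
  mul_mem' := by
    rintro f g ⟨v, hf⟩ ⟨v', hg⟩
    exact ⟨v + v', hf.mul hg⟩
  algebraMap_mem' := fun q => ⟨0, InLattice.algebraMap q⟩

theorem InLattice.proj {v : ℕ+ →₀ ℕ} {f : FinSub[T;T⁻¹]} (hf : InLattice v f) (i : ℤ) :
    InLattice v ((GrRing.laurent FinSub (-2)).proj i f) := by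
  intro j n h
  refine hf j n fun h' => h ?_
  rw [GrRing.coeff_proj_laurent]
  split_ifs
  · exact h'
  · rfl

/-- `𝒪_𝓕`, with `c` in degree `-2`. -/
def OF : GrRing.{0} :=
  GrRing.sub (GrRing.laurent FinSub (-2)) (𝕜 := ℚ) OFSub fun _ hx i => InLattice.proj hx i

/-- `𝓔⁻¹𝒪_𝓕`, with `c` in degree `-2`. -/
def EOF : GrRing.{0} :=
  GrRing.sub (GrRing.laurent FinSub (-2)) (𝕜 := ℚ) EOFSub
    fun _ ⟨v, hx⟩ i => ⟨v, InLattice.proj hx i⟩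

instance : Algebra ℚ EOF.carrier := inferInstanceAs (Algebra ℚ EOFSub)

theorem OFSub_le_EOFSub : OFSub ≤ EOFSub := fun _ hf => ⟨0, hf⟩

/-- The diagram of graded rings `𝒪_𝓕 → 𝓔⁻¹𝒪_𝓕 ← ℚ`. -/
def sphereFork : RingFork.{0} where
  R₁ := OF
  R₂ := EOF
  R₃ := GrRing.concentrated ℚ
  l :=
    { toRingHom := (Subalgebra.inclusion OFSub_le_EOFSub).toRingHom
      map_mem := fun _ _ h => h }
  ι := GrRing.ratHom EOF

/-- The abelian category `𝒜(𝕋)`: modules over `𝒪_𝓕 → 𝓔⁻¹𝒪_𝓕 ← ℚ` whose structure maps are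
extensions of scalars. -/
abbrev AT : Type (w + 1) := (RingFork.extended.{0, w} sphereFork).FullSubcategory

/-! ## Points and functions on an elliptic curve -/

/-- A place of an extension `L` of `K`: a non-trivial valuation ring of `L` that contains `K`.  The
places of the function field of a smooth projective curve are the local rings of its closed
points. -/
structure Place (K : Type u) (L : Type v) [Field K] [Field L] [Algebra K L] where
  ring : ValuationSubring L
  const_mem : ∀ a : K, algebraMap K L a ∈ ring
  ne_top : ring ≠ ⊤

section Curve

variable {K : Type u} [Field K] (W : WeierstrassCurve K)

/-- The field of rational functions on the curve. -/
def FF : Type u := W.toAffine.FunctionField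

instance : Field (FF W) := inferInstanceAs (Field W.toAffine.FunctionField)

instance : Algebra W.toAffine.CoordinateRing (FF W) :=
  inferInstanceAs (Algebra W.toAffine.CoordinateRing W.toAffine.FunctionField)

instance : IsFractionRing W.toAffine.CoordinateRing (FF W) :=
  inferInstanceAs (IsFractionRing W.toAffine.CoordinateRing W.toAffine.FunctionField)

instance : Algebra K (FF W) :=
  inferInstanceAs (Algebra K W.toAffine.FunctionField)

instance : IsScalarTower K W.toAffine.CoordinateRing (FF W) :=
  inferInstanceAs (IsScalarTower K W.toAffine.CoordinateRing W.toAffine.FunctionField)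

instance [CharZero K] : CharZero (FF W) :=
  charZero_of_injective_algebraMap (algebraMap K (FF W)).injective

/-- The Weierstrass coordinate `x`. -/
def xF : FF W :=
  algebraMap W.toAffine.CoordinateRing (FF W)
    (WeierstrassCurve.Affine.CoordinateRing.mk W.toAffine (Polynomial.C Polynomial.X))

/-- The Weierstrass coordinate `y`. -/
def yF : FF W :=
  algebraMap W.toAffine.CoordinateRing (FF W)
    (WeierstrassCurve.Affine.CoordinateRing.mk W.toAffine Polynomial.X)

theorem equation_xF_yF : (W.toAffine.map (algebraMap K (FF W))).Equation (xF W) (yF W) := by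
  have hC : ∀ a : K, algebraMap K (FF W) a = algebraMap W.toAffine.CoordinateRing (FF W)
      (WeierstrassCurve.Affine.CoordinateRing.mk W.toAffine
        (Polynomial.C (Polynomial.C a))) := fun a =>
    IsScalarTower.algebraMap_apply K W.toAffine.CoordinateRing W.toAffine.FunctionField a
  have h0 : WeierstrassCurve.Affine.CoordinateRing.mk W.toAffine W.toAffine.polynomial = 0 :=
    AdjoinRoot.mk_self
  have h1 := congrArg (algebraMap W.toAffine.CoordinateRing (FF W)) h0
  rw [WeierstrassCurve.Affine.equation_iff']
  simp only [WeierstrassCurve.Affine.polynomial, map_sub, map_add, map_mul, map_pow,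
    map_zero] at h1
  simp only [WeierstrassCurve.map, hC, xF, yF]
  linear_combination h1

/-- A closed point of the curve. -/
abbrev ClosedPoint : Type u := Place K (FF W)

attribute [irreducible] FF

variable {W}

namespace Place

/-- The residue field. -/
abbrev residue (p : ClosedPoint W) : Type u := IsLocalRing.ResidueField p.ring

/-- The constants in the local ring. -/
def const (p : ClosedPoint W) : K →+* p.ring :=
  (algebraMap K (FF W)).codRestrict p.ring.toSubring p.const_mem

/-- The constants in the residue field. -/
def toResidue (p : ClosedPoint W) : K →+* p.residue :=
  (IsLocalRing.residue p.ring).comp p.const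

theorem equation (p : ClosedPoint W) (hx : xF W ∈ p.ring) (hy : yF W ∈ p.ring) :
    (W.toAffine.map p.toResidue).Equation (IsLocalRing.residue p.ring ⟨xF W, hx⟩)
      (IsLocalRing.residue p.ring ⟨yF W, hy⟩) := by
  have h : (W.toAffine.map p.const).Equation ⟨xF W, hx⟩ ⟨yF W, hy⟩ := by
    rw [← WeierstrassCurve.Affine.map_equation (f := p.ring.subtype) _ Subtype.val_injective]
    exact equation_xF_yF W
  exact h.map (IsLocalRing.residue p.ring)

open Classical in
/-- The point of the elliptic curve with coordinates in the residue field that is defined by a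
closed point: the reduction of `(x, y)` if `x` and `y` are regular, and the identity `e` of the
group otherwise. -/
def toPoint [W.IsElliptic] (p : ClosedPoint W) : (W.toAffine.map p.toResidue).Point :=
  if h : xF W ∈ p.ring ∧ yF W ∈ p.ring then
    WeierstrassCurve.Affine.Point.mk (p.equation h.1 h.2)
  else 0

open Classical in
/-- The order of a closed point in the group of points over its residue field (`0` if it has
infinite order). -/
def order [W.IsElliptic] (p : ClosedPoint W) : ℕ := addOrderOf p.toPoint

end Place

theorem Place.rat_mem [CharZero K] (p : ClosedPoint W) (q : ℚ) :
    algebraMap ℚ (FF W) q ∈ p.ring := by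
  have := p.const_mem (q : K)
  rwa [map_ratCast, ← eq_ratCast (algebraMap ℚ (FF W))] at this

variable [W.IsElliptic]

/-- The semilocal ring `𝒪_{C⟨n⟩}` of functions that are regular at all the points of exact
order `n`. -/
def regularAt (W : WeierstrassCurve K) [W.IsElliptic] (n : ℕ+) : Subring (FF W) :=
  ⨅ (p : ClosedPoint W) (_ : p.order = n), p.ring.toSubring

theorem mem_regularAt {n : ℕ+} {f : FF W} :
    f ∈ regularAt W n ↔ ∀ p : ClosedPoint W, p.order = n → f ∈ p.ring := by
  simp [regularAt, Subring.mem_iInf]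

variable [CharZero K]

/-- The ring `𝒦` of meromorphic functions with poles only at points of finite order. -/
def mero (W : WeierstrassCurve K) [W.IsElliptic] : Subalgebra ℚ (FF W) where
  carrier := {f | {p : ClosedPoint W | f ∉ p.ring}.Finite ∧
    ∀ p : ClosedPoint W, f ∉ p.ring → 0 < p.order}
  add_mem' := by
    rintro f g ⟨hf, hf'⟩ ⟨hg, hg'⟩
    have h : ∀ p : ClosedPoint W, f + g ∉ p.ring → f ∉ p.ring ∨ g ∉ p.ring := by
      intro p hp
      by_contra! h
      exact hp (add_mem h.1 h.2)
    exact ⟨(hf.union hg).subset h, fun p hp => (h p hp).elim (hf' p) (hg' p)⟩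
  mul_mem' := by
    rintro f g ⟨hf, hf'⟩ ⟨hg, hg'⟩
    have h : ∀ p : ClosedPoint W, f * g ∉ p.ring → f ∉ p.ring ∨ g ∉ p.ring := by
      intro p hp
      by_contra! h
      exact hp (mul_mem h.1 h.2)
    exact ⟨(hf.union hg).subset h, fun p hp => (h p hp).elim (hf' p) (hg' p)⟩
  algebraMap_mem' := fun q =>
    ⟨Set.finite_empty.subset fun p hp => hp (p.rat_mem q), fun p hp => absurd (p.rat_mem q) hp⟩

/-- `P𝒦 = ⨁ₙ 𝒦 ⊗ Ωⁿ`, with `Ωⁿ` in degree `2 n`.  The sheaf of differentials is trivialized by the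
invariant differential `ω = dx / (2 y + a₁ x + a₃)`, which has neither zeros nor poles, and the
variable `T` stands for `ω`. -/
abbrev PK (W : WeierstrassCurve K) [W.IsElliptic] : GrRing.{u} := GrRing.laurent (mero W) 2

/-- Rational sections of the tensor powers of the sheaf of differentials. -/
abbrev PFF (W : WeierstrassCurve K) : GrRing.{u} := GrRing.laurent (FF W) 2

variable (W) in
/-- Coordinate data on the elliptic curve. -/
structure CoordinateData where
  /-- The functions `t₁, t₂, …`. -/
  t : ℕ+ → FF W
  t_ne_zero : ∀ n, t n ≠ 0
  /-- `tₙ` vanishes to the first order at the points of exact order `n`. -/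
  vanishing : ∀ (n : ℕ+) (p : ClosedPoint W), p.order = n →
    ∃ h : t n ∈ p.ring, IsLocalRing.maximalIdeal p.ring = Ideal.span {⟨t n, h⟩}
  /-- The regular differential `Dt` is `lam • ω`. -/
  lam : Kˣ
  /-- `Dt` agrees with `dt₁` at the identity: as `ω` agrees with `dz` there, where `z = - x / y`,
  this says that `t₁ / z` takes the value `lam` at the identity. -/
  agrees : ∀ p : ClosedPoint W, p.order = 1 →
    -(t 1 * yF W / xF W) - algebraMap K (FF W) lam ∈ p.ring.nonunits

namespace CoordinateData

variable (D : CoordinateData W)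

theorem div_mul_div (n : ℕ+) : D.t n / algebraMap K (FF W) D.lam *
    (algebraMap K (FF W) D.lam / D.t n) = 1 := by
  have h1 := D.t_ne_zero n
  have h2 : algebraMap K (FF W) D.lam ≠ 0 := by simp
  field_simp

/-- `tₙ / Dt`, a rational section of `Ω⁻¹`. -/
def euler (n : ℕ+) : (FF W)[T;T⁻¹]ˣ where
  val := LaurentPolynomial.C (D.t n / algebraMap K (FF W) D.lam) * LaurentPolynomial.T (-1)
  inv := LaurentPolynomial.C (algebraMap K (FF W) D.lam / D.t n) * LaurentPolynomial.T 1
  val_inv := by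
    rw [mul_mul_mul_comm, ← map_mul, D.div_mul_div, ← LaurentPolynomial.T_add]
    simp
  inv_val := by
    rw [mul_mul_mul_comm, ← map_mul, mul_comm (algebraMap K (FF W) D.lam / D.t n),
      D.div_mul_div, ← LaurentPolynomial.T_add]
    simp

theorem C_mul_T_mem (a : FF W) (j : ℤ) :
    (LaurentPolynomial.C a * LaurentPolynomial.T j : (FF W)[T;T⁻¹]) ∈ (PFF W).piece (2 * j) := by
  intro m hm
  rw [← LaurentPolynomial.single_eq_C_mul_T, AddMonoidAlgebra.coeff_single] at hm
  by_cases h : m = j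
  · rw [h]
  · exact absurd (Finsupp.single_eq_of_ne h) hm

theorem rat_mem_piece (q : ℚ) : algebraMap ℚ (FF W)[T;T⁻¹] q ∈ (PFF W).piece 0 := by
  have := C_mul_T_mem (W := W) (algebraMap ℚ (FF W) q) 0
  rwa [LaurentPolynomial.T_zero, mul_one, mul_zero] at this

/-- The ring homomorphism `c^v ↦ (tₙ / Dt)^{v(n)}`. -/
def evalEuler (n : ℕ+) : (GrRing.laurent FinSub (-2)).Hom (PFF W) :=
  GrRing.laurentEval (B := PFF W)
    ((algebraMap ℚ (FF W)[T;T⁻¹]).comp (Pi.evalRingHom (fun _ => ℚ) n))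
    (fun _ => rat_mem_piece _) (D.euler n) (C_mul_T_mem _ (-1)) (C_mul_T_mem _ 1)

/-- The ring homomorphism `c^v ⊗ f ↦ (tₙ / Dt)^{v(n)} f` on `𝓔⁻¹𝒪_𝓕 ⊗ P𝒦`. -/
def evalAt (n : ℕ+) : (EOF.tensor (PK W)).Hom (PFF W) :=
  GrRing.tensorLift ((D.evalEuler n).comp (GrRing.subHom _ _ _))
    (GrRing.laurentMap (mero W).val.toRingHom 2)

end CoordinateData

/-- The rational sections of the tensor powers of the sheaf of differentials that are regular at
the points of exact order `n`. -/
def regularSections (W : WeierstrassCurve K) [W.IsElliptic] (n : ℕ+) :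
    Subring (FF W)[T;T⁻¹] where
  carrier := {f | ∀ j, f.coeff j ∈ regularAt W n}
  zero_mem' := fun _ => zero_mem _
  one_mem' := by
    intro j
    rw [← LaurentPolynomial.T_zero, LaurentPolynomial.T_apply]
    split_ifs
    · exact one_mem _
    · exact zero_mem _
  add_mem' := fun hf hg j => add_mem (hf j) (hg j)
  neg_mem' := fun hf j => neg_mem (hf j)
  mul_mem' := by
    classical
    intro f g hf hg j
    rw [AddMonoidAlgebra.coeff_mul]
    refine sum_mem fun a _ => sum_mem fun b _ => ?_
    dsimp only
    split_ifs
    · exact mul_mem (hf a) (hg b)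
    · exact zero_mem _

theorem C_mul_T_mem_regularSections {n : ℕ+} {a : FF W} (ha : a ∈ regularAt W n) (j : ℤ) :
    LaurentPolynomial.C a * LaurentPolynomial.T j ∈ regularSections W n := by
  intro m
  rw [← LaurentPolynomial.single_eq_C_mul_T, AddMonoidAlgebra.coeff_single,
    Finsupp.single_apply]
  split_ifs
  · exact ha
  · exact zero_mem _

theorem rat_mem_regularSections (n : ℕ+) (q : ℚ) :
    algebraMap ℚ (FF W)[T;T⁻¹] q ∈ regularSections W n := by
  have := C_mul_T_mem_regularSections (n := n) (a := algebraMap ℚ (FF W) q)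
    (mem_regularAt.2 fun p _ => p.rat_mem q) 0
  rwa [LaurentPolynomial.T_zero, mul_one] at this

/-- The local cohomology `H¹_{C⟨n⟩}(C; P𝒪_C)`, that is the group of principal parts at the points
of exact order `n`: rational sections modulo those regular at these points. -/
abbrev PrincipalParts (W : WeierstrassCurve K) [W.IsElliptic] (n : ℕ+) : Type u :=
  (FF W)[T;T⁻¹] ⧸ (regularSections W n).toAddSubgroup

namespace CoordinateData

variable (D : CoordinateData W)

/-- The `n`-th component `c^v ⊗ f ↦ (tₙ / Dt)^{v(n)} f` of the principal part map. -/
def principalPart (n : ℕ+) : (EOF.tensor (PK W)).carrier →+ PrincipalParts W n :=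
  (QuotientAddGroup.mk' (regularSections W n).toAddSubgroup).comp
    (D.evalAt n).toRingHom.toAddMonoidHom

theorem principalPart_eq_zero_iff {n : ℕ+} {z : (EOF.tensor (PK W)).carrier} :
    D.principalPart n z = 0 ↔ (D.evalAt n).toRingHom z ∈ regularSections W n :=
  QuotientAddGroup.eq_zero_iff _

/-- The underlying ring of `NC`: the kernel of the principal part map. -/
def NCSub : Subalgebra ℚ (EOF.tensor (PK W)).carrier where
  carrier := {z | ∀ n, D.principalPart n z = 0}
  add_mem' := fun ha hb n => by rw [map_add, ha n, hb n, add_zero]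
  mul_mem' := fun ha hb n => by
    have h1 := D.principalPart_eq_zero_iff.1 (ha n)
    have h2 := D.principalPart_eq_zero_iff.1 (hb n)
    rw [principalPart_eq_zero_iff, map_mul]
    exact mul_mem h1 h2
  algebraMap_mem' := fun q n => by
    rw [principalPart_eq_zero_iff]
    have h : (D.evalAt n).toRingHom (algebraMap ℚ (EOF.tensor (PK W)).carrier q) =
        algebraMap ℚ (FF W)[T;T⁻¹] q :=
      RingHom.congr_fun (RingHom.ext_rat ((D.evalAt n).toRingHom.comp
        (algebraMap ℚ (EOF.tensor (PK W)).carrier)) (algebraMap ℚ (FF W)[T;T⁻¹])) q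
    rw [h]
    exact rat_mem_regularSections n q

theorem proj_mem_NCSub {z : (EOF.tensor (PK W)).carrier} (hz : z ∈ D.NCSub) (i : ℤ) :
    (EOF.tensor (PK W)).proj i z ∈ D.NCSub := by
  intro n
  have h := D.principalPart_eq_zero_iff.1 (hz n)
  rw [principalPart_eq_zero_iff, ← GrRing.Hom.map_proj]
  intro j
  refine (congrArg (· ∈ regularAt W n) (GrRing.coeff_proj_laurent (A := FF W) (d := 2) i
    ((D.evalAt n).toRingHom z) j)).mpr ?_
  split_ifs
  · exact h j
  · exact zero_mem _

theorem euler_mem (n : ℕ+) : (D.euler n : (FF W)[T;T⁻¹]) ∈ regularSections W n := by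
  refine C_mul_T_mem_regularSections (mem_regularAt.2 fun p hp => ?_) (-1)
  obtain ⟨h, -⟩ := D.vanishing n p hp
  rw [div_eq_mul_inv, ← map_inv₀]
  exact mul_mem h (p.const_mem _)

theorem left_mem_NCSub (a : OFSub) : (GrRing.tensorLeft EOF (PK W)).toRingHom
    (sphereFork.l.toRingHom a) ∈ D.NCSub := by
  intro n
  rw [principalPart_eq_zero_iff]
  have h1 : (D.evalAt n).toRingHom ((GrRing.tensorLeft EOF (PK W)).toRingHom
      (sphereFork.l.toRingHom a)) = (D.evalEuler n).toRingHom (a : FinSub[T;T⁻¹]) := by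
    change (D.evalEuler n).toRingHom (a : FinSub[T;T⁻¹]) *
      (GrRing.laurentMap (mero W).val.toRingHom 2).toRingHom 1 = _
    rw [map_one, mul_one]
  rw [h1]
  obtain ⟨f, hf⟩ := a
  have hsum : f = ∑ j ∈ f.coeff.support, LaurentPolynomial.C (f.coeff j) *
      LaurentPolynomial.T j := by
    simp only [← LaurentPolynomial.single_eq_C_mul_T]
    exact (AddMonoidAlgebra.sum_coeff_single f).symm
  have h2 : LaurentPolynomial.eval₂ ((algebraMap ℚ (FF W)[T;T⁻¹]).comp
      (Pi.evalRingHom (fun _ => ℚ) n)) (D.euler n) f ∈ regularSections W n := by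
    rw [hsum, map_sum]
    refine sum_mem fun j _ => ?_
    rw [LaurentPolynomial.eval₂_C_mul_T]
    by_cases h0 : f.coeff j n = 0
    · have : ((algebraMap ℚ (FF W)[T;T⁻¹]).comp (Pi.evalRingHom (fun _ => ℚ) n)) (f.coeff j) =
          0 := by simp [h0]
      rw [this, zero_mul]
      exact zero_mem _
    · have hj : 0 ≤ j := by simpa using hf j n h0
      obtain ⟨m, rfl⟩ := Int.eq_ofNat_of_zero_le hj
      refine mul_mem (rat_mem_regularSections n _) ?_
      rw [zpow_natCast, Units.val_pow_eq_pow_val]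
      exact pow_mem (D.euler_mem n) m
  exact h2

/-- `NC`, the kernel of the principal part map
`𝓔⁻¹𝒪_𝓕 ⊗ P𝒦 → ⨁ₙ H¹_{C⟨n⟩}(C; P𝒪_C)`: the elements all of whose components vanish. -/
def NC : GrRing.{u} := (EOF.tensor (PK W)).sub D.NCSub fun _ hz i => D.proj_mem_NCSub hz i

/-- The commutative monoid `EC_a = (NC → 𝓔⁻¹𝒪_𝓕 ⊗ P𝒦)`, as a diagram of graded rings
`NC → 𝓔⁻¹𝒪_𝓕 ⊗ P𝒦 ← P𝒦`. -/
def ECa : RingFork.{u} where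
  R₁ := D.NC
  R₂ := EOF.tensor (PK W)
  R₃ := PK W
  l := GrRing.subHom _ _ _
  ι := GrRing.tensorRight _ _

/-- The unit of the commutative monoid `EC_a`. -/
def unit : sphereFork.Hom D.ECa where
  h₁ :=
    { toRingHom := ((GrRing.tensorLeft EOF (PK W)).toRingHom.comp
        sphereFork.l.toRingHom).codRestrict D.NCSub.toSubring D.left_mem_NCSub
      map_mem := fun i x hx => (GrRing.tensorLeft EOF (PK W)).map_mem i _
        (sphereFork.l.map_mem i x hx) }
  h₂ := GrRing.tensorLeft EOF (PK W)
  h₃ := GrRing.ratHom (PK W)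
  comm_l := fun _ => rfl
  comm_ι := fun r => RingHom.congr_fun (RingHom.ext_rat
    ((GrRing.tensorLeft EOF (PK W)).toRingHom.comp (algebraMap ℚ EOF.carrier))
    ((GrRing.tensorRight EOF (PK W)).toRingHom.comp (algebraMap ℚ (PK W).carrier))) r

/-- The category of `EC_a`-modules in `𝒜(𝕋)`.  As the tensor product of modules over
`𝒪_𝓕 → 𝓔⁻¹𝒪_𝓕 ← ℚ` is formed objectwise, an action of the monoid `EC_a` on an object `N → P ← V`
amounts to the structure of a module over the diagram of rings `EC_a` that restricts along the
unit to the given structure; the underlying object has to lie in `𝒜(𝕋)`. -/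
abbrev ECaMod : Type (max u (w + 1)) :=
  ObjectProperty.FullSubcategory (C := ForkMod.{u, w} D.ECa) fun X =>
    RingFork.extended sphereFork (X.restrict D.unit)

end CoordinateData

/-! ## The category `𝒜(PC)` -/

/-- The torsion points of the curve. -/
abbrev TorsionPoint (W : WeierstrassCurve K) [W.IsElliptic] : Type u :=
  {p : ClosedPoint W // 0 < p.order}

/-- The completed local ring at a closed point. -/
abbrev Place.completion (p : ClosedPoint W) : Type u :=
  AdicCompletion (IsLocalRing.maximalIdeal p.ring) p.ring

/-- The ring `∏ₙ Γ𝒪^∧_{C⟨n⟩}`, the product of the completed local rings at all the torsion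
points. -/
abbrev CompletedRing (W : WeierstrassCurve K) [W.IsElliptic] : Type u :=
  ∀ p : TorsionPoint W, p.1.completion

/-- The families of local equations of effective divisors of torsion points: a nonzero element of
each local ring, and a unit at almost all torsion points. -/
def localEquations (W : WeierstrassCurve K) [W.IsElliptic] :
    Submonoid (∀ p : TorsionPoint W, p.1.ring) where
  carrier := {s | (∀ p, s p ≠ 0) ∧ {p | ¬ IsUnit (s p)}.Finite}
  one_mem' := ⟨fun _ => one_ne_zero, by simp⟩
  mul_mem' := by
    rintro s s' ⟨h₁, h₂⟩ ⟨h₁', h₂'⟩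
    refine ⟨fun p => mul_ne_zero (h₁ p) (h₁' p), (h₂.union h₂').subset fun p hp => ?_⟩
    by_contra h
    rw [Set.mem_union, not_or] at h
    exact hp ((not_not.1 h.1).mul (not_not.1 h.2))

/-- The completion map, at all the torsion points. -/
def toCompleted (W : WeierstrassCurve K) [W.IsElliptic] :
    (∀ p : TorsionPoint W, p.1.ring) →+* CompletedRing W :=
  RingHom.pi fun p => (algebraMap p.1.ring p.1.completion).comp (Pi.evalRingHom _ p)

/-- The ring `𝒦 ⊗_{𝒪_C} ∏ₙ Γ𝒪^∧_{C⟨n⟩} = colim_D 𝒪_C(D) ⊗_{𝒪_C} ∏ₙ Γ𝒪^∧_{C⟨n⟩}`, where `D` runs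
through the effective divisors of torsion points: the local equations of such divisors are
inverted. -/
abbrev MeroCompletedRing (W : WeierstrassCurve K) [W.IsElliptic] : Type u :=
  Localization ((localEquations W).map (toCompleted W))

open Classical in
/-- A numerator of a function at the torsion points: the function itself where it is regular, and
`1` elsewhere. -/
def num (f : FF W) (p : TorsionPoint W) : p.1.ring :=
  if h : f ∈ p.1.ring then ⟨f, h⟩ else 1

open Classical in
/-- The corresponding denominator. -/
def den (f : FF W) (p : TorsionPoint W) : p.1.ring :=
  if h : f ∈ p.1.ring then 1 else ⟨f⁻¹, (p.1.ring.mem_or_inv_mem f).resolve_left h⟩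

theorem coe_num (f : FF W) (p : TorsionPoint W) : (num f p : FF W) = f * (den f p : FF W) := by
  by_cases h : f ∈ p.1.ring
  · simp [num, den, h]
  · have h0 : f ≠ 0 := fun h0 => h (h0 ▸ zero_mem _)
    simp [num, den, h, h0]

theorem den_mem (f : mero W) : den (f : FF W) ∈ localEquations W := by
  refine ⟨fun p => ?_, ?_⟩
  · by_cases h : (f : FF W) ∈ p.1.ring
    · simp [den, h]
    · have h0 : (f : FF W) ≠ 0 := fun h0 => h (h0 ▸ zero_mem _)
      intro h1
      simp [den, h, Subtype.ext_iff, h0] at h1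
  · refine (f.2.1.preimage (Subtype.val_injective.injOn
      (s := Subtype.val ⁻¹' {p : ClosedPoint W | (f : FF W) ∉ p.ring}))).subset fun p hp => ?_
    intro h
    apply hp
    have h' : (f : FF W) ∈ p.1.ring := h
    simp [den, h']

/-- The fraction `a / s` in `𝒦 ⊗_{𝒪_C} ∏ₙ Γ𝒪^∧_{C⟨n⟩}`. -/
def fraction (a : ∀ p : TorsionPoint W, p.1.ring) (s : localEquations W) : MeroCompletedRing W :=
  Localization.mk (toCompleted W a)
    ⟨toCompleted W s.1, Submonoid.mem_map_of_mem (toCompleted W) s.2⟩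

theorem fraction_eq {a a' : ∀ p : TorsionPoint W, p.1.ring} {s s' : localEquations W}
    (h : ∀ p, (a p * s'.1 p : FF W) = a' p * s.1 p) : fraction a s = fraction a' s' := by
  refine Localization.mk_eq_mk_iff.2 (Localization.r_of_eq ?_)
  have h' : s'.1 * a = s.1 * a' := by
    funext p
    refine Subtype.ext ?_
    have := h p
    change (s'.1 p : FF W) * a p = s.1 p * a' p
    rw [mul_comm, this, mul_comm]
  change toCompleted W s'.1 * toCompleted W a = toCompleted W s.1 * toCompleted W a'
  rw [← map_mul, ← map_mul, h']

/-- The map `𝒦 → 𝒦 ⊗_{𝒪_C} ∏ₙ Γ𝒪^∧_{C⟨n⟩}` that expands a function at all the torsion points. -/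
def expansion (W : WeierstrassCurve K) [W.IsElliptic] : mero W →+* MeroCompletedRing W where
  toFun f := fraction (num f) ⟨den f, den_mem f⟩
  map_one' := by
    have h : fraction (W := W) 1 1 = 1 := by
      have h1 : (⟨toCompleted W (1 : localEquations W).1,
          Submonoid.mem_map_of_mem (toCompleted W) (1 : localEquations W).2⟩ :
            (localEquations W).map (toCompleted W)) = 1 := Subtype.ext (map_one _)
      rw [fraction, h1, map_one, Localization.mk_one]
    rw [← h]
    refine fraction_eq fun p => ?_
    simp [coe_num]
  map_zero' := by
    have h : fraction (W := W) 0 1 = 0 := by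
      rw [fraction, map_zero, Localization.mk_zero]
    rw [← h]
    refine fraction_eq fun p => ?_
    simp [coe_num]
  map_mul' f g := by
    have h : fraction (num (f : FF W)) ⟨den f, den_mem f⟩ *
        fraction (num (g : FF W)) ⟨den g, den_mem g⟩ =
        fraction (num (f : FF W) * num (g : FF W)) (⟨den f, den_mem f⟩ * ⟨den g, den_mem g⟩) := by
      simp only [fraction, Localization.mk_mul, map_mul]
      congr 1
    rw [h]
    refine fraction_eq fun p => ?_
    simp [coe_num]
    ring
  map_add' f g := by
    have h : fraction (num (f : FF W)) ⟨den f, den_mem f⟩ +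
        fraction (num (g : FF W)) ⟨den g, den_mem g⟩ =
        fraction (den (f : FF W) * num (g : FF W) + den (g : FF W) * num (f : FF W))
          (⟨den f, den_mem f⟩ * ⟨den g, den_mem g⟩) := by
      simp only [fraction, Localization.add_mk, map_mul, map_add]
      congr 1
    rw [h]
    refine fraction_eq fun p => ?_
    simp [coe_num]
    ring

/-- The periodic diagram of graded rings
`∏ₙ Γ𝒪^∧_{C⟨n⟩} → 𝒦 ⊗_{𝒪_C} ∏ₙ Γ𝒪^∧_{C⟨n⟩} ← 𝒦`; the variable `T` stands for the invariant
differential `ω`, in degree `2`. -/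
def curveFork (W : WeierstrassCurve K) [W.IsElliptic] : RingFork.{u} where
  R₁ := GrRing.laurent (CompletedRing W) 2
  R₂ := GrRing.laurent (MeroCompletedRing W) 2
  R₃ := PK W
  l := GrRing.laurentMap (algebraMap (CompletedRing W) (MeroCompletedRing W)) 2
  ι := GrRing.laurentMap (expansion W) 2

/-- The category `𝒜(PC)`: modules over the periodic diagram of rings of the curve whose structure
maps are extensions of scalars. -/
abbrev APC (W : WeierstrassCurve K) [W.IsElliptic] : Type (max u (w + 1)) :=
  (RingFork.extended.{u, w} (curveFork W)).FullSubcategory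

end Curve

end EllipticModel

end

noncomputable section

set_option linter.unusedSectionVars false

namespace EllipticModel

/-! ## Flatness and gluing -/

/-! Write `A → B ← C` for the diagram `EC_a`, so that `A = NC`, `B = 𝓔⁻¹𝒪_𝓕 ⊗ P𝒦`, `C = P𝒦`, and `A'
→ B' ← C` for the diagram of the curve. Sending `c^v ⊗ f` to the expansions of `(tₙ / Dt)^{v(n)} f`
at the points of order `n`, for all `n` at once, gives a map of diagrams that is the identity on `C`
(`toCurve`). The equivalence is extension of scalars along this map.

A module over `EC_a` has its underlying object in `𝒜(𝕋)` exactly when it is extended over `EC_a`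
(`extended_restrict_unit_iff`): `𝒪_𝓕 → 𝓔⁻¹𝒪_𝓕` and `A → B` are localizations at the same Euler
classes, and `B` is the pushout of `𝓔⁻¹𝒪_𝓕` and `P𝒦` over `ℚ`. In particular `EC_a` itself lies in
`𝒜(𝕋)`, and both categories in question consist of extended modules.

Modules over a diagram of rings form an abelian category componentwise, and the extended ones are
closed under cokernels, finite sums and, if the two ring maps are flat, kernels
(`nonempty_abelian_extended`). Here `A → B` and `A' → B'` are localizations, `C → B` is a base
change of a map out of `ℚ`, and `C → B'` is flat because every nonzero function in `𝒦` becomes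
invertible when expanded at torsion points only (`isUnit_expand`).

For the equivalence, the square of `A`, `B`, `A'`, `B'` is a fibre product with `B' = A' + B`, so
that `0 → A → A' × B → B' → 0` is exact. If it stays exact after tensoring with `N`, then `N` is
recovered as the fibre product of `N'` and `P` over `P'`. As `A'` is not known to be flat over `A`,
injectivity is the point. The obstruction is computed from a free presentation of `B'` over `B`:
tensoring its kernel map with `N` over `A` amounts to tensoring with `P` over `B`, and also with `V`
over `C`, and over `C` injectivity follows from flatness of `B'`
(`rTensor_squareDiag_injective_of_presentation`). This gives full faithfulness. Conversely a module
over the curve is glued by taking `V` unchanged, `P = B ⊗_C V` and `N` the fibre product; `A' ⊗_A N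
→ N'` is then bijective by clearing denominators with Euler classes (`IsGluingSquare.isBaseChange`).

The geometric input is the two properties of the square. It is a fibre product because a family of
functions with regular expansions is regular (`mem_everywhereRegular_of_eq`), which is the vanishing
of principal parts. The identity `B' = A' + B` is a partial fraction statement
(`exists_eq_map_add_toMCR`): modulo `A'` only finitely many principal parts remain, and each is that
of some `c^{-j} ⊗ f`, where `f` in `𝒦` is found by approximation at the finitely many points of
order `n`. The approximation takes place in Dedekind domains attached to two affine charts, where
`x` respectively `1 / ψ` is regular, with `ψ = (2 y + a₁ x + a₃)²`. The complement of each chart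
consists of torsion points, so functions on either chart belong to `𝒦`. -/

theorem rTensor_injective_of_flat_of_exact {R J G Q L F X : Type*} [CommRing R] [AddCommGroup J]
    [AddCommGroup G] [AddCommGroup Q] [AddCommGroup L] [AddCommGroup F] [AddCommGroup X]
    [Module R J] [Module R G] [Module R Q] [Module R L] [Module R F] [Module R X]
    {f : J →ₗ[R] G} {g : G →ₗ[R] Q} {i : L →ₗ[R] F} {π : F →ₗ[R] X}
    (hf : Function.Injective f) (hfg : Function.Exact f g) (hg : Function.Surjective g)
    (hi : Function.Injective i) (hiπ : Function.Exact i π) (hπ : Function.Surjective π)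
    [Module.Flat R Q] [Module.Flat R F] : Function.Injective (f.rTensor X) := by
  rw [injective_iff_map_eq_zero]
  intro x hx
  -- A chase for the vanishing of Tor₁ of `Q` and `X`: the image of a lift `y` in `G ⊗ F` comes from
  -- some `z` in `G ⊗ L`; flatness of `Q` moves `z` back to `w` in `J ⊗ L`, and flatness of `F`
  -- identifies `y` with the image of `w`, which dies in `J ⊗ X`.
  obtain ⟨y, rfl⟩ := LinearMap.lTensor_surjective J hπ x
  have h1 : π.lTensor G (f.rTensor _ y) = 0 := by
    rw [← hx, ← LinearMap.comp_apply, ← LinearMap.comp_apply, LinearMap.lTensor_comp_rTensor,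
      LinearMap.rTensor_comp_lTensor]
  obtain ⟨z, hz⟩ := (lTensor_exact G hiπ hπ _).1 h1
  have h2 : i.lTensor Q (g.rTensor _ z) = 0 := by
    have : i.lTensor Q (g.rTensor _ z) = g.rTensor _ (i.lTensor G z) := by
      rw [← LinearMap.comp_apply, ← LinearMap.comp_apply, LinearMap.lTensor_comp_rTensor,
        LinearMap.rTensor_comp_lTensor]
    rw [this, hz]
    exact (rTensor_exact _ hfg hg).apply_apply_eq_zero y
  have h3 : g.rTensor _ z = 0 :=
    (map_eq_zero_iff _ (Module.Flat.lTensor_preserves_injective_linearMap i hi)).1 h2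
  obtain ⟨w, rfl⟩ := (rTensor_exact _ hfg hg _).1 h3
  have h4 : f.rTensor _ (i.lTensor J w) = f.rTensor _ y := by
    rw [← hz, ← LinearMap.comp_apply, ← LinearMap.comp_apply, LinearMap.lTensor_comp_rTensor,
      LinearMap.rTensor_comp_lTensor]
  have h5 := Module.Flat.rTensor_preserves_injective_linearMap f hf h4
  rw [← h5]
  exact (lTensor_exact J hiπ hπ).apply_apply_eq_zero w

theorem rTensor_injective_of_flat_cokernel {R J G Q : Type*} [CommRing R] [AddCommGroup J]
    [AddCommGroup G] [AddCommGroup Q] [Module R J] [Module R G] [Module R Q] {f : J →ₗ[R] G}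
    {g : G →ₗ[R] Q} (hf : Function.Injective f) (hfg : Function.Exact f g)
    (hg : Function.Surjective g) [Module.Flat R Q] (X : Type*) [AddCommGroup X] [Module R X] :
    Function.Injective (f.rTensor X) :=
  rTensor_injective_of_flat_of_exact
    (L := LinearMap.ker (Finsupp.linearCombination R (id : X → X))) (F := X →₀ R)
    (i := (LinearMap.ker (Finsupp.linearCombination R (id : X → X))).subtype) hf hfg hg
    Subtype.val_injective (LinearMap.exact_subtype_ker_map _)
    (Finsupp.linearCombination_id_surjective R X)

/-- The kernel of the tensor product with `N` does not depend on the presentation of `Q`. -/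
theorem rTensor_injective_of_presentation {R M F J G Q : Type*} [CommRing R] [AddCommGroup M]
    [AddCommGroup F] [AddCommGroup J] [AddCommGroup G] [AddCommGroup Q] [Module R M] [Module R F]
    [Module R J] [Module R G] [Module R Q] {i : M →ₗ[R] F} {δ : F →ₗ[R] Q} {j : J →ₗ[R] G}
    {γ : G →ₗ[R] Q} (hi : Function.Injective i) (hiδ : Function.Exact i δ)
    (hδ : Function.Surjective δ) (hjγ : Function.Exact j γ) (hγ : Function.Surjective γ)
    [Module.Flat R G] {N : Type*} [AddCommGroup N] [Module R N]
    (hj : Function.Injective (j.rTensor N)) : Function.Injective (i.rTensor N) := by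
  -- As in Schanuel's lemma, `H` is the fibre product of `F` and `G` over `Q`. It surjects onto `G`
  -- with kernel `M` and onto `F` with kernel the image of `J`. Flatness of `G` makes `M ⊗ N → H ⊗
  -- N` injective, and an element dying in `F ⊗ N` then comes from `J ⊗ N` and dies in `G ⊗ N`.
  let H : Submodule R (F × G) :=
    LinearMap.ker (δ ∘ₗ LinearMap.fst R F G - γ ∘ₗ LinearMap.snd R F G)
  have hH : ∀ {x}, x ∈ H ↔ δ x.1 = γ x.2 := fun {x} => by
    simp [H, LinearMap.mem_ker, sub_eq_zero]
  let pF : H →ₗ[R] F := LinearMap.fst R F G ∘ₗ H.subtype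
  let pG : H →ₗ[R] G := LinearMap.snd R F G ∘ₗ H.subtype
  let iM : M →ₗ[R] H := (LinearMap.inl R F G ∘ₗ i).codRestrict H fun a => hH.2 (by
    simpa using hiδ.apply_apply_eq_zero a)
  let iJ : J →ₗ[R] H := (LinearMap.inr R F G ∘ₗ j).codRestrict H fun a => hH.2 (by
    simpa using (hjγ.apply_apply_eq_zero a).symm)
  have hpG : Function.Surjective pG := fun g => by
    obtain ⟨x, hx⟩ := hδ (γ g)
    exact ⟨⟨(x, g), hH.2 hx⟩, rfl⟩
  have hiM : Function.Injective iM := fun a a' haa =>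
    hi (congrArg (fun z : H => z.1.1) haa)
  have hMpG : Function.Exact iM pG := by
    rintro ⟨⟨x, g⟩, hx⟩
    constructor
    · intro (hg : g = 0)
      subst hg
      have hx' : δ x = 0 := by simpa using hH.1 hx
      obtain ⟨a, rfl⟩ := (hiδ x).1 hx'
      exact ⟨a, rfl⟩
    · rintro ⟨a, ha⟩
      exact (congrArg (fun z : H => z.1.2) ha).symm
  have hpF : Function.Surjective pF := fun x => by
    obtain ⟨g, hg⟩ := hγ (δ x)
    exact ⟨⟨(x, g), hH.2 hg.symm⟩, rfl⟩
  have hJpF : Function.Exact iJ pF := by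
    rintro ⟨⟨x, g⟩, hx⟩
    constructor
    · intro (hg : x = 0)
      subst hg
      have hx' : γ g = 0 := by simpa using (hH.1 hx).symm
      obtain ⟨a, rfl⟩ := (hjγ g).1 hx'
      exact ⟨a, rfl⟩
    · rintro ⟨a, ha⟩
      exact (congrArg (fun z : H => z.1.1) ha).symm
  rw [injective_iff_map_eq_zero]
  intro x hx
  have h1 : pF.rTensor N (iM.rTensor N x) = 0 := by
    rw [← LinearMap.comp_apply, ← LinearMap.rTensor_comp]
    exact hx
  obtain ⟨y, hy⟩ := (rTensor_exact N hJpF hpF _).1 h1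
  have h2 : j.rTensor N y = 0 := by
    have h3 : pG.rTensor N (iJ.rTensor N y) = 0 := by
      rw [hy]
      exact (rTensor_exact N hMpG hpG).apply_apply_eq_zero x
    rwa [← LinearMap.comp_apply, ← LinearMap.rTensor_comp] at h3
  have h4 : y = 0 := (map_eq_zero_iff _ hj).1 h2
  rw [h4, map_zero] at hy
  exact (map_eq_zero_iff _ (rTensor_injective_of_flat_cokernel hiM hMpG hpG N)).1 hy.symm

/-- Tensoring a `B`-linear map with `N` over `A` or with its base change to `B` over `B` amounts to
the same. -/
theorem rTensor_injective_iff_of_isBaseChange {A B N P J G : Type*} [CommRing A] [CommRing B]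
    [Algebra A B] [AddCommGroup N] [Module A N] [AddCommGroup P] [Module A P] [Module B P]
    [IsScalarTower A B P] {k : N →ₗ[A] P} (hk : IsBaseChange B k) [AddCommGroup J] [Module A J]
    [Module B J] [IsScalarTower A B J] [AddCommGroup G] [Module A G] [Module B G]
    [IsScalarTower A B G] (f : J →ₗ[B] G) :
    Function.Injective ((f.restrictScalars A).rTensor N) ↔ Function.Injective (f.rTensor P) := by
  let eJ : J ⊗[B] P ≃ₗ[B] J ⊗[A] N :=
    (TensorProduct.congr (LinearEquiv.refl B J) hk.equiv.symm).trans
      (TensorProduct.AlgebraTensorModule.cancelBaseChange A B B J N)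
  let eG : G ⊗[B] P ≃ₗ[B] G ⊗[A] N :=
    (TensorProduct.congr (LinearEquiv.refl B G) hk.equiv.symm).trans
      (TensorProduct.AlgebraTensorModule.cancelBaseChange A B B G N)
  have he : ∀ x, (f.restrictScalars A).rTensor N (eJ x) = eG (f.rTensor P x) := by
    intro x
    induction x using TensorProduct.induction_on with
    | zero => simp
    | add x y hx hy => simp only [map_add, hx, hy]
    | tmul j p =>
      obtain ⟨q, rfl⟩ := hk.equiv.surjective p
      simp only [eJ, eG, LinearEquiv.trans_apply, TensorProduct.congr_tmul, LinearEquiv.refl_apply,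
        LinearEquiv.symm_apply_apply, LinearMap.rTensor_tmul]
      induction q using TensorProduct.induction_on with
      | zero => simp
      | add x y hx hy => simp only [TensorProduct.tmul_add, map_add, hx, hy]
      | tmul b n => simp
  have h1 : ⇑((f.restrictScalars A).rTensor N) ∘ eJ = eG ∘ f.rTensor P := funext he
  rw [← EquivLike.injective_comp eJ, h1, EquivLike.comp_injective]

/-! ### Gluing modules along a fibre square of rings -/

section Gluing

variable {A B A' B' C N P V : Type*} [CommRing A] [CommRing B] [CommRing A'] [CommRing B']
  [CommRing C] [Algebra A B] [Algebra A A'] [Algebra A B'] [Algebra B B'] [Algebra A' B']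
  [Algebra C B] [Algebra C B'] [IsScalarTower A B B'] [IsScalarTower A A' B']
  [IsScalarTower C B B'] [AddCommGroup N] [Module A N] [AddCommGroup P] [Module A P] [Module B P]
  [Module C P] [IsScalarTower A B P] [IsScalarTower C B P] [AddCommGroup V] [Module C V]

variable (A B A' B') in
/-- A square of rings that is both a fibre product and a sum. -/
structure IsGluingSquare : Prop where
  injective : Function.Injective (algebraMap A B)
  exists_of_eq : ∀ (a' : A') (b : B), algebraMap A' B' a' = algebraMap B B' b →
    ∃ a, algebraMap A A' a = a' ∧ algebraMap A B a = b
  exists_add : ∀ x : B', ∃ (a' : A') (b : B), x = algebraMap A' B' a' + algebraMap B B' b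

variable (A B A' B') in
/-- The difference map of a square of rings. -/
def squareDiff : (A' × B) →ₗ[A] B' :=
  (IsScalarTower.toAlgHom A A' B').toLinearMap ∘ₗ LinearMap.fst A A' B -
    (IsScalarTower.toAlgHom A B B').toLinearMap ∘ₗ LinearMap.snd A A' B

variable (A B A') in
/-- The diagonal map of a square of rings. -/
def squareDiag : A →ₗ[A] A' × B :=
  (Algebra.linearMap A A').prod (Algebra.linearMap A B)

theorem squareDiff_apply (x : A' × B) :
    squareDiff A B A' B' x = algebraMap A' B' x.1 - algebraMap B B' x.2 := rfl

theorem IsGluingSquare.exact (h : IsGluingSquare A B A' B') :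
    Function.Exact (squareDiag A B A') (squareDiff A B A' B') := by
  rintro ⟨a', b⟩
  rw [squareDiff_apply, sub_eq_zero]
  constructor
  · intro h1
    obtain ⟨a, rfl, rfl⟩ := h.exists_of_eq a' b h1
    exact ⟨a, rfl⟩
  · rintro ⟨a, ha⟩
    rw [← ha]
    change algebraMap A' B' (algebraMap A A' a) = algebraMap B B' (algebraMap A B a)
    rw [← IsScalarTower.algebraMap_apply, ← IsScalarTower.algebraMap_apply]

theorem IsGluingSquare.surjective (h : IsGluingSquare A B A' B') :
    Function.Surjective (squareDiff A B A' B') := by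
  intro x
  obtain ⟨a', b, rfl⟩ := h.exists_add x
  exact ⟨(a', -b), by simp [squareDiff_apply]⟩

/-- The comparison maps for `N`, `P` and `V` are base changes, so `j` tensored with `N` over `A`,
with `P` over `B` or with `V` over `C` is the same map. Over `C` its cokernel `B'` is flat, which
gives injectivity. Flatness of `A'` over `A` is never used; flatness of `B` over `A` makes `G` flat
over `A`, as the change of presentation requires. -/
theorem IsGluingSquare.rTensor_squareDiag_injective_of_presentation
    (h : IsGluingSquare A B A' B') [Module.Flat A B] [Module.Flat C B'] {k : N →ₗ[A] P}
    (hk : IsBaseChange B k) {m : V →ₗ[C] P} (hm : IsBaseChange B m) {J G : Type*}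
    [AddCommGroup J] [AddCommGroup G] [Module B J] [Module B G] [Module.Flat B G]
    {j : J →ₗ[B] G} {γ : G →ₗ[B] B'} (hj : Function.Injective j) (hjγ : Function.Exact j γ)
    (hγ : Function.Surjective γ) : Function.Injective ((squareDiag A B A').rTensor N) := by
  let _ : Module A J := Module.compHom J (algebraMap A B)
  let _ : Module A G := Module.compHom G (algebraMap A B)
  let _ : Module C J := Module.compHom J (algebraMap C B)
  let _ : Module C G := Module.compHom G (algebraMap C B)
  have : IsScalarTower A B J := .of_algebraMap_smul fun _ _ => rfl
  have : IsScalarTower A B G := .of_algebraMap_smul fun _ _ => rfl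
  have : IsScalarTower C B J := .of_algebraMap_smul fun _ _ => rfl
  have : IsScalarTower C B G := .of_algebraMap_smul fun _ _ => rfl
  have hj' : Function.Injective ((j.restrictScalars A).rTensor N) :=
    (rTensor_injective_iff_of_isBaseChange hk j).2
      ((rTensor_injective_iff_of_isBaseChange hm j).1
        (rTensor_injective_of_flat_cokernel (f := j.restrictScalars C)
          (g := γ.restrictScalars C) hj hjγ hγ V))
  have : Module.Flat A G := Module.Flat.trans A B _
  have hdiag : Function.Injective (squareDiag A B A') := fun a a' haa =>
    h.injective (congrArg Prod.snd haa)
  exact rTensor_injective_of_presentation (j := j.restrictScalars A)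
    (γ := γ.restrictScalars A) hdiag h.exact h.surjective hjγ hγ hj'

theorem IsGluingSquare.rTensor_squareDiag_injective (h : IsGluingSquare A B A' B')
    [Module.Flat A B] [Module.Flat C B'] {k : N →ₗ[A] P} (hk : IsBaseChange B k) {m : V →ₗ[C] P}
    (hm : IsBaseChange B m) : Function.Injective ((squareDiag A B A').rTensor N) :=
  h.rTensor_squareDiag_injective_of_presentation
    (J := LinearMap.ker (Finsupp.linearCombination B (id : B' → B'))) (G := B' →₀ B)
    (j := (LinearMap.ker (Finsupp.linearCombination B (id : B' → B'))).subtype) hk hm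
    Subtype.val_injective (LinearMap.exact_subtype_ker_map _)
    (Finsupp.linearCombination_id_surjective B B')

variable {N' P' : Type*} [AddCommGroup N'] [Module A N'] [Module A' N'] [IsScalarTower A A' N']
  [AddCommGroup P'] [Module A P'] [Module B P'] [Module A' P'] [Module B' P']
  [IsScalarTower A A' P'] [IsScalarTower A B P'] [IsScalarTower A' B' P'] [IsScalarTower B B' P']

/-- Tensoring `A → A' × B → B'` with `N` yields `N → N' × P → P'`. Right exactness gives existence,
and uniqueness is the injectivity of the tensored diagonal. -/
theorem IsGluingSquare.existsUnique (h : IsGluingSquare A B A' B')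
    [Module.Flat A B] [Module.Flat C B'] {k : N →ₗ[A] P} (hk : IsBaseChange B k) {m : V →ₗ[C] P}
    (hm : IsBaseChange B m) {α : N →ₗ[A] N'} (hα : IsBaseChange A' α) {β : P →ₗ[B] P'}
    (hβ : IsBaseChange B' β) (k' : N' →ₗ[A'] P') (comm : ∀ n, k' (α n) = β (k n)) (n' : N')
    (p : P) (hnp : k' n' = β p) : ∃! n, α n = n' ∧ k n = p := by
  have : IsScalarTower A B' P' := ⟨fun a b x => by
    rw [Algebra.smul_def, IsScalarTower.algebraMap_apply A B B', mul_smul, algebraMap_smul,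
      algebraMap_smul]⟩
  have hβk : IsBaseChange B' (β.restrictScalars A ∘ₗ k) := hk.comp hβ
  let e : (A' × B) ⊗[A] N ≃ₗ[A] N' × P :=
    (TensorProduct.prodLeft A A A' B N).trans
      ((hα.equiv.restrictScalars A).prodCongr (hk.equiv.restrictScalars A))
  have he1 : ∀ n, e ((squareDiag A B A').rTensor N (1 ⊗ₜ n)) = (α n, k n) := by
    intro n
    have h1 : squareDiag A B A' 1 = (1, 1) := by simp [squareDiag]
    simp [e, h1, IsBaseChange.equiv_tmul]
  have he2 : ∀ x, hβk.equiv ((squareDiff A B A' B').rTensor N x) =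
      k' (e x).1 - β (e x).2 := by
    intro x
    induction x using TensorProduct.induction_on with
    | zero => simp
    | add x y hx hy => simp only [map_add, hx, hy, Prod.fst_add, Prod.snd_add]; abel
    | tmul ab n =>
      obtain ⟨a, b⟩ := ab
      simp [e, IsBaseChange.equiv_tmul, squareDiff_apply, sub_smul, comm]
  obtain ⟨x, hx⟩ := e.surjective (n', p)
  have h1 : (squareDiff A B A' B').rTensor N x = 0 := by
    apply hβk.equiv.injective
    rw [he2, hx, map_zero]
    exact sub_eq_zero.2 hnp
  obtain ⟨y, rfl⟩ := (rTensor_exact N h.exact h.surjective _).1 h1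
  obtain ⟨n, rfl⟩ := (TensorProduct.lid A N).symm.surjective y
  rw [TensorProduct.lid_symm_apply, he1, Prod.mk.injEq] at hx
  refine ⟨n, hx, fun n₂ hn₂ => ?_⟩
  have h2 : e ((squareDiag A B A').rTensor N (1 ⊗ₜ n₂)) =
      e ((squareDiag A B A').rTensor N (1 ⊗ₜ n)) := by
    rw [he1, he1, hx.1, hx.2, hn₂.1, hn₂.2]
  have h3 := h.rTensor_squareDiag_injective hk hm (e.injective h2)
  simpa using congrArg (TensorProduct.lid A N) h3

/-- The fibre product of modules extends to the given module. -/
theorem IsGluingSquare.isBaseChange (h : IsGluingSquare A B A' B')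
    [Module.Flat A B] [Module.Flat C B'] (S : Submonoid A) [IsLocalization S B]
    {k : N →ₗ[A] P} (hk : IsBaseChange B k) {m : V →ₗ[C] P} (hm : IsBaseChange B m)
    {α : N →ₗ[A] N'} {β : P →ₗ[B] P'} (hβ : IsBaseChange B' β) (k' : N' →ₗ[A'] P')
    (comm : ∀ n, k' (α n) = β (k n)) (hα : ∀ n' p, k' n' = β p → ∃! n, α n = n' ∧ k n = p) :
    IsBaseChange A' α := by
  have : IsLocalizedModule S k := (isLocalizedModule_iff_isBaseChange S B k).2 hk
  -- A common denominator: a single `e` brings finitely many elements of `P` into the image of `k`.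
  have hloc : ∀ (s : Finset P), ∃ e : S, ∀ p ∈ s, ∃ n, e • p = k n := by
    classical
    intro s
    induction s using Finset.induction_on with
    | empty => exact ⟨1, by simp⟩
    | insert p s _ ih =>
      obtain ⟨e, he⟩ := ih
      obtain ⟨⟨n, e'⟩, hn⟩ := IsLocalizedModule.surj S k p
      refine ⟨e * e', fun q hq => ?_⟩
      rcases Finset.mem_insert.1 hq with rfl | hq
      · exact ⟨e • n, by rw [mul_smul, hn]; exact (k.map_smul _ _).symm⟩
      · obtain ⟨n', hn'⟩ := he q hq
        exact ⟨e' • n', by rw [mul_comm, mul_smul, hn']; exact (k.map_smul _ _).symm⟩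
  let τ : A' ⊗[A] N →ₗ[A'] N' := (TensorProduct.isBaseChange A N A').lift α
  have hτ : ∀ n, τ (1 ⊗ₜ n) = α n := (TensorProduct.isBaseChange A N A').lift_eq α
  refine IsBaseChange.of_equiv (LinearEquiv.ofBijective τ ⟨?_, ?_⟩) hτ
  -- An element `z` of the kernel of `τ` is compatible with `0` in `P`. The gluing statement for `A'
  -- ⊗ N` itself therefore writes `z` as `1 ⊗ n` with `k n = 0`; as also `α n = 0`, the uniqueness
  -- in `hα` gives `n = 0`.
  · rw [injective_iff_map_eq_zero]
    intro z hz
    obtain ⟨n, ⟨hn1, hn2⟩, -⟩ := h.existsUnique hk hm (TensorProduct.isBaseChange A N A') hβ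
      (k' ∘ₗ τ) (fun n => by
        rw [← comm, LinearMap.comp_apply]
        exact congrArg k' (hτ n)) z 0 (by
          rw [LinearMap.comp_apply, hz, map_zero, map_zero])
    have h1 : α n = 0 := by
      rw [← hτ, ← hz]
      exact congrArg τ hn1
    have h2 : n = 0 := (hα 0 0 (by simp)).unique ⟨h1, hn2⟩ ⟨map_zero _, map_zero _⟩
    rw [← hn1, h2, map_zero]
  · intro n'
    obtain ⟨x, hx⟩ := hβ.equiv.surjective (k' n')
    obtain ⟨s, hs⟩ := TensorProduct.exists_finset x
    classical
    obtain ⟨e, he⟩ := hloc (s.image Prod.snd)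
    -- If `e p = k n` and `e⁻¹ x = a' + b`, then `x β(p) = a' β(k n) + β(e b p)`, and the first
    -- summand is the image of `a' ⊗ n`. Thus `n'`, up to the image of `τ`, goes to `β(P)`, and `hα`
    -- lifts the difference to `N`.
    have key : ∀ i ∈ s, ∃ (z : A' ⊗[A] N) (p : P), i.1 • β i.2 = k' (τ z) + β p := by
      intro i hi
      obtain ⟨n, hn⟩ := he i.2 (Finset.mem_image_of_mem _ hi)
      obtain ⟨a', b, hab⟩ := h.exists_add (((IsLocalization.map_units B e).unit⁻¹ : Bˣ) • i.1)
      refine ⟨a' ⊗ₜ n, algebraMap A B e • b • i.2, ?_⟩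
      have h1 : i.1 = algebraMap A B e •
          (algebraMap A' B' a' + algebraMap B B' b) := by
        rw [← hab, Units.smul_def, smul_smul, IsUnit.mul_val_inv, one_smul]
      have h2 : τ (a' ⊗ₜ n) = a' • α n := by
        rw [← hτ, ← map_smul, TensorProduct.smul_tmul', smul_eq_mul, mul_one]
      rw [h2, map_smul, comm, ← hn, Submonoid.smul_def, ← algebraMap_smul B (e : A) i.2]
      conv_lhs => rw [h1]
      rw [smul_assoc, add_smul, smul_add, algebraMap_smul, algebraMap_smul, map_smul, map_smul,
        map_smul]
      simp only [algebraMap_smul]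
      rw [smul_comm a' (e : A)]
    choose! z p hzp using key
    have h3 : k' (n' - τ (∑ i ∈ s, z i)) = β (∑ i ∈ s, p i) := by
      rw [map_sub, ← hx, hs]
      simp only [map_sum, IsBaseChange.equiv_tmul]
      rw [← Finset.sum_sub_distrib]
      refine Finset.sum_congr rfl fun i hi => ?_
      rw [hzp i hi, add_sub_cancel_left]
    obtain ⟨n, ⟨hn, -⟩, -⟩ := hα _ _ h3
    exact ⟨1 ⊗ₜ n + ∑ i ∈ s, z i, by
      rw [map_add]
      change τ (1 ⊗ₜ n) + τ (∑ i ∈ s, z i) = n'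
      rw [hτ, hn, sub_add_cancel]⟩

end Gluing

/-! ## Graded modules -/

section GradedProj

variable {M N : Type*} [AddCommGroup M] [AddCommGroup N] {A : ℤ → AddSubgroup M}
  {B : ℤ → AddSubgroup N}

/-- The projection to the homogeneous elements of degree `i`. -/
def gradedProj (h : DirectSum.IsInternal A) (i : ℤ) : M →+ M :=
  letI := h.chooseDecomposition
  (A i).subtype.comp
    ((DFinsupp.evalAddMonoidHom i).comp (DirectSum.decomposeAddEquiv A).toAddMonoidHom)

theorem gradedProj_mem (h : DirectSum.IsInternal A) (i : ℤ) (x : M) : gradedProj h i x ∈ A i := by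
  let _ := h.chooseDecomposition
  exact (DirectSum.decompose A x i).2

theorem gradedProj_of_mem (h : DirectSum.IsInternal A) {i : ℤ} {x : M} (hx : x ∈ A i) :
    gradedProj h i x = x := by
  let _ := h.chooseDecomposition
  exact DirectSum.decompose_of_mem_same A hx

theorem gradedProj_of_mem_ne (h : DirectSum.IsInternal A) {i j : ℤ} {x : M} (hx : x ∈ A i)
    (hij : i ≠ j) : gradedProj h j x = 0 := by
  let _ := h.chooseDecomposition
  exact DirectSum.decompose_of_mem_ne A hx hij

theorem exists_sum_gradedProj (h : DirectSum.IsInternal A) (x : M) :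
    ∃ s : Finset ℤ, x = ∑ i ∈ s, gradedProj h i x := by
  classical
  let _ := h.chooseDecomposition
  exact ⟨_, (DirectSum.sum_support_decompose A x).symm⟩

theorem graded_induction (h : DirectSum.IsInternal A) {p : M → Prop}
    (hom : ∀ i, ∀ x ∈ A i, p x) (add : ∀ x y, p x → p y → p (x + y)) (x : M) : p x := by
  classical
  obtain ⟨s, hs⟩ := exists_sum_gradedProj h x
  rw [hs]
  exact Finset.sum_induction _ p add (hom 0 0 (zero_mem _))
    fun i _ => hom i _ (gradedProj_mem h i x)

theorem gradedProj_map (h : DirectSum.IsInternal A) (h' : DirectSum.IsInternal B) (f : M →+ N)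
    (hf : ∀ i x, x ∈ A i → f x ∈ B i) (i : ℤ) (x : M) :
    gradedProj h' i (f x) = f (gradedProj h i x) := by
  induction x using graded_induction h with
  | add x y hx hy => simp only [map_add, hx, hy]
  | hom j x hx =>
    by_cases hj : j = i
    · subst hj
      rw [gradedProj_of_mem h' (hf _ _ hx), gradedProj_of_mem h hx]
    · rw [gradedProj_of_mem_ne h' (hf _ _ hx) hj, gradedProj_of_mem_ne h hx hj, map_zero]

/-- Since `f` commutes with the projections, `x` and its component of degree `i` have the same
image. Lifts through injective maps, constructed without regard to degrees, therefore preserve them.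
-/
theorem mem_of_map_mem (h : DirectSum.IsInternal A) (h' : DirectSum.IsInternal B) (f : M →+ N)
    (hf : ∀ i x, x ∈ A i → f x ∈ B i) (hinj : Function.Injective f) {i : ℤ} {x : M}
    (hx : f x ∈ B i) : x ∈ A i := by
  have h1 : gradedProj h i x = x := hinj (by
    rw [← gradedProj_map h h' f hf, gradedProj_of_mem h' hx])
  rw [← h1]
  exact gradedProj_mem h i x

theorem exists_mem_of_surjective (h : DirectSum.IsInternal A) (h' : DirectSum.IsInternal B)
    (f : M →+ N) (hf : ∀ i x, x ∈ A i → f x ∈ B i) (hsurj : Function.Surjective f) {i : ℤ} {y : N}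
    (hy : y ∈ B i) : ∃ x ∈ A i, f x = y := by
  obtain ⟨x, rfl⟩ := hsurj y
  exact ⟨gradedProj h i x, gradedProj_mem h i x, by
    rw [← gradedProj_map h h' f hf, gradedProj_of_mem h' hy]⟩

/-- A variant of `isInternal_of_proj` in which finite decompositions are replaced by an induction
principle over homogeneous elements, which is easier to supply for quotients, products and tensor
products. -/
theorem isInternal_of_gradedProj (π : ℤ → M →+ M) (h₁ : ∀ i x, π i x ∈ A i)
    (h₂ : ∀ i x, x ∈ A i → ∀ j, j ≠ i → π j x = 0) (h₃ : ∀ i x, x ∈ A i → π i x = x)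
    (h₄ : ∀ p : M → Prop, (∀ i, ∀ x ∈ A i, p x) → (∀ x y, p x → p y → p (x + y)) → ∀ x, p x) :
    DirectSum.IsInternal A := by
  classical
  refine isInternal_of_proj A id π h₁ h₂ fun x => ?_
  suffices h : ∃ s : Finset ℤ, ∀ s', s ⊆ s' → x = ∑ j ∈ s', π j x by
    obtain ⟨s, hs⟩ := h
    exact ⟨s, hs s subset_rfl⟩
  refine h₄ (fun x => ∃ s : Finset ℤ, ∀ s', s ⊆ s' → x = ∑ j ∈ s', π j x) ?_ ?_ x
  · intro i x hx
    refine ⟨{i}, fun s' hs' => ?_⟩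
    rw [Finset.sum_eq_single_of_mem i (hs' (Finset.mem_singleton_self i))
      fun j _ hj => h₂ i x hx j hj, h₃ i x hx]
  · rintro x y ⟨s, hs⟩ ⟨t, ht⟩
    refine ⟨s ∪ t, fun s' h => ?_⟩
    simp only [map_add, Finset.sum_add_distrib]
    rw [← hs s' (Finset.union_subset_left h), ← ht s' (Finset.union_subset_right h)]

end GradedProj

namespace GrMod

variable {R : GrRing.{u}}

/-- The projection of a graded module to its homogeneous elements of degree `i`. -/
def proj (M : GrMod.{u, w} R) (i : ℤ) : M.carrier →+ M.carrier := gradedProj M.internal i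

/-- A submodule containing the homogeneous components of its elements, with the induced
grading. -/
def sub (M : GrMod.{u, w} R) (S : Submodule R.carrier M.carrier)
    (hS : ∀ x ∈ S, ∀ i, M.proj i x ∈ S) : GrMod.{u, w} R where
  carrier := S
  piece i := (M.piece i).comap S.subtype.toAddMonoidHom
  smul_mem := fun i j r m hr hm => M.smul_mem i j r m hr hm
  internal := by
    refine isInternal_of_proj _ (fun i => i)
      (fun i => ((M.proj i).comp S.subtype.toAddMonoidHom).codRestrict S.toAddSubgroup
        fun x => hS x x.2 i) ?_ ?_ ?_
    · intro j x
      exact gradedProj_mem M.internal j _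
    · intro i x hx j hj
      exact Subtype.ext (gradedProj_of_mem_ne M.internal hx (Ne.symm hj))
    · intro x
      obtain ⟨s, hs⟩ := exists_sum_gradedProj M.internal (x : M.carrier)
      refine ⟨s, Subtype.ext ?_⟩
      change S.subtype x = S.subtype _
      rw [map_sum]
      exact hs

/-- The quotient by a submodule containing the homogeneous components of its elements. -/
def quot (M : GrMod.{u, w} R) (S : Submodule R.carrier M.carrier)
    (hS : ∀ x ∈ S, ∀ i, M.proj i x ∈ S) : GrMod.{u, w} R where
  carrier := M.carrier ⧸ S
  piece i := (M.piece i).map S.mkQ.toAddMonoidHom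
  smul_mem := by
    rintro i j r _ hr ⟨m, hm, rfl⟩
    exact ⟨r • m, M.smul_mem i j r m hr hm, map_smul S.mkQ r m⟩
  internal := by
    have hq : ∀ i, ∃ π : M.carrier ⧸ S →+ M.carrier ⧸ S, ∀ x, π (S.mkQ x) = S.mkQ (M.proj i x) :=
      fun i => ⟨QuotientAddGroup.map S.toAddSubgroup S.toAddSubgroup (M.proj i)
        fun x hx => hS x hx i, fun x => rfl⟩
    choose π hπ using hq
    refine isInternal_of_gradedProj π ?_ ?_ ?_ ?_
    · intro i x
      obtain ⟨x, rfl⟩ := S.mkQ_surjective x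
      rw [hπ]
      exact ⟨_, gradedProj_mem M.internal i x, rfl⟩
    · rintro i _ ⟨x, hx, rfl⟩ j hj
      refine (hπ j x).trans ?_
      rw [proj, gradedProj_of_mem_ne M.internal hx (Ne.symm hj), map_zero]
    · rintro i _ ⟨x, hx, rfl⟩
      refine (hπ i x).trans ?_
      rw [proj, gradedProj_of_mem M.internal hx]
      rfl
    · intro p hom add x
      obtain ⟨x, rfl⟩ := S.mkQ_surjective x
      induction x using graded_induction M.internal with
      | hom i x hx => exact hom i _ ⟨x, hx, rfl⟩
      | add x y hx hy =>
        rw [map_add]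
        exact add _ _ hx hy

/-- The direct sum of two graded modules. -/
def prod (M N : GrMod.{u, w} R) : GrMod.{u, w} R where
  carrier := M.carrier × N.carrier
  piece i := (M.piece i).prod (N.piece i)
  smul_mem := fun i j r m hr hm => ⟨M.smul_mem i j r _ hr hm.1, N.smul_mem i j r _ hr hm.2⟩
  internal := by
    refine isInternal_of_gradedProj (fun i => (M.proj i).prodMap (N.proj i)) ?_ ?_ ?_ ?_
    · intro i x
      exact ⟨gradedProj_mem _ _ _, gradedProj_mem _ _ _⟩
    · intro i x hx j hj
      exact Prod.ext (gradedProj_of_mem_ne M.internal hx.1 (Ne.symm hj))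
        (gradedProj_of_mem_ne N.internal hx.2 (Ne.symm hj))
    · intro i x hx
      exact Prod.ext (gradedProj_of_mem M.internal hx.1) (gradedProj_of_mem N.internal hx.2)
    · rintro p hom add ⟨x, y⟩
      have h : ((x, y) : M.carrier × N.carrier) = (x, 0) + (0, y) := by simp
      rw [h]
      refine add _ _ ?_ ?_
      · induction x using graded_induction M.internal with
        | hom i x hx => exact hom i _ ⟨hx, zero_mem _⟩
        | add x y hx hy => simpa using add _ _ (hx (by simp)) (hy (by simp))
      · induction y using graded_induction N.internal with
        | hom i x hx => exact hom i _ ⟨zero_mem _, hx⟩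
        | add x y hx hy => simpa using add _ _ (hx (by simp)) (hy (by simp))

/-! ### Extension of scalars of graded modules -/

section Extend

variable {S : GrRing.{v}} (f : R.Hom S) (M : GrMod.{u, w} R)

/-- The component of degree `k` of `s ⊗ m`. -/
def extendProjAux (k : ℤ) : letI := f.toRingHom.toAlgebra
    S.carrier →+ M.carrier →+ S.carrier ⊗[R.carrier] M.carrier :=
  letI := f.toRingHom.toAlgebra
  letI := S.internal.chooseDecomposition
  (DirectSum.toAddMonoid fun i => AddMonoidHom.mk'
    (fun s : S.piece i => (TensorProduct.mk R.carrier S.carrier M.carrier s).toAddMonoidHom.comp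
      (M.proj (k - i)))
    (fun s s' => by ext m; simp)).comp
      (DirectSum.decomposeAddEquiv S.piece).toAddMonoidHom

theorem extendProjAux_of_mem (k : ℤ) {i : ℤ} {s : S.carrier} (hs : s ∈ S.piece i) (m : M.carrier) :
    letI := f.toRingHom.toAlgebra
    extendProjAux f M k s m = s ⊗ₜ[R.carrier] M.proj (k - i) m := by
  let _ := f.toRingHom.toAlgebra
  let _ := S.internal.chooseDecomposition
  simp only [extendProjAux, AddMonoidHom.comp_apply]
  have h : (DirectSum.decomposeAddEquiv S.piece).toAddMonoidHom s =
      DirectSum.of (fun i => S.piece i) i ⟨s, hs⟩ := DirectSum.decompose_of_mem S.piece hs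
  rw [h, DirectSum.toAddMonoid_of]
  rfl

theorem proj_smul {i j : ℤ} {r : R.carrier} (hr : r ∈ R.piece i) (m : M.carrier) :
    M.proj j (r • m) = r • M.proj (j - i) m := by
  induction m using graded_induction M.internal with
  | add x y hx hy => simp only [smul_add, map_add, hx, hy]
  | hom k x hx =>
    by_cases h : i + k = j
    · subst h
      rw [proj, gradedProj_of_mem M.internal (M.smul_mem _ _ _ _ hr hx), proj,
        add_sub_cancel_left, gradedProj_of_mem M.internal hx]
    · rw [proj, gradedProj_of_mem_ne M.internal (M.smul_mem _ _ _ _ hr hx) h, proj,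
        gradedProj_of_mem_ne M.internal hx (fun h' => h (by omega)), smul_zero]

/-- The component of degree `k` of an extension of scalars. -/
def extendProj (k : ℤ) : letI := f.toRingHom.toAlgebra
    S.carrier ⊗[R.carrier] M.carrier →+ S.carrier ⊗[R.carrier] M.carrier :=
  letI := f.toRingHom.toAlgebra
  -- Balancedness over `R` can be tested on homogeneous `r` and `s`: moving `r` of degree `j` from
  -- `m` to `s` lowers by `j` the degree of the component of `m` that is needed.
  TensorProduct.liftAddHom (extendProjAux f M k) (by
    intro r s m
    induction s using graded_induction S.internal with
    | add x y hx hy => simp only [smul_add, map_add, AddMonoidHom.add_apply, hx, hy]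
    | hom i s hs =>
      induction r using graded_induction R.internal with
      | add x y hx hy => simp only [add_smul, map_add, AddMonoidHom.add_apply, hx, hy]
      | hom j r hr =>
        have h1 : r • s ∈ S.piece (j + i) := SetLike.mul_mem_graded (f.map_mem _ _ hr) hs
        rw [extendProjAux_of_mem f M k h1, extendProjAux_of_mem f M k hs, proj_smul M hr,
          TensorProduct.smul_tmul, show k - (j + i) = k - i - j by ring])

/-- Extension of scalars. -/
def extend : GrMod.{v, max v w} S :=
  letI := f.toRingHom.toAlgebra
  { carrier := S.carrier ⊗[R.carrier] M.carrier
    piece := fun k => AddSubgroup.closure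
      {z | ∃ i j, ∃ a ∈ S.piece i, ∃ b ∈ M.piece j, i + j = k ∧ z = a ⊗ₜ[R.carrier] b}
    smul_mem := by
      intro i j r m hr hm
      induction hm using AddSubgroup.closure_induction with
      | zero => rw [smul_zero]; exact zero_mem _
      | add _ _ _ _ h₁ h₂ => rw [smul_add]; exact add_mem h₁ h₂
      | neg _ _ h => rw [smul_neg]; exact neg_mem h
      | mem x hx =>
        obtain ⟨i', j', a, ha, b, hb, rfl, rfl⟩ := hx
        exact AddSubgroup.subset_closure ⟨i + i', j', r * a, SetLike.mul_mem_graded hr ha, b, hb,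
          by ring, rfl⟩
    internal := by
      have key : ∀ k {i : ℤ} {s : S.carrier}, s ∈ S.piece i → ∀ m,
          extendProj f M k (s ⊗ₜ[R.carrier] m) = s ⊗ₜ[R.carrier] M.proj (k - i) m :=
        fun k i s hs m => extendProjAux_of_mem f M k hs m
      refine isInternal_of_gradedProj (extendProj f M) ?_ ?_ ?_ ?_
      · intro k x
        induction x using TensorProduct.induction_on with
        | zero => rw [map_zero]; exact zero_mem _
        | add x y hx hy => rw [map_add]; exact add_mem hx hy
        | tmul s m =>
          induction s using graded_induction S.internal with
          | add x y hx hy => rw [TensorProduct.add_tmul, map_add]; exact add_mem hx hy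
          | hom i s hs =>
            rw [key k hs]
            exact AddSubgroup.subset_closure ⟨i, k - i, s, hs, _, gradedProj_mem M.internal _ m,
              by ring, rfl⟩
      · intro k x hx j hj
        induction hx using AddSubgroup.closure_induction with
        | zero => simp
        | add x y _ _ hx hy => rw [map_add, hx, hy, add_zero]
        | neg x _ hx => rw [map_neg, hx, neg_zero]
        | mem x hx =>
          obtain ⟨i', j', a, ha, b, hb, rfl, rfl⟩ := hx
          rw [key j ha, proj, gradedProj_of_mem_ne M.internal hb (fun h => hj (by omega)),
            TensorProduct.tmul_zero]
      · intro k x hx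
        induction hx using AddSubgroup.closure_induction with
        | zero => simp
        | add x y _ _ hx hy => rw [map_add, hx, hy]
        | neg x _ hx => rw [map_neg, hx]
        | mem x hx =>
          obtain ⟨i', j', a, ha, b, hb, rfl, rfl⟩ := hx
          rw [key _ ha, proj, add_sub_cancel_left, gradedProj_of_mem M.internal hb]
      · intro p hom add x
        induction x using TensorProduct.induction_on with
        | zero => exact hom 0 0 (zero_mem _)
        | add x y hx hy => exact add _ _ hx hy
        | tmul s m =>
          induction s using graded_induction S.internal with
          | add x y hx hy => rw [TensorProduct.add_tmul]; exact add _ _ hx hy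
          | hom i s hs =>
            induction m using graded_induction M.internal with
            | add x y hx hy => rw [TensorProduct.tmul_add]; exact add _ _ hx hy
            | hom j m hm =>
              exact hom (i + j) _ (AddSubgroup.subset_closure ⟨i, j, s, hs, m, hm, rfl, rfl⟩) }

/-- The unit of extension of scalars. -/
def toExtend : M.carrier →ₛₗ[f.toRingHom] (M.extend f).carrier :=
  letI := f.toRingHom.toAlgebra
  { toFun := fun m => (1 : S.carrier) ⊗ₜ[R.carrier] m
    map_add' := fun _ _ => TensorProduct.tmul_add _ _ _
    map_smul' := fun r m => by
      change _ = (f.toRingHom r * 1) ⊗ₜ[R.carrier] m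
      rw [mul_one, ← TensorProduct.smul_tmul]
      congr 1
      exact mul_one _ }

theorem toExtend_mem (i : ℤ) (x : M.carrier) (hx : x ∈ M.piece i) :
    M.toExtend f x ∈ (M.extend f).piece i :=
  AddSubgroup.subset_closure ⟨0, i, 1, SetLike.GradedOne.one_mem (A := S.piece), x, hx,
    zero_add i, rfl⟩

theorem isExtensionOfScalars_toExtend :
    IsExtensionOfScalars f.toRingHom (M.toExtend f) := by
  let _ := f.toRingHom.toAlgebra
  exact TensorProduct.isBaseChange R.carrier M.carrier S.carrier

end Extend

end GrMod

/-! ## Extensions of scalars along ring homomorphisms -/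

section ExtensionOfScalars

variable {R S : Type*} [CommRing R] [CommRing S]

/-- `IsExtensionOfScalars` builds its own algebra and module instances; any ambient ones compatible
with `l` are equal to these, so results on `IsBaseChange` become available for them. -/
theorem isExtensionOfScalars_iff [algRS : Algebra R S] {M N : Type*} [AddCommGroup M]
    [AddCommGroup N] [Module R M] [Module S N] [modRN : Module R N] [IsScalarTower R S N]
    {l : R →+* S} (hl : algebraMap R S = l) {f : M →ₛₗ[l] N} (g : M →ₗ[R] N)
    (hg : ∀ m, f m = g m) : IsExtensionOfScalars l f ↔ IsBaseChange S g := by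
  have h1 : modRN = Module.compHom N l := Module.ext' _ _ fun r n => by
    rw [← algebraMap_smul S r n, hl]
    rfl
  have h2 : algRS = l.toAlgebra := Algebra.algebra_ext _ _ fun r => RingHom.congr_fun hl r
  subst h1 h2
  let _ : Algebra R S := l.toAlgebra
  let _ : Module R N := Module.compHom N l
  have h3 : g = { toFun := f, map_add' := f.map_add, map_smul' := f.map_smulₛₗ } :=
    LinearMap.ext fun m => (hg m).symm
  subst h3
  rfl

variable {l : R →+* S}

section Lift

variable {M N Q : Type*} [AddCommGroup M] [AddCommGroup N] [AddCommGroup Q] [Module R M]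
  [Module S N] [Module S Q] {f : M →ₛₗ[l] N}

theorem IsExtensionOfScalars.exists_lift (h : IsExtensionOfScalars l f) (g : M →ₛₗ[l] Q) :
    ∃ g' : N →ₗ[S] Q, ∀ m, g' (f m) = g m := by
  let _ : Algebra R S := l.toAlgebra
  let _ : Module R N := Module.compHom N l
  let _ : Module R Q := Module.compHom Q l
  have : IsScalarTower R S N := ⟨fun r s n => mul_smul (l r) s n⟩
  have : IsScalarTower R S Q := ⟨fun r s n => mul_smul (l r) s n⟩
  let g₀ : M →ₗ[R] Q := { toFun := g, map_add' := g.map_add, map_smul' := g.map_smulₛₗ }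
  exact ⟨IsBaseChange.lift h g₀, IsBaseChange.lift_eq h g₀⟩

theorem IsExtensionOfScalars.induction (h : IsExtensionOfScalars l f) {p : N → Prop}
    (smul : ∀ (s : S) m, p (s • f m)) (add : ∀ x y, p x → p y → p (x + y)) (x : N) : p x := by
  let _ : Algebra R S := l.toAlgebra
  let _ : Module R N := Module.compHom N l
  have : IsScalarTower R S N := ⟨fun r s n => mul_smul (l r) s n⟩
  let f₀ : M →ₗ[R] N := { toFun := f, map_add' := f.map_add, map_smul' := f.map_smulₛₗ }
  have hf : IsBaseChange S f₀ := h
  obtain ⟨y, rfl⟩ := hf.equiv.surjective x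
  induction y using TensorProduct.induction_on with
  | zero => simpa using smul 0 0
  | add x y hx hy =>
    rw [map_add]
    exact add _ _ hx hy
  | tmul s m =>
    rw [IsBaseChange.equiv_tmul]
    exact smul s m

theorem IsExtensionOfScalars.hom_ext (h : IsExtensionOfScalars l f) {g g' : N →ₗ[S] Q}
    (hg : ∀ m, g (f m) = g' (f m)) : g = g' := by
  ext x
  induction x using IsExtensionOfScalars.induction h with
  | smul s m => rw [map_smul, map_smul, hg]
  | add x y hx hy => rw [map_add, map_add, hx, hy]

/-- The universal property for a target over a third ring, viewed as an `S`-module through `l'`. It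
produces the structure maps of extended modules. -/
theorem IsExtensionOfScalars.exists_lift_semilinear {T O : Type*} [CommRing T] [AddCommGroup O]
    [Module T O] {l' : S →+* T} (h : IsExtensionOfScalars l f) {l'' : R →+* T}
    (hl : ∀ r, l'' r = l' (l r)) (g : M →ₛₗ[l''] O) :
    ∃ g' : N →ₛₗ[l'] O, ∀ m, g' (f m) = g m := by
  let _ : Module S O := Module.compHom O l'
  obtain ⟨g', hg'⟩ := h.exists_lift (Q := O)
    { toFun := g, map_add' := g.map_add, map_smul' := fun r m => by
        rw [map_smulₛₗ, hl]
        rfl }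
  exact ⟨{ toFun := g', map_add' := g'.map_add, map_smul' := g'.map_smul }, hg'⟩

/-- Extensions of scalars along a localization are localizations. -/
theorem isExtensionOfScalars_iff_of_isLocalization (E : Submonoid R)
    (hE : letI := l.toAlgebra; IsLocalization E S) :
    IsExtensionOfScalars l f ↔ (∀ y, ∃ e ∈ E, ∃ x, l e • y = f x) ∧
      ∀ x, f x = 0 → ∃ e ∈ E, e • x = 0 := by
  let _ : Algebra R S := l.toAlgebra
  let _ : Module R N := Module.compHom N l
  have : IsScalarTower R S N := ⟨fun r s n => mul_smul (l r) s n⟩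
  have : IsLocalization E S := hE
  let f₀ : M →ₗ[R] N := { toFun := f, map_add' := f.map_add, map_smul' := f.map_smulₛₗ }
  have h1 : IsExtensionOfScalars l f ↔ IsBaseChange S f₀ := Iff.rfl
  rw [h1, ← isLocalizedModule_iff_isBaseChange E S f₀]
  constructor
  · intro h
    refine ⟨fun y => ?_, fun x hx => ?_⟩
    · obtain ⟨⟨x, e⟩, hx⟩ := h.surj y
      exact ⟨e, e.2, x, hx⟩
    · obtain ⟨e, he⟩ := (IsLocalizedModule.eq_zero_iff E f₀).1 hx
      exact ⟨e, e.2, he⟩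
  · rintro ⟨hs, hi⟩
    refine ⟨fun e => ?_, fun y => ?_, fun {x y} hxy => ?_⟩
    · rw [Module.End.isUnit_iff]
      have hu : IsUnit (algebraMap R S e) := IsLocalization.map_units S e
      have h2 : ∀ n : N, algebraMap R (Module.End R N) e n = algebraMap R S e • n := fun _ => rfl
      refine ⟨fun n n' hn => hu.smul_left_cancel.1 hn, fun n =>
        ⟨((hu.unit⁻¹ : Sˣ) : S) • n, ?_⟩⟩
      rw [h2, smul_smul, IsUnit.mul_val_inv, one_smul]
    · obtain ⟨e, he, x, hx⟩ := hs y
      exact ⟨⟨x, ⟨e, he⟩⟩, hx⟩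
    · obtain ⟨e, he, h0⟩ := hi (x - y) (by rw [map_sub]; exact sub_eq_zero.2 hxy)
      refine ⟨⟨e, he⟩, ?_⟩
      rw [smul_sub, sub_eq_zero] at h0
      exact h0

/-- Cancellation of base changes in a composite `R → S → T`. Applied to the squares of a map of
diagrams, it carries the extension property from one side to the other. -/
theorem IsExtensionOfScalars.comp_iff {T O : Type*} [CommRing T] [AddCommGroup O] [Module T O]
    {l' : S →+* T} (h : IsExtensionOfScalars l f) {g : N →ₛₗ[l'] O} {l'' : R →+* T}
    (hl : ∀ r, l'' r = l' (l r)) {gf : M →ₛₗ[l''] O} (hgf : ∀ m, gf m = g (f m)) :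
    IsExtensionOfScalars l'' gf ↔ IsExtensionOfScalars l' g := by
  let _ : Algebra R S := l.toAlgebra
  let _ : Algebra S T := l'.toAlgebra
  let _ : Algebra R T := l''.toAlgebra
  let _ : Module R N := Module.compHom N l
  let _ : Module R O := Module.compHom O l''
  let _ : Module S O := Module.compHom O l'
  have : IsScalarTower R S T := .of_algebraMap_eq hl
  have : IsScalarTower R S N := ⟨fun r s n => mul_smul (l r) s n⟩
  have : IsScalarTower S T O := ⟨fun r s n => mul_smul (l' r) s n⟩
  have : IsScalarTower R T O := ⟨fun r s n => mul_smul (l'' r) s n⟩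
  have : IsScalarTower R S O := .of_algebraMap_smul fun r x => by
    change l' (l r) • x = l'' r • x
    rw [hl]
  let f₀ : M →ₗ[R] N := { toFun := f, map_add' := f.map_add, map_smul' := f.map_smulₛₗ }
  let g₀ : N →ₗ[S] O := { toFun := g, map_add' := g.map_add, map_smul' := g.map_smulₛₗ }
  have hf : IsBaseChange S f₀ := h
  have h1 : IsExtensionOfScalars l'' gf ↔ IsBaseChange T (g₀.restrictScalars R ∘ₗ f₀) :=
    isExtensionOfScalars_iff rfl _ hgf
  have h2 : IsExtensionOfScalars l' g ↔ IsBaseChange T g₀ := Iff.rfl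
  rw [h1, h2]
  exact hf.comp_iff

theorem IsExtensionOfScalars.of_equiv {M' N' : Type*} [AddCommGroup M'] [AddCommGroup N']
    [Module R M'] [Module S N'] (h : IsExtensionOfScalars l f) {f' : M' →ₛₗ[l] N'} (e : M ≃ₗ[R] M')
    (e' : N ≃ₗ[S] N') (he : ∀ m, e' (f m) = f' (e m)) : IsExtensionOfScalars l f' := by
  let _ : Algebra R S := l.toAlgebra
  let _ : Module R N := Module.compHom N l
  let _ : Module R N' := Module.compHom N' l
  have : IsScalarTower R S N := ⟨fun r s n => mul_smul (l r) s n⟩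
  have : IsScalarTower R S N' := ⟨fun r s n => mul_smul (l r) s n⟩
  refine (IsBaseChange.iff_of_equiv_comm e e' ?_).1 h
  ext m
  exact (he m).symm

theorem IsExtensionOfScalars.prod {M' N' : Type*} [AddCommGroup M'] [AddCommGroup N']
    [Module R M'] [Module S N'] (h : IsExtensionOfScalars l f) {f' : M' →ₛₗ[l] N'}
    (h' : IsExtensionOfScalars l f') {g : M × M' →ₛₗ[l] N × N'}
    (hg : ∀ x, g x = (f x.1, f' x.2)) : IsExtensionOfScalars l g := by
  let _ : Algebra R S := l.toAlgebra
  let _ : Module R N := Module.compHom N l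
  let _ : Module R N' := Module.compHom N' l
  have : IsScalarTower R S N := ⟨fun r s n => mul_smul (l r) s n⟩
  have : IsScalarTower R S N' := ⟨fun r s n => mul_smul (l r) s n⟩
  let f₀ : M →ₗ[R] N := { toFun := f, map_add' := f.map_add, map_smul' := f.map_smulₛₗ }
  let f₀' : M' →ₗ[R] N' := { toFun := f', map_add' := f'.map_add, map_smul' := f'.map_smulₛₗ }
  have hf : IsBaseChange S f₀ := h
  have hf' : IsBaseChange S f₀' := h'
  refine (isExtensionOfScalars_iff rfl (f₀.prodMap f₀') hg).2 ?_
  refine IsBaseChange.of_equiv ((TensorProduct.prodRight R S S M M').trans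
    (LinearEquiv.prodCongr hf.equiv hf'.equiv)) ?_
  rintro ⟨m, m'⟩
  simp only [LinearEquiv.trans_apply, TensorProduct.prodRight_tmul, LinearEquiv.prodCongr_apply,
    IsBaseChange.equiv_tmul, one_smul]
  rfl

end Lift

/-! ### Extensions of scalars in exact sequences -/

section Exact

variable {M₁ M₂ M₃ N₁ N₂ N₃ : Type*} [AddCommGroup M₁] [AddCommGroup M₂] [AddCommGroup M₃]
  [AddCommGroup N₁] [AddCommGroup N₂] [AddCommGroup N₃] [Module R M₁] [Module R M₂] [Module R M₃]
  [Module S N₁] [Module S N₂] [Module S N₃] {h₁ : M₁ →ₛₗ[l] N₁} {h₂ : M₂ →ₛₗ[l] N₂}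
  {h₃ : M₃ →ₛₗ[l] N₃} {f : M₁ →ₗ[R] M₂} {g : M₂ →ₗ[R] M₃} {f' : N₁ →ₗ[S] N₂} {g' : N₂ →ₗ[S] N₃}

/-- Flatness keeps the tensored row left exact, so that it can be compared with the row of the `Nᵢ`.
This is the only reason why flat diagrams are needed for an abelian category. -/
theorem IsExtensionOfScalars.of_left_exact (hl : l.Flat) (comm₁ : ∀ x, h₂ (f x) = f' (h₁ x))
    (comm₂ : ∀ x, h₃ (g x) = g' (h₂ x)) (e₂ : IsExtensionOfScalars l h₂)
    (e₃ : IsExtensionOfScalars l h₃) (hf : Function.Injective f) (hfg : Function.Exact f g)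
    (hf' : Function.Injective f') (hfg' : Function.Exact f' g') : IsExtensionOfScalars l h₁ := by
  let _ : Algebra R S := l.toAlgebra
  let _ : Module R N₁ := Module.compHom N₁ l
  let _ : Module R N₂ := Module.compHom N₂ l
  let _ : Module R N₃ := Module.compHom N₃ l
  have : IsScalarTower R S N₁ := ⟨fun r s n => mul_smul (l r) s n⟩
  have : IsScalarTower R S N₂ := ⟨fun r s n => mul_smul (l r) s n⟩
  have : IsScalarTower R S N₃ := ⟨fun r s n => mul_smul (l r) s n⟩
  have : Module.Flat R S := hl
  exact IsBaseChange.of_left_exact S _ _ _ (LinearMap.ext comm₁) (LinearMap.ext comm₂) e₂ e₃ hfg hf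
    hfg' hf'

/-- Tensoring is right exact, so unlike for kernels no flatness is required. -/
theorem IsExtensionOfScalars.of_right_exact (comm₁ : ∀ x, h₂ (f x) = f' (h₁ x))
    (comm₂ : ∀ x, h₃ (g x) = g' (h₂ x)) (e₁ : IsExtensionOfScalars l h₁)
    (e₂ : IsExtensionOfScalars l h₂) (hg : Function.Surjective g) (hfg : Function.Exact f g)
    (hg' : Function.Surjective g') (hfg' : Function.Exact f' g') : IsExtensionOfScalars l h₃ := by
  let _ : Algebra R S := l.toAlgebra
  let _ : Module R N₁ := Module.compHom N₁ l
  let _ : Module R N₂ := Module.compHom N₂ l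
  let _ : Module R N₃ := Module.compHom N₃ l
  have : IsScalarTower R S N₁ := ⟨fun r s n => mul_smul (l r) s n⟩
  have : IsScalarTower R S N₂ := ⟨fun r s n => mul_smul (l r) s n⟩
  have : IsScalarTower R S N₃ := ⟨fun r s n => mul_smul (l r) s n⟩
  simp only [IsExtensionOfScalars, IsBaseChange, IsTensorProduct] at e₁ e₂ ⊢
  refine LinearMap.bijective_of_surjective_of_bijective_of_right_exact
    ((f.baseChange S).restrictScalars R) ((g.baseChange S).restrictScalars R)
    (f'.restrictScalars R) (g'.restrictScalars R) _ _ _ ?_ ?_ ?_ hfg' e₁.2 e₂ ?_ hg'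
  · ext s m
    simpa using congrArg (s • ·) (comm₁ m).symm
  · ext s m
    simpa using congrArg (s • ·) (comm₂ m).symm
  · exact lTensor_exact S hfg hg
  · exact LinearMap.lTensor_surjective S hg

end Exact

end ExtensionOfScalars

/-- A map out of an extension of scalars preserves degrees if it does so on the generators. -/
theorem IsExtensionOfScalars.mem_piece {R : GrRing.{u}} {S : GrRing.{v}} {l : R.Hom S}
    {M : GrMod.{u, w} R} {N : GrMod S} {f : M.carrier →ₛₗ[l.toRingHom] N.carrier}
    (h : IsExtensionOfScalars l.toRingHom f) (hf : ∀ i x, x ∈ M.piece i → f x ∈ N.piece i)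
    {Q : Type*} [AddCommGroup Q] {A : ℤ → AddSubgroup Q} (hA : DirectSum.IsInternal A)
    (g : N.carrier →+ Q) (hg : ∀ i j (s : S.carrier) x, s ∈ S.piece i → x ∈ M.piece j →
      g (s • f x) ∈ A (i + j)) (i : ℤ) (x : N.carrier) (hx : x ∈ N.piece i) : g x ∈ A i := by
  -- That `g` commutes with the projections is an additive condition on `y`, hence it may be tested
  -- on `s • f m` with `s` and `m` homogeneous.
  have key : ∀ y, ∀ i, g (gradedProj N.internal i y) = gradedProj hA i (g y) := by
    intro y
    induction y using IsExtensionOfScalars.induction h with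
    | add x y hx hy => intro i; simp only [map_add, hx, hy]
    | smul s m =>
      induction s using graded_induction S.internal with
      | add s t hs ht => intro i; simp only [add_smul, map_add, hs, ht]
      | hom j s hs =>
        induction m using graded_induction M.internal with
        | add s t hs ht => intro i; simp only [map_add, smul_add, hs, ht]
        | hom k m hm =>
          intro i
          have h1 := N.smul_mem j k s _ hs (hf k m hm)
          have h2 := hg j k s m hs hm
          by_cases hi : j + k = i
          · subst hi
            rw [gradedProj_of_mem _ h1, gradedProj_of_mem _ h2]
          · rw [gradedProj_of_mem_ne _ h1 hi, gradedProj_of_mem_ne _ h2 hi, map_zero]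
  rw [← gradedProj_of_mem N.internal hx, key]
  exact gradedProj_mem _ _ _

/-! ## The abelian category of modules over a diagram of rings -/

theorem exists_lift_of_injective {R X Y Z : Type*} [CommRing R] [AddCommGroup X] [AddCommGroup Y]
    [AddCommGroup Z] [Module R X] [Module R Y] [Module R Z] {f : X →ₗ[R] Y}
    (hf : Function.Injective f) (h : Z →ₗ[R] Y) (hh : ∀ z, ∃ x, f x = h z) :
    ∃ l : Z →ₗ[R] X, ∀ z, f (l z) = h z := by
  refine ⟨(LinearEquiv.ofInjective f hf).symm.toLinearMap ∘ₗ
    h.codRestrict (LinearMap.range f) hh, fun z => ?_⟩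
  have := (LinearEquiv.ofInjective f hf).apply_symm_apply (h.codRestrict (LinearMap.range f) hh z)
  exact congrArg Subtype.val this

theorem exists_desc_of_surjective {R X Y Z : Type*} [CommRing R] [AddCommGroup X] [AddCommGroup Y]
    [AddCommGroup Z] [Module R X] [Module R Y] [Module R Z] {g : X →ₗ[R] Y}
    (hg : Function.Surjective g) (h : X →ₗ[R] Z) (hh : ∀ x, g x = 0 → h x = 0) :
    ∃ l : Y →ₗ[R] Z, ∀ x, l (g x) = h x := by
  refine ⟨(LinearMap.ker g).liftQ h hh ∘ₗ (g.quotKerEquivOfSurjective hg).symm.toLinearMap,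
    fun x => ?_⟩
  have : (g.quotKerEquivOfSurjective hg).symm (g x) = (LinearMap.ker g).mkQ x := by
    rw [LinearEquiv.symm_apply_eq]
    rfl
  rw [LinearMap.comp_apply, LinearEquiv.coe_coe, this]
  rfl

/-- The zero graded module. -/
def GrMod.zero (R : GrRing.{u}) : GrMod.{u, w} R where
  carrier := PUnit
  piece _ := ⊤
  smul_mem := fun _ _ _ _ _ _ => trivial
  internal := isInternal_of_proj _ (fun e : Empty => e.elim) (fun e => e.elim) (fun e => e.elim)
    (fun _ _ _ e => e.elim) fun _ => ⟨∅, rfl⟩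

namespace ForkMod

variable {F : RingFork.{u}} {X Y Z : ForkMod.{u, w} F}

theorem hom_ext {f g : X ⟶ Y} (ha : ∀ x, Hom.a f x = Hom.a g x) (hb : ∀ x, Hom.b f x = Hom.b g x)
    (hc : ∀ x, Hom.c f x = Hom.c g x) : f = g :=
  Hom.ext (LinearMap.ext ha) (LinearMap.ext hb) (LinearMap.ext hc)

@[simp] theorem comp_a (f : X ⟶ Y) (g : Y ⟶ Z) (x) : Hom.a (f ≫ g) x = Hom.a g (Hom.a f x) := rfl
@[simp] theorem comp_b (f : X ⟶ Y) (g : Y ⟶ Z) (x) : Hom.b (f ≫ g) x = Hom.b g (Hom.b f x) := rfl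
@[simp] theorem comp_c (f : X ⟶ Y) (g : Y ⟶ Z) (x) : Hom.c (f ≫ g) x = Hom.c g (Hom.c f x) := rfl
@[simp] theorem id_a (x) : Hom.a (𝟙 X) x = x := rfl
@[simp] theorem id_b (x) : Hom.b (𝟙 X) x = x := rfl
@[simp] theorem id_c (x) : Hom.c (𝟙 X) x = x := rfl

instance : Zero (X ⟶ Y) where
  zero :=
    { a := 0, b := 0, c := 0
      a_mem := fun _ _ _ => zero_mem _, b_mem := fun _ _ _ => zero_mem _
      c_mem := fun _ _ _ => zero_mem _
      comm_k := fun _ => (map_zero _).symm, comm_m := fun _ => (map_zero _).symm }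

instance : Add (X ⟶ Y) where
  add f g :=
    { a := Hom.a f + Hom.a g, b := Hom.b f + Hom.b g, c := Hom.c f + Hom.c g
      a_mem := fun i x h => add_mem (Hom.a_mem f i x h) (Hom.a_mem g i x h)
      b_mem := fun i x h => add_mem (Hom.b_mem f i x h) (Hom.b_mem g i x h)
      c_mem := fun i x h => add_mem (Hom.c_mem f i x h) (Hom.c_mem g i x h)
      comm_k := fun x => by simp [Hom.comm_k f, Hom.comm_k g]
      comm_m := fun x => by simp [Hom.comm_m f, Hom.comm_m g] }

instance : Neg (X ⟶ Y) where
  neg f :=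
    { a := -Hom.a f, b := -Hom.b f, c := -Hom.c f
      a_mem := fun i x h => neg_mem (Hom.a_mem f i x h)
      b_mem := fun i x h => neg_mem (Hom.b_mem f i x h)
      c_mem := fun i x h => neg_mem (Hom.c_mem f i x h)
      comm_k := fun x => by simp [Hom.comm_k f]
      comm_m := fun x => by simp [Hom.comm_m f] }

@[simp] theorem zero_a (x) : Hom.a (0 : X ⟶ Y) x = 0 := rfl
@[simp] theorem zero_b (x) : Hom.b (0 : X ⟶ Y) x = 0 := rfl
@[simp] theorem zero_c (x) : Hom.c (0 : X ⟶ Y) x = 0 := rfl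
@[simp] theorem add_a (f g : X ⟶ Y) (x) : Hom.a (f + g) x = Hom.a f x + Hom.a g x := rfl
@[simp] theorem add_b (f g : X ⟶ Y) (x) : Hom.b (f + g) x = Hom.b f x + Hom.b g x := rfl
@[simp] theorem add_c (f g : X ⟶ Y) (x) : Hom.c (f + g) x = Hom.c f x + Hom.c g x := rfl
@[simp] theorem neg_a (f : X ⟶ Y) (x) : Hom.a (-f) x = -Hom.a f x := rfl
@[simp] theorem neg_b (f : X ⟶ Y) (x) : Hom.b (-f) x = -Hom.b f x := rfl
@[simp] theorem neg_c (f : X ⟶ Y) (x) : Hom.c (-f) x = -Hom.c f x := rfl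

instance : AddCommGroup (X ⟶ Y) :=
  { AddGroup.ofLeftAxioms (G := (X ⟶ Y))
      (fun f g h => hom_ext (by simp [add_assoc]) (by simp [add_assoc]) (by simp [add_assoc]))
      (fun f => hom_ext (by simp) (by simp) (by simp))
      (fun f => hom_ext (by simp) (by simp) (by simp)) with
    add_comm := fun f g => hom_ext (by simp [add_comm]) (by simp [add_comm]) (by simp [add_comm]) }

instance : Preadditive (ForkMod.{u, w} F) where
  add_comp _ _ _ _ _ _ := hom_ext (by simp) (by simp) (by simp)
  comp_add _ _ _ _ _ _ := hom_ext (by simp) (by simp) (by simp)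

/-- The zero module. -/
def zeroObj (F : RingFork.{u}) : ForkMod.{u, w} F where
  N := GrMod.zero F.R₁
  P := GrMod.zero F.R₂
  V := GrMod.zero F.R₃
  k := 0
  m := 0
  k_mem := fun _ _ _ => trivial
  m_mem := fun _ _ _ => trivial

theorem isZero_zeroObj : Limits.IsZero (zeroObj F : ForkMod.{u, w} F) := by
  rw [Limits.IsZero.iff_id_eq_zero]
  exact hom_ext (fun _ => rfl) (fun _ => rfl) (fun _ => rfl)

/-- The direct sum of two modules. -/
def prod (X Y : ForkMod.{u, w} F) : ForkMod.{u, w} F where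
  N := X.N.prod Y.N
  P := X.P.prod Y.P
  V := X.V.prod Y.V
  k :=
    { toFun := fun x => (X.k x.1, Y.k x.2)
      map_add' := fun _ _ => Prod.ext (map_add X.k _ _) (map_add Y.k _ _)
      map_smul' := fun _ _ => Prod.ext (map_smulₛₗ X.k _ _) (map_smulₛₗ Y.k _ _) }
  m :=
    { toFun := fun x => (X.m x.1, Y.m x.2)
      map_add' := fun _ _ => Prod.ext (map_add X.m _ _) (map_add Y.m _ _)
      map_smul' := fun _ _ => Prod.ext (map_smulₛₗ X.m _ _) (map_smulₛₗ Y.m _ _) }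
  k_mem := fun i _ h => ⟨X.k_mem i _ h.1, Y.k_mem i _ h.2⟩
  m_mem := fun i _ h => ⟨X.m_mem i _ h.1, Y.m_mem i _ h.2⟩

/-- The first projection. -/
def fst (X Y : ForkMod.{u, w} F) : X.prod Y ⟶ X :=
  ({ a := LinearMap.fst _ _ _, b := LinearMap.fst _ _ _, c := LinearMap.fst _ _ _
     a_mem := fun _ _ h => h.1, b_mem := fun _ _ h => h.1, c_mem := fun _ _ h => h.1
     comm_k := fun _ => rfl, comm_m := fun _ => rfl } : Hom (X.prod Y) X)

/-- The second projection. -/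
def snd (X Y : ForkMod.{u, w} F) : X.prod Y ⟶ Y :=
  ({ a := LinearMap.snd _ _ _, b := LinearMap.snd _ _ _, c := LinearMap.snd _ _ _
     a_mem := fun _ _ h => h.2, b_mem := fun _ _ h => h.2, c_mem := fun _ _ h => h.2
     comm_k := fun _ => rfl, comm_m := fun _ => rfl } : Hom (X.prod Y) Y)

/-- The map to a direct sum. -/
def pair (f : Z ⟶ X) (g : Z ⟶ Y) : Z ⟶ X.prod Y :=
  ({ a := (Hom.a f).prod (Hom.a g), b := (Hom.b f).prod (Hom.b g), c := (Hom.c f).prod (Hom.c g)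
     a_mem := fun i x h => ⟨Hom.a_mem f i x h, Hom.a_mem g i x h⟩
     b_mem := fun i x h => ⟨Hom.b_mem f i x h, Hom.b_mem g i x h⟩
     c_mem := fun i x h => ⟨Hom.c_mem f i x h, Hom.c_mem g i x h⟩
     comm_k := fun x => Prod.ext (Hom.comm_k f x) (Hom.comm_k g x)
     comm_m := fun x => Prod.ext (Hom.comm_m f x) (Hom.comm_m g x) } : Hom Z (X.prod Y))

/-- The direct sum is a product. -/
def isLimitProd (X Y : ForkMod.{u, w} F) :
    Limits.IsLimit (Limits.BinaryFan.mk (fst X Y) (snd X Y)) :=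
  Limits.BinaryFan.IsLimit.mk _ (fun f g => pair f g) (fun _ _ => rfl) (fun _ _ => rfl)
    fun f g m h₁ h₂ => by
      subst h₁ h₂
      exact hom_ext (fun _ => rfl) (fun _ => rfl) (fun _ => rfl)

instance : Limits.HasZeroObject (ForkMod.{u, w} F) := ⟨⟨_, isZero_zeroObj⟩⟩

instance : Limits.HasFiniteProducts (ForkMod.{u, w} F) := by
  have h1 : ∀ X Y : ForkMod.{u, w} F, Limits.HasLimit (Limits.pair X Y) := fun X Y =>
    ⟨⟨⟨_, isLimitProd X Y⟩⟩⟩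
  have : Limits.HasBinaryProducts (ForkMod.{u, w} F) := Limits.hasBinaryProducts_of_hasLimit_pair _
  have : Limits.HasTerminal (ForkMod.{u, w} F) := Limits.HasZeroObject.hasTerminal
  exact hasFiniteProducts_of_has_binary_and_terminal

/-- A sequence that is exact and injective in each of the three components. -/
structure LeftExact (f : X ⟶ Y) (g : Y ⟶ Z) : Prop where
  inj_a : Function.Injective (Hom.a f)
  inj_b : Function.Injective (Hom.b f)
  inj_c : Function.Injective (Hom.c f)
  exact_a : Function.Exact (Hom.a f) (Hom.a g)
  exact_b : Function.Exact (Hom.b f) (Hom.b g)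
  exact_c : Function.Exact (Hom.c f) (Hom.c g)

/-- A sequence that is exact and surjective in each of the three components. -/
structure RightExact (f : X ⟶ Y) (g : Y ⟶ Z) : Prop where
  surj_a : Function.Surjective (Hom.a g)
  surj_b : Function.Surjective (Hom.b g)
  surj_c : Function.Surjective (Hom.c g)
  exact_a : Function.Exact (Hom.a f) (Hom.a g)
  exact_b : Function.Exact (Hom.b f) (Hom.b g)
  exact_c : Function.Exact (Hom.c f) (Hom.c g)

theorem LeftExact.comp_eq_zero {f : X ⟶ Y} {g : Y ⟶ Z} (h : LeftExact f g) : f ≫ g = 0 :=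
  hom_ext h.exact_a.apply_apply_eq_zero h.exact_b.apply_apply_eq_zero
    h.exact_c.apply_apply_eq_zero

theorem RightExact.comp_eq_zero {f : X ⟶ Y} {g : Y ⟶ Z} (h : RightExact f g) : f ≫ g = 0 :=
  hom_ext h.exact_a.apply_apply_eq_zero h.exact_b.apply_apply_eq_zero
    h.exact_c.apply_apply_eq_zero

/-- The components are lifted separately. Compatibility with the structure maps can be checked after
the injective `b`, and degrees are reflected by injective graded maps. -/
theorem exists_lift {f : X ⟶ Y} (hfa : Function.Injective (Hom.a f))
    (hfb : Function.Injective (Hom.b f)) (hfc : Function.Injective (Hom.c f)) (h : Z ⟶ Y)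
    (ha : ∀ z, ∃ x, Hom.a f x = Hom.a h z) (hb : ∀ z, ∃ x, Hom.b f x = Hom.b h z)
    (hc : ∀ z, ∃ x, Hom.c f x = Hom.c h z) : ∃ l : Z ⟶ X, l ≫ f = h := by
  obtain ⟨la, hla⟩ := exists_lift_of_injective hfa (Hom.a h) ha
  obtain ⟨lb, hlb⟩ := exists_lift_of_injective hfb (Hom.b h) hb
  obtain ⟨lc, hlc⟩ := exists_lift_of_injective hfc (Hom.c h) hc
  refine ⟨({ a := la, b := lb, c := lc, a_mem := ?_, b_mem := ?_, c_mem := ?_, comm_k := ?_,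
             comm_m := ?_ } : Hom _ _), hom_ext hla hlb hlc⟩
  · intro i x hx
    refine mem_of_map_mem X.N.internal Y.N.internal (Hom.a f).toAddMonoidHom (Hom.a_mem f) hfa ?_
    exact (congrArg (· ∈ Y.N.piece i) (hla x)).mpr (Hom.a_mem h i x hx)
  · intro i x hx
    refine mem_of_map_mem X.P.internal Y.P.internal (Hom.b f).toAddMonoidHom (Hom.b_mem f) hfb ?_
    exact (congrArg (· ∈ Y.P.piece i) (hlb x)).mpr (Hom.b_mem h i x hx)
  · intro i x hx
    refine mem_of_map_mem X.V.internal Y.V.internal (Hom.c f).toAddMonoidHom (Hom.c_mem f) hfc ?_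
    exact (congrArg (· ∈ Y.V.piece i) (hlc x)).mpr (Hom.c_mem h i x hx)
  · intro x
    apply hfb
    rw [hlb, Hom.comm_k h, Hom.comm_k f, hla]
  · intro x
    apply hfb
    rw [hlb, Hom.comm_m h, Hom.comm_m f, hlc]

theorem exists_desc {g : X ⟶ Y} (hga : Function.Surjective (Hom.a g))
    (hgb : Function.Surjective (Hom.b g)) (hgc : Function.Surjective (Hom.c g)) (h : X ⟶ Z)
    (ha : ∀ x, Hom.a g x = 0 → Hom.a h x = 0) (hb : ∀ x, Hom.b g x = 0 → Hom.b h x = 0)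
    (hc : ∀ x, Hom.c g x = 0 → Hom.c h x = 0) : ∃ l : Y ⟶ Z, g ≫ l = h := by
  obtain ⟨la, hla⟩ := exists_desc_of_surjective hga (Hom.a h) ha
  obtain ⟨lb, hlb⟩ := exists_desc_of_surjective hgb (Hom.b h) hb
  obtain ⟨lc, hlc⟩ := exists_desc_of_surjective hgc (Hom.c h) hc
  refine ⟨({ a := la, b := lb, c := lc, a_mem := ?_, b_mem := ?_, c_mem := ?_, comm_k := ?_,
             comm_m := ?_ } : Hom _ _), hom_ext hla hlb hlc⟩
  · intro i y hy
    obtain ⟨x, hx, rfl⟩ := exists_mem_of_surjective X.N.internal Y.N.internal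
      (Hom.a g).toAddMonoidHom (Hom.a_mem g) hga hy
    exact (congrArg (· ∈ Z.N.piece i) (hla x)).mpr (Hom.a_mem h i x hx)
  · intro i y hy
    obtain ⟨x, hx, rfl⟩ := exists_mem_of_surjective X.P.internal Y.P.internal
      (Hom.b g).toAddMonoidHom (Hom.b_mem g) hgb hy
    exact (congrArg (· ∈ Z.P.piece i) (hlb x)).mpr (Hom.b_mem h i x hx)
  · intro i y hy
    obtain ⟨x, hx, rfl⟩ := exists_mem_of_surjective X.V.internal Y.V.internal
      (Hom.c g).toAddMonoidHom (Hom.c_mem g) hgc hy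
    exact (congrArg (· ∈ Z.V.piece i) (hlc x)).mpr (Hom.c_mem h i x hx)
  · intro y
    obtain ⟨x, rfl⟩ := hga y
    rw [hla, ← Hom.comm_k g, hlb, Hom.comm_k h]
  · intro y
    obtain ⟨x, rfl⟩ := hgc y
    rw [hlc, ← Hom.comm_m g, hlb, Hom.comm_m h]

/-- A left exact sequence exhibits a kernel. -/
def LeftExact.isLimit {f : X ⟶ Y} {g : Y ⟶ Z} (h : LeftExact f g) :
    Limits.IsLimit (Limits.KernelFork.ofι f h.comp_eq_zero) :=
  have key : ∀ {W : ForkMod.{u, w} F} (e : W ⟶ Y), e ≫ g = 0 → ∃ l : W ⟶ X, l ≫ f = e :=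
    fun e he => exists_lift h.inj_a h.inj_b h.inj_c e
      (fun z => (h.exact_a _).1 (DFunLike.congr_fun (congrArg Hom.a he) z))
      (fun z => (h.exact_b _).1 (DFunLike.congr_fun (congrArg Hom.b he) z))
      (fun z => (h.exact_c _).1 (DFunLike.congr_fun (congrArg Hom.c he) z))
  Limits.KernelFork.IsLimit.ofι _ _ (fun e he => (key e he).choose)
    (fun e he => (key e he).choose_spec) fun e he l hl => by
      have h1 := hl.trans (key e he).choose_spec.symm
      exact hom_ext (fun x => h.inj_a (DFunLike.congr_fun (congrArg Hom.a h1) x))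
        (fun x => h.inj_b (DFunLike.congr_fun (congrArg Hom.b h1) x))
        (fun x => h.inj_c (DFunLike.congr_fun (congrArg Hom.c h1) x))

/-- A right exact sequence exhibits a cokernel. -/
def RightExact.isColimit {f : X ⟶ Y} {g : Y ⟶ Z} (h : RightExact f g) :
    Limits.IsColimit (Limits.CokernelCofork.ofπ g h.comp_eq_zero) :=
  have key : ∀ {W : ForkMod.{u, w} F} (e : Y ⟶ W), f ≫ e = 0 → ∃ l : Z ⟶ W, g ≫ l = e :=
    fun e he => exists_desc h.surj_a h.surj_b h.surj_c e
      (fun z hz => by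
        obtain ⟨x, rfl⟩ := (h.exact_a z).1 hz
        exact DFunLike.congr_fun (congrArg Hom.a he) x)
      (fun z hz => by
        obtain ⟨x, rfl⟩ := (h.exact_b z).1 hz
        exact DFunLike.congr_fun (congrArg Hom.b he) x)
      (fun z hz => by
        obtain ⟨x, rfl⟩ := (h.exact_c z).1 hz
        exact DFunLike.congr_fun (congrArg Hom.c he) x)
  Limits.CokernelCofork.IsColimit.ofπ _ _ (fun e he => (key e he).choose)
    (fun e he => (key e he).choose_spec) fun e he l hl => by
      have h1 := hl.trans (key e he).choose_spec.symm
      refine hom_ext (fun z => ?_) (fun z => ?_) (fun z => ?_)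
      · obtain ⟨x, rfl⟩ := h.surj_a z
        exact DFunLike.congr_fun (congrArg Hom.a h1) x
      · obtain ⟨x, rfl⟩ := h.surj_b z
        exact DFunLike.congr_fun (congrArg Hom.b h1) x
      · obtain ⟨x, rfl⟩ := h.surj_c z
        exact DFunLike.congr_fun (congrArg Hom.c h1) x

/-! ### Kernels and cokernels, formed componentwise -/

section Kernel

variable (f : X ⟶ Y)

theorem ker_homogeneous {R : GrRing.{u}} {M N : GrMod.{u, w} R}
    (f : M.carrier →ₗ[R.carrier] N.carrier) (hf : ∀ i x, x ∈ M.piece i → f x ∈ N.piece i) :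
    ∀ x ∈ LinearMap.ker f, ∀ i, M.proj i x ∈ LinearMap.ker f := by
  intro x hx i
  rw [LinearMap.mem_ker] at hx ⊢
  have := gradedProj_map M.internal N.internal f.toAddMonoidHom hf i x
  refine this.symm.trans ?_
  change gradedProj N.internal i (f x) = 0
  rw [hx, map_zero]

theorem range_homogeneous {R : GrRing.{u}} {M N : GrMod.{u, w} R}
    (f : M.carrier →ₗ[R.carrier] N.carrier) (hf : ∀ i x, x ∈ M.piece i → f x ∈ N.piece i) :
    ∀ x ∈ LinearMap.range f, ∀ i, N.proj i x ∈ LinearMap.range f := by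
  rintro _ ⟨x, rfl⟩ i
  exact ⟨M.proj i x, (gradedProj_map M.internal N.internal f.toAddMonoidHom hf i x).symm⟩

/-- The kernel of a morphism. -/
def kernelObj : ForkMod.{u, w} F where
  N := X.N.sub (LinearMap.ker (Hom.a f)) (ker_homogeneous _ (Hom.a_mem f))
  P := X.P.sub (LinearMap.ker (Hom.b f)) (ker_homogeneous _ (Hom.b_mem f))
  V := X.V.sub (LinearMap.ker (Hom.c f)) (ker_homogeneous _ (Hom.c_mem f))
  k :=
    { toFun := fun x => ⟨X.k x.1, by
        have h : Hom.a f x.1 = 0 := x.2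
        rw [LinearMap.mem_ker, Hom.comm_k f, h, map_zero]⟩
      map_add' := fun x y => Subtype.ext (map_add X.k _ _)
      map_smul' := fun r x => Subtype.ext (map_smulₛₗ X.k _ _) }
  m :=
    { toFun := fun x => ⟨X.m x.1, by
        have h : Hom.c f x.1 = 0 := x.2
        rw [LinearMap.mem_ker, Hom.comm_m f, h, map_zero]⟩
      map_add' := fun x y => Subtype.ext (map_add X.m _ _)
      map_smul' := fun r x => Subtype.ext (map_smulₛₗ X.m _ _) }
  k_mem := fun i x h => X.k_mem i x.1 h
  m_mem := fun i x h => X.m_mem i x.1 h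

/-- The inclusion of the kernel. -/
def kernelι : kernelObj f ⟶ X :=
  ({ a := Submodule.subtype _, b := Submodule.subtype _, c := Submodule.subtype _
     a_mem := fun _ _ h => h, b_mem := fun _ _ h => h, c_mem := fun _ _ h => h
     comm_k := fun _ => rfl, comm_m := fun _ => rfl } : Hom (kernelObj f) X)

theorem leftExact_kernelι : LeftExact (kernelι f) f where
  inj_a := Subtype.val_injective
  inj_b := Subtype.val_injective
  inj_c := Subtype.val_injective
  exact_a := LinearMap.exact_subtype_ker_map _
  exact_b := LinearMap.exact_subtype_ker_map _
  exact_c := LinearMap.exact_subtype_ker_map _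

/-- The cokernel of a morphism. -/
def cokernelObj : ForkMod.{u, w} F where
  N := Y.N.quot (LinearMap.range (Hom.a f)) (range_homogeneous _ (Hom.a_mem f))
  P := Y.P.quot (LinearMap.range (Hom.b f)) (range_homogeneous _ (Hom.b_mem f))
  V := Y.V.quot (LinearMap.range (Hom.c f)) (range_homogeneous _ (Hom.c_mem f))
  k := (LinearMap.range (Hom.a f)).liftQ
    ((LinearMap.range (Hom.b f)).mkQ.comp Y.k) (by
      rintro _ ⟨x, rfl⟩
      exact (Submodule.Quotient.mk_eq_zero _).2 ⟨X.k x, Hom.comm_k f x⟩)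
  m := (LinearMap.range (Hom.c f)).liftQ
    ((LinearMap.range (Hom.b f)).mkQ.comp Y.m) (by
      rintro _ ⟨x, rfl⟩
      exact (Submodule.Quotient.mk_eq_zero _).2 ⟨X.m x, Hom.comm_m f x⟩)
  k_mem := by
    rintro i _ ⟨x, hx, rfl⟩
    exact ⟨Y.k x, Y.k_mem i x hx, rfl⟩
  m_mem := by
    rintro i _ ⟨x, hx, rfl⟩
    exact ⟨Y.m x, Y.m_mem i x hx, rfl⟩

/-- The projection to the cokernel. -/
def cokernelπ : Y ⟶ cokernelObj f :=
  ({ a := Submodule.mkQ _, b := Submodule.mkQ _, c := Submodule.mkQ _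
     a_mem := fun _ x h => ⟨x, h, rfl⟩, b_mem := fun _ x h => ⟨x, h, rfl⟩
     c_mem := fun _ x h => ⟨x, h, rfl⟩
     comm_k := fun _ => rfl, comm_m := fun _ => rfl } : Hom Y (cokernelObj f))

theorem rightExact_cokernelπ : RightExact f (cokernelπ f) where
  surj_a := Submodule.mkQ_surjective _
  surj_b := Submodule.mkQ_surjective _
  surj_c := Submodule.mkQ_surjective _
  exact_a := LinearMap.exact_map_mkQ_range _
  exact_b := LinearMap.exact_map_mkQ_range _
  exact_c := LinearMap.exact_map_mkQ_range _

instance : Limits.HasKernels (ForkMod.{u, w} F) := ⟨fun f => ⟨⟨⟨_, (leftExact_kernelι f).isLimit⟩⟩⟩⟩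

instance : Limits.HasCokernels (ForkMod.{u, w} F) :=
  ⟨fun f => ⟨⟨⟨_, (rightExact_cokernelπ f).isColimit⟩⟩⟩⟩

/-- The inclusion of the componentwise kernel of a monomorphism is zero, so all three components are
injective. A monomorphism is therefore the kernel of its cokernel, which is the normality demanded
of an abelian category. -/
theorem leftExact_cokernelπ [Mono f] : LeftExact f (cokernelπ f) := by
  have h : kernelι f = 0 := by
    rw [← cancel_mono f, Limits.zero_comp, (leftExact_kernelι f).comp_eq_zero]
  refine ⟨?_, ?_, ?_, (rightExact_cokernelπ f).exact_a, (rightExact_cokernelπ f).exact_b,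
    (rightExact_cokernelπ f).exact_c⟩
  · rw [injective_iff_map_eq_zero]
    exact fun x hx => DFunLike.congr_fun (congrArg Hom.a h)
      (⟨x, hx⟩ : LinearMap.ker (Hom.a f))
  · rw [injective_iff_map_eq_zero]
    exact fun x hx => DFunLike.congr_fun (congrArg Hom.b h)
      (⟨x, hx⟩ : LinearMap.ker (Hom.b f))
  · rw [injective_iff_map_eq_zero]
    exact fun x hx => DFunLike.congr_fun (congrArg Hom.c h)
      (⟨x, hx⟩ : LinearMap.ker (Hom.c f))

theorem rightExact_kernelι [Epi f] : RightExact (kernelι f) f := by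
  have h : cokernelπ f = 0 := by
    rw [← cancel_epi f, Limits.comp_zero, (rightExact_cokernelπ f).comp_eq_zero]
  refine ⟨?_, ?_, ?_, (leftExact_kernelι f).exact_a, (leftExact_kernelι f).exact_b,
    (leftExact_kernelι f).exact_c⟩
  · exact fun y => ((rightExact_cokernelπ f).exact_a y).1
      (DFunLike.congr_fun (congrArg Hom.a h) y)
  · exact fun y => ((rightExact_cokernelπ f).exact_b y).1
      (DFunLike.congr_fun (congrArg Hom.b h) y)
  · exact fun y => ((rightExact_cokernelπ f).exact_c y).1
      (DFunLike.congr_fun (congrArg Hom.c h) y)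

end Kernel

instance : IsNormalMonoCategory (ForkMod.{u, w} F) where
  normalMonoOfMono f _ := ⟨⟨_, cokernelπ f, _, (leftExact_cokernelπ f).isLimit⟩⟩

instance : IsNormalEpiCategory (ForkMod.{u, w} F) where
  normalEpiOfEpi f _ := ⟨⟨_, kernelι f, _, (rightExact_kernelι f).isColimit⟩⟩

instance : Abelian (ForkMod.{u, w} F) where

theorem extended_of_iso (e : X ≅ Y) (hX : F.extended X) : F.extended Y := by
  let ea : X.N.carrier ≃ₗ[F.R₁.carrier] Y.N.carrier := LinearEquiv.ofLinearMap (Hom.a e.hom)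
    (Hom.a e.inv) (congrArg Hom.a e.inv_hom_id) (congrArg Hom.a e.hom_inv_id)
  let eb : X.P.carrier ≃ₗ[F.R₂.carrier] Y.P.carrier := LinearEquiv.ofLinearMap (Hom.b e.hom)
    (Hom.b e.inv) (congrArg Hom.b e.inv_hom_id) (congrArg Hom.b e.hom_inv_id)
  let ec : X.V.carrier ≃ₗ[F.R₃.carrier] Y.V.carrier := LinearEquiv.ofLinearMap (Hom.c e.hom)
    (Hom.c e.inv) (congrArg Hom.c e.inv_hom_id) (congrArg Hom.c e.hom_inv_id)
  exact ⟨hX.1.of_equiv ea eb (Hom.comm_k e.hom), hX.2.of_equiv ec eb (Hom.comm_m e.hom)⟩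

theorem extended_of_isZero (hX : Limits.IsZero X) : F.extended X := by
  have h := (Limits.IsZero.iff_id_eq_zero X).1 hX
  have hN : ∀ x : X.N.carrier, x = 0 := fun x => DFunLike.congr_fun (congrArg Hom.a h) x
  have hP : ∀ x : X.P.carrier, x = 0 := fun x => DFunLike.congr_fun (congrArg Hom.b h) x
  have hV : ∀ x : X.V.carrier, x = 0 := fun x => DFunLike.congr_fun (congrArg Hom.c h) x
  -- The extension of scalars of a zero module is zero, hence isomorphic to any other zero module.
  have key : ∀ {R S : GrRing.{u}} {l : R.Hom S} {M : GrMod.{u, w} R} {N : GrMod.{u, w} S}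
      (f : M.carrier →ₛₗ[l.toRingHom] N.carrier), (∀ x : M.carrier, x = 0) →
      (∀ x : N.carrier, x = 0) → IsExtensionOfScalars l.toRingHom f := by
    intro R S l M N f hM hN
    have h0 : ∀ x : (M.extend l).carrier, x = 0 := fun x => by
      induction x using (M.isExtensionOfScalars_toExtend l).induction with
      | smul s m => rw [hM m, map_zero, smul_zero]
      | add x y hx hy => rw [hx, hy, add_zero]
    exact (M.isExtensionOfScalars_toExtend l).of_equiv (LinearEquiv.refl _ _)
      (LinearEquiv.ofLinearMap 0 0 (LinearMap.ext fun x => (hN _).trans (hN x).symm)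
        (LinearMap.ext fun x => (h0 _).trans (h0 x).symm)) fun m => (hN _).trans (hN _).symm
  exact ⟨key _ hN hP, key _ hV hP⟩

theorem extended_of_leftExact (hl : F.l.toRingHom.Flat) (hι : F.ι.toRingHom.Flat) {f : X ⟶ Y}
    {g : Y ⟶ Z} (h : LeftExact f g) (hY : F.extended Y) (hZ : F.extended Z) : F.extended X :=
  ⟨IsExtensionOfScalars.of_left_exact hl (fun x => (Hom.comm_k f x).symm)
      (fun x => (Hom.comm_k g x).symm) hY.1 hZ.1 h.inj_a h.exact_a h.inj_b h.exact_b,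
    IsExtensionOfScalars.of_left_exact hι (fun x => (Hom.comm_m f x).symm)
      (fun x => (Hom.comm_m g x).symm) hY.2 hZ.2 h.inj_c h.exact_c h.inj_b h.exact_b⟩

theorem extended_of_rightExact {f : X ⟶ Y} {g : Y ⟶ Z} (h : RightExact f g) (hX : F.extended X)
    (hY : F.extended Y) : F.extended Z :=
  ⟨IsExtensionOfScalars.of_right_exact (fun x => (Hom.comm_k f x).symm)
      (fun x => (Hom.comm_k g x).symm) hX.1 hY.1 h.surj_a h.exact_a h.surj_b h.exact_b,
    IsExtensionOfScalars.of_right_exact (fun x => (Hom.comm_m f x).symm)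
      (fun x => (Hom.comm_m g x).symm) hX.2 hY.2 h.surj_c h.exact_c h.surj_b h.exact_b⟩

theorem extended_prod (hX : F.extended X) (hY : F.extended Y) : F.extended (X.prod Y) :=
  ⟨hX.1.prod hY.1 fun _ => rfl, hX.2.prod hY.2 fun _ => rfl⟩

end ForkMod

/-- The extended modules over a diagram of rings with flat maps form an abelian category. -/
theorem nonempty_abelian_extended {F : RingFork.{u}} (hl : F.l.toRingHom.Flat)
    (hι : F.ι.toRingHom.Flat) : Nonempty (Abelian (RingFork.extended.{u, w} F).FullSubcategory) := by
  have : (RingFork.extended.{u, w} F).IsClosedUnderIsomorphisms := ⟨ForkMod.extended_of_iso⟩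
  have : (RingFork.extended.{u, w} F).ContainsZero :=
    ⟨_, ForkMod.isZero_zeroObj, ForkMod.extended_of_isZero ForkMod.isZero_zeroObj⟩
  -- The property is invariant under isomorphism, so the explicit componentwise kernel suffices.
  -- Flatness of both structure maps enters here and nowhere else in this proof.
  have : (RingFork.extended.{u, w} F).IsClosedUnderKernels := ⟨by
    rintro _ ⟨f, k, hk, hf⟩
    exact ForkMod.extended_of_iso
      (((ForkMod.leftExact_kernelι f).isLimit).conePointUniqueUpToIso hk)
      (ForkMod.extended_of_leftExact hl hι (ForkMod.leftExact_kernelι f) hf.1 hf.2)⟩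
  have : (RingFork.extended.{u, w} F).IsClosedUnderCokernels := ⟨by
    rintro _ ⟨f, k, hk, hf⟩
    exact ForkMod.extended_of_iso
      (((ForkMod.rightExact_cokernelπ f).isColimit).coconePointUniqueUpToIso hk)
      (ForkMod.extended_of_rightExact (ForkMod.rightExact_cokernelπ f) hf.1 hf.2)⟩
  have : (RingFork.extended.{u, w} F).IsClosedUnderBinaryProducts := ⟨by
    rintro Z ⟨p⟩
    let G := p.diag
    have e : Limits.pair (G.obj ⟨.left⟩) (G.obj ⟨.right⟩) ≅ G := (Limits.diagramIsoPair G).symm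
    have h := p.prop_diag_obj
    exact ForkMod.extended_of_iso
      ((ForkMod.isLimitProd (G.obj ⟨.left⟩) (G.obj ⟨.right⟩)).conePointsIsoOfNatIso p.isLimit e)
      (ForkMod.extended_prod (h ⟨.left⟩) (h ⟨.right⟩))⟩
  have : (RingFork.extended.{u, w} F).IsClosedUnderFiniteProducts :=
    ObjectProperty.IsClosedUnderFiniteProducts.mk'
  exact ⟨inferInstance⟩

/-! ## Extension of scalars along a map of diagrams of rings -/

/-- A degree-preserving semilinear map from a module over a diagram of rings to a module over
another one. -/
structure ForkMod.SemiHom {F : RingFork.{u}} {G : RingFork.{u}} (h : F.Hom G) (X : ForkMod.{u, w} F)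
    (Y : ForkMod.{u, w} G) where
  a : X.N.carrier →ₛₗ[h.h₁.toRingHom] Y.N.carrier
  b : X.P.carrier →ₛₗ[h.h₂.toRingHom] Y.P.carrier
  c : X.V.carrier →ₛₗ[h.h₃.toRingHom] Y.V.carrier
  a_mem : ∀ i x, x ∈ X.N.piece i → a x ∈ Y.N.piece i
  b_mem : ∀ i x, x ∈ X.P.piece i → b x ∈ Y.P.piece i
  c_mem : ∀ i x, x ∈ X.V.piece i → c x ∈ Y.V.piece i
  comm_k : ∀ x, b (X.k x) = Y.k (a x)
  comm_m : ∀ x, b (X.m x) = Y.m (c x)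

theorem IsExtensionOfScalars.bijective {R S M N : Type*} [CommRing R] [CommRing S]
    [AddCommGroup M] [AddCommGroup N] [Module R M] [Module S N] {l : R →+* S} {f : M →ₛₗ[l] N}
    (h : IsExtensionOfScalars l f) (hl : Function.Bijective l) : Function.Bijective f := by
  let _ : Algebra R S := l.toAlgebra
  let _ : Module R N := Module.compHom N l
  have : IsScalarTower R S N := ⟨fun r s n => mul_smul (l r) s n⟩
  let f₀ : M →ₗ[R] N := { toFun := f, map_add' := f.map_add, map_smul' := f.map_smulₛₗ }
  have hf : IsBaseChange S f₀ := h
  have h1 : ∀ x, f x = hf.equiv (TensorProduct.congr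
      (LinearEquiv.ofBijective (Algebra.linearMap R S) hl) (LinearEquiv.refl R M)
      ((TensorProduct.lid R M).symm x)) := by
    intro x
    have h1 : (LinearEquiv.ofBijective (Algebra.linearMap R S) hl) 1 = 1 := map_one l
    simp [IsBaseChange.equiv_tmul, h1]
    rfl
  have h2 : ⇑f = hf.equiv ∘ (TensorProduct.congr
      (LinearEquiv.ofBijective (Algebra.linearMap R S) hl) (LinearEquiv.refl R M)) ∘
      (TensorProduct.lid R M).symm := funext h1
  rw [h2]
  exact hf.equiv.bijective.comp ((LinearEquiv.bijective _).comp (LinearEquiv.bijective _))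

namespace ForkMod

variable {F G : RingFork.{u}} {h : F.Hom G}

namespace SemiHom

variable {X X' : ForkMod.{u, w} F} {Y Z : ForkMod.{u, w} G}

/-- The property of a semilinear map that it is an extension of scalars. -/
structure IsExtended (σ : SemiHom h X Y) : Prop where
  a : IsExtensionOfScalars h.h₁.toRingHom σ.a
  b : IsExtensionOfScalars h.h₂.toRingHom σ.b
  c : IsExtensionOfScalars h.h₃.toRingHom σ.c

theorem IsExtended.hom_ext {σ : SemiHom h X Y} (hσ : σ.IsExtended) {f g : Y ⟶ Z}
    (ha : ∀ x, Hom.a f (σ.a x) = Hom.a g (σ.a x)) (hb : ∀ x, Hom.b f (σ.b x) = Hom.b g (σ.b x))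
    (hc : ∀ x, Hom.c f (σ.c x) = Hom.c g (σ.c x)) : f = g :=
  Hom.ext (hσ.a.hom_ext ha) (hσ.b.hom_ext hb) (hσ.c.hom_ext hc)

theorem IsExtended.exists_desc {σ : SemiHom h X Y} (hσ : σ.IsExtended) (τ : SemiHom h X Z) :
    ∃ f : Y ⟶ Z, (∀ x, Hom.a f (σ.a x) = τ.a x) ∧ (∀ x, Hom.b f (σ.b x) = τ.b x) ∧
      ∀ x, Hom.c f (σ.c x) = τ.c x := by
  obtain ⟨a, ha⟩ := hσ.a.exists_lift τ.a
  obtain ⟨b, hb⟩ := hσ.b.exists_lift τ.b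
  obtain ⟨c, hc⟩ := hσ.c.exists_lift τ.c
  refine ⟨{ a := a, b := b, c := c, a_mem := ?_, b_mem := ?_, c_mem := ?_
            comm_k := ?_, comm_m := ?_ }, ha, hb, hc⟩
  · refine hσ.a.mem_piece σ.a_mem Z.N.internal a.toAddMonoidHom fun i j s x hs hx => ?_
    change a (s • σ.a x) ∈ _
    rw [map_smul, ha]
    exact Z.N.smul_mem _ _ _ _ hs (τ.a_mem _ _ hx)
  · refine hσ.b.mem_piece σ.b_mem Z.P.internal b.toAddMonoidHom fun i j s x hs hx => ?_
    change b (s • σ.b x) ∈ _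
    rw [map_smul, hb]
    exact Z.P.smul_mem _ _ _ _ hs (τ.b_mem _ _ hx)
  · refine hσ.c.mem_piece σ.c_mem Z.V.internal c.toAddMonoidHom fun i j s x hs hx => ?_
    change c (s • σ.c x) ∈ _
    rw [map_smul, hc]
    exact Z.V.smul_mem _ _ _ _ hs (τ.c_mem _ _ hx)
  · intro y
    induction y using IsExtensionOfScalars.induction hσ.a with
    | smul s x => rw [map_smulₛₗ, map_smul, map_smul, map_smulₛₗ, ← σ.comm_k, hb, ha, τ.comm_k]
    | add x y hx hy => simp only [map_add, hx, hy]
  · intro y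
    induction y using IsExtensionOfScalars.induction hσ.c with
    | smul s x => rw [map_smulₛₗ, map_smul, map_smul, map_smulₛₗ, ← σ.comm_m, hb, hc, τ.comm_m]
    | add x y hx hy => simp only [map_add, hx, hy]

/-- The composition of a linear map with a semilinear map. -/
def precomp (f : X' ⟶ X) (σ : SemiHom h X Y) : SemiHom h X' Y where
  a := σ.a.comp (Hom.a f)
  b := σ.b.comp (Hom.b f)
  c := σ.c.comp (Hom.c f)
  a_mem := fun i x hx => σ.a_mem i _ (Hom.a_mem f i x hx)
  b_mem := fun i x hx => σ.b_mem i _ (Hom.b_mem f i x hx)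
  c_mem := fun i x hx => σ.c_mem i _ (Hom.c_mem f i x hx)
  comm_k := fun x => (congrArg σ.b (Hom.comm_k f x)).trans (σ.comm_k _)
  comm_m := fun x => (congrArg σ.b (Hom.comm_m f x)).trans (σ.comm_m _)

theorem IsExtended.nonempty_iso {σ : SemiHom h X Y} (hσ : σ.IsExtended) {τ : SemiHom h X Z}
    (hτ : τ.IsExtended) : Nonempty (Y ≅ Z) := by
  obtain ⟨f, fa, fb, fc⟩ := hσ.exists_desc τ
  obtain ⟨g, ga, gb, gc⟩ := hτ.exists_desc σ
  exact ⟨⟨f, g, hσ.hom_ext (by simp [fa, ga]) (by simp [fb, gb]) (by simp [fc, gc]),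
    hτ.hom_ext (by simp [fa, ga]) (by simp [fb, gb]) (by simp [fc, gc])⟩⟩

/-- In the square formed by `X.k`, `σ.b`, `σ.a` and `Y.k`, the diagonal is a composite of two
extensions of scalars; cancelling `σ.a` leaves `Y.k`. The same argument applies to `m`. -/
theorem IsExtended.extended {σ : SemiHom h X Y} (hσ : σ.IsExtended) (hX : F.extended X) :
    G.extended Y := by
  have : RingHomCompTriple h.h₁.toRingHom G.l.toRingHom (G.l.toRingHom.comp h.h₁.toRingHom) := ⟨rfl⟩
  have : RingHomCompTriple h.h₃.toRingHom G.ι.toRingHom (G.ι.toRingHom.comp h.h₃.toRingHom) := ⟨rfl⟩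
  constructor
  · refine (hσ.a.comp_iff (gf := (Y.k.comp σ.a :
      X.N.carrier →ₛₗ[G.l.toRingHom.comp h.h₁.toRingHom] Y.P.carrier)) (fun _ => rfl)
      fun _ => rfl).1 ?_
    exact (hX.1.comp_iff (g := σ.b) (fun r => (h.comm_l r).symm)
      fun x => (σ.comm_k x).symm).2 hσ.b
  · refine (hσ.c.comp_iff (gf := (Y.m.comp σ.c :
      X.V.carrier →ₛₗ[G.ι.toRingHom.comp h.h₃.toRingHom] Y.P.carrier)) (fun _ => rfl)
      fun _ => rfl).1 ?_
    exact (hX.2.comp_iff (g := σ.b) (fun r => (h.comm_ι r).symm)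
      fun x => (σ.comm_m x).symm).2 hσ.b

end SemiHom

/-- The three modules are extended independently, and the universal property supplies the structure
maps. Modules are taken in the universe of the rings so that tensor products stay in it. -/
theorem exists_isExtended (h : F.Hom G) (X : ForkMod.{u, u} F) :
    ∃ (Y : ForkMod.{u, u} G) (σ : SemiHom h X Y), σ.IsExtended := by
  have : RingHomCompTriple F.l.toRingHom h.h₂.toRingHom (h.h₂.toRingHom.comp F.l.toRingHom) := ⟨rfl⟩
  have : RingHomCompTriple F.ι.toRingHom h.h₂.toRingHom (h.h₂.toRingHom.comp F.ι.toRingHom) := ⟨rfl⟩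
  obtain ⟨k, hk⟩ := (X.N.isExtensionOfScalars_toExtend h.h₁).exists_lift_semilinear
    (l' := G.l.toRingHom) (l'' := h.h₂.toRingHom.comp F.l.toRingHom) h.comm_l
    ((X.P.toExtend h.h₂).comp X.k)
  obtain ⟨m, hm⟩ := (X.V.isExtensionOfScalars_toExtend h.h₃).exists_lift_semilinear
    (l' := G.ι.toRingHom) (l'' := h.h₂.toRingHom.comp F.ι.toRingHom) h.comm_ι
    ((X.P.toExtend h.h₂).comp X.m)
  refine ⟨⟨X.N.extend h.h₁, X.P.extend h.h₂, X.V.extend h.h₃, k, m, ?_, ?_⟩,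
    ⟨X.N.toExtend h.h₁, X.P.toExtend h.h₂, X.V.toExtend h.h₃, X.N.toExtend_mem _,
      X.P.toExtend_mem _, X.V.toExtend_mem _, fun x => (hk x).symm, fun x => (hm x).symm⟩,
    ⟨X.N.isExtensionOfScalars_toExtend h.h₁, X.P.isExtensionOfScalars_toExtend h.h₂,
      X.V.isExtensionOfScalars_toExtend h.h₃⟩⟩
  · refine (X.N.isExtensionOfScalars_toExtend h.h₁).mem_piece (X.N.toExtend_mem _)
      (GrMod.internal _) k.toAddMonoidHom fun i j s x hs hx => ?_
    change k (s • X.N.toExtend _ x) ∈ _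
    rw [map_smulₛₗ, hk]
    exact GrMod.smul_mem _ _ _ _ _ (G.l.map_mem _ _ hs) (X.P.toExtend_mem _ _ _ (X.k_mem _ _ hx))
  · refine (X.V.isExtensionOfScalars_toExtend h.h₃).mem_piece (X.V.toExtend_mem _)
      (GrMod.internal _) m.toAddMonoidHom fun i j s x hs hx => ?_
    change m (s • X.V.toExtend _ x) ∈ _
    rw [map_smulₛₗ, hm]
    exact GrMod.smul_mem _ _ _ _ _ (G.ι.map_mem _ _ hs) (X.P.toExtend_mem _ _ _ (X.m_mem _ _ hx))

end ForkMod

/-- Extension of scalars along a map of diagrams of rings, on the categories of extended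
modules. -/
theorem exists_extensionFunctor {F G : RingFork.{u}} (h : F.Hom G) :
    ∃ (Φ : (RingFork.extended.{u, u} F).FullSubcategory ⥤
        (RingFork.extended.{u, u} G).FullSubcategory)
      (σ : ∀ X, ForkMod.SemiHom h X.obj (Φ.obj X).obj), (∀ X, (σ X).IsExtended) ∧
      ∀ {X Y} (f : X ⟶ Y), (∀ x, ForkMod.Hom.a (Φ.map f).hom ((σ X).a x) =
          (σ Y).a (ForkMod.Hom.a f.hom x)) ∧
        (∀ x, ForkMod.Hom.b (Φ.map f).hom ((σ X).b x) = (σ Y).b (ForkMod.Hom.b f.hom x)) ∧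
        ∀ x, ForkMod.Hom.c (Φ.map f).hom ((σ X).c x) = (σ Y).c (ForkMod.Hom.c f.hom x) := by
  choose Y σ hσ using fun X : ForkMod.{u, u} F => ForkMod.exists_isExtended h X
  choose φ ha hb hc using fun (X X' : ForkMod.{u, u} F) (f : X ⟶ X') =>
    (hσ X).exists_desc ((σ X').precomp f)
  have ha' : ∀ X X' (f : X ⟶ X') x, ForkMod.Hom.a (φ X X' f) ((σ X).a x) =
    (σ X').a (ForkMod.Hom.a f x) := ha
  have hb' : ∀ X X' (f : X ⟶ X') x, ForkMod.Hom.b (φ X X' f) ((σ X).b x) =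
    (σ X').b (ForkMod.Hom.b f x) := hb
  have hc' : ∀ X X' (f : X ⟶ X') x, ForkMod.Hom.c (φ X X' f) ((σ X).c x) =
    (σ X').c (ForkMod.Hom.c f x) := hc
  refine ⟨{ obj := fun X => ⟨Y X.obj, (hσ X.obj).extended X.property⟩,
            map := fun f => ObjectProperty.homMk (φ _ _ f.hom), map_id := ?_, map_comp := ?_ },
    fun X => σ X.obj, fun X => hσ X.obj, fun {X Y} f => ⟨ha' _ _ _, hb' _ _ _, hc' _ _ _⟩⟩
  · intro X
    ext1
    exact (hσ X.obj).hom_ext (fun x => ha' _ _ _ x) (fun x => hb' _ _ _ x) fun x => hc' _ _ _ x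
  · intro X₁ X₂ X₃ f g
    ext1
    refine (hσ X₁.obj).hom_ext (fun x => ?_) (fun x => ?_) fun x => ?_
    · simp [ha']
    · simp [hb']
    · simp [hc']

/-! ## Gluing modules over diagrams of rings -/

/-- A map of diagrams of rings `(A → B ← C) ⟶ (A' → B' ← C')` such that `A = A' ×_{B'} B`,
`B' = A' + B`, the rings `B` and `B'` are localizations of `A` and `A'` at the same elements, `B'`
is flat over `C'` and `C = C'`. -/
structure RingFork.Hom.IsGluing {F G : RingFork.{u}} (h : F.Hom G) (E : Submonoid F.R₁.carrier) :
    Prop where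
  injective : Function.Injective F.l.toRingHom
  exists_of_eq : ∀ a' b, G.l.toRingHom a' = h.h₂.toRingHom b →
    ∃ a, h.h₁.toRingHom a = a' ∧ F.l.toRingHom a = b
  exists_add : ∀ x, ∃ a' b, x = G.l.toRingHom a' + h.h₂.toRingHom b
  isLocalization : letI := F.l.toRingHom.toAlgebra; IsLocalization E F.R₂.carrier
  isLocalization_map : letI := G.l.toRingHom.toAlgebra
    IsLocalization (E.map h.h₁.toRingHom) G.R₂.carrier
  flat : G.ι.toRingHom.Flat
  bijective : Function.Bijective h.h₃.toRingHom

namespace RingFork.Hom.IsGluing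

variable {F G : RingFork.{u}} {h : F.Hom G} {E : Submonoid F.R₁.carrier} (hh : h.IsGluing E)
  {X : ForkMod.{u, w} F} {Y : ForkMod.{u, w} G}

include hh

theorem flat_comp : (h.h₂.toRingHom.comp F.ι.toRingHom).Flat := by
  have h1 : h.h₂.toRingHom.comp F.ι.toRingHom = G.ι.toRingHom.comp h.h₃.toRingHom :=
    RingHom.ext h.comm_ι
  rw [h1]
  exact .comp (.of_bijective hh.bijective) hh.flat

/-- `IsGluingSquare.existsUnique` with the ring homomorphisms of the diagrams turned into algebra
structures; flatness of `B` over `A` comes from localization, and that of `B'` over `C` from `C =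
C'`. -/
theorem existsUnique (hX : F.extended X) {σ : ForkMod.SemiHom h X Y} (hσ : σ.IsExtended)
    (n' : Y.N.carrier) (p : X.P.carrier) (hnp : Y.k n' = σ.b p) :
    ∃! n, σ.a n = n' ∧ X.k n = p := by
  let _ : Algebra F.R₁.carrier F.R₂.carrier := F.l.toRingHom.toAlgebra
  let _ : Algebra F.R₁.carrier G.R₁.carrier := h.h₁.toRingHom.toAlgebra
  let _ : Algebra F.R₂.carrier G.R₂.carrier := h.h₂.toRingHom.toAlgebra
  let _ : Algebra G.R₁.carrier G.R₂.carrier := G.l.toRingHom.toAlgebra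
  let _ : Algebra F.R₁.carrier G.R₂.carrier := (h.h₂.toRingHom.comp F.l.toRingHom).toAlgebra
  let _ : Algebra F.R₃.carrier F.R₂.carrier := F.ι.toRingHom.toAlgebra
  let _ : Algebra F.R₃.carrier G.R₂.carrier := (h.h₂.toRingHom.comp F.ι.toRingHom).toAlgebra
  have : IsScalarTower F.R₁.carrier F.R₂.carrier G.R₂.carrier := .of_algebraMap_eq fun _ => rfl
  have : IsScalarTower F.R₁.carrier G.R₁.carrier G.R₂.carrier := .of_algebraMap_eq h.comm_l
  have : IsScalarTower F.R₃.carrier F.R₂.carrier G.R₂.carrier := .of_algebraMap_eq fun _ => rfl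
  let _ : Module F.R₁.carrier X.P.carrier := Module.compHom _ F.l.toRingHom
  let _ : Module F.R₃.carrier X.P.carrier := Module.compHom _ F.ι.toRingHom
  have : IsScalarTower F.R₁.carrier F.R₂.carrier X.P.carrier := ⟨fun r s n => mul_smul _ s n⟩
  have : IsScalarTower F.R₃.carrier F.R₂.carrier X.P.carrier := ⟨fun r s n => mul_smul _ s n⟩
  let _ : Module F.R₁.carrier Y.N.carrier := Module.compHom _ h.h₁.toRingHom
  have : IsScalarTower F.R₁.carrier G.R₁.carrier Y.N.carrier := ⟨fun r s n => mul_smul _ s n⟩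
  let _ : Module F.R₂.carrier Y.P.carrier := Module.compHom _ h.h₂.toRingHom
  let _ : Module G.R₁.carrier Y.P.carrier := Module.compHom _ G.l.toRingHom
  let _ : Module F.R₁.carrier Y.P.carrier :=
    Module.compHom _ (h.h₂.toRingHom.comp F.l.toRingHom)
  have : IsScalarTower F.R₂.carrier G.R₂.carrier Y.P.carrier := ⟨fun r s n => mul_smul _ s n⟩
  have : IsScalarTower G.R₁.carrier G.R₂.carrier Y.P.carrier := ⟨fun r s n => mul_smul _ s n⟩
  have : IsScalarTower F.R₁.carrier F.R₂.carrier Y.P.carrier := .of_algebraMap_smul fun _ _ => rfl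
  have : IsScalarTower F.R₁.carrier G.R₁.carrier Y.P.carrier := .of_algebraMap_smul fun r x => by
    change G.l.toRingHom (h.h₁.toRingHom r) • x = h.h₂.toRingHom (F.l.toRingHom r) • x
    rw [h.comm_l]
  have hsq : IsGluingSquare F.R₁.carrier F.R₂.carrier G.R₁.carrier G.R₂.carrier :=
    ⟨hh.injective, hh.exists_of_eq, hh.exists_add⟩
  have : IsLocalization E F.R₂.carrier := hh.isLocalization
  have : Module.Flat F.R₁.carrier F.R₂.carrier := IsLocalization.flat _ E
  have : Module.Flat F.R₃.carrier G.R₂.carrier := hh.flat_comp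
  let k : X.N.carrier →ₗ[F.R₁.carrier] X.P.carrier :=
    { toFun := X.k, map_add' := X.k.map_add, map_smul' := X.k.map_smulₛₗ }
  let m : X.V.carrier →ₗ[F.R₃.carrier] X.P.carrier :=
    { toFun := X.m, map_add' := X.m.map_add, map_smul' := X.m.map_smulₛₗ }
  let k' : Y.N.carrier →ₗ[G.R₁.carrier] Y.P.carrier :=
    { toFun := Y.k, map_add' := Y.k.map_add, map_smul' := Y.k.map_smulₛₗ }
  let α : X.N.carrier →ₗ[F.R₁.carrier] Y.N.carrier :=
    { toFun := σ.a, map_add' := σ.a.map_add, map_smul' := σ.a.map_smulₛₗ }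
  let β : X.P.carrier →ₗ[F.R₂.carrier] Y.P.carrier :=
    { toFun := σ.b, map_add' := σ.b.map_add, map_smul' := σ.b.map_smulₛₗ }
  have hk : IsBaseChange F.R₂.carrier k := hX.1
  have hm : IsBaseChange F.R₂.carrier m := hX.2
  have hα : IsBaseChange G.R₁.carrier α := hσ.a
  have hβ : IsBaseChange G.R₂.carrier β := hσ.b
  exact hsq.existsUnique hk hm hα hβ k' (fun n => (σ.comm_k n).symm) n' p hnp

/-- `IsGluingSquare.isBaseChange` in the same translation; it shows that a fibre product of modules
extends to the module it was built from. -/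
theorem isExtensionOfScalars (hX : F.extended X) (σ : ForkMod.SemiHom h X Y)
    (hσ : IsExtensionOfScalars h.h₂.toRingHom σ.b)
    (hn : ∀ n' p, Y.k n' = σ.b p → ∃! n, σ.a n = n' ∧ X.k n = p) :
    IsExtensionOfScalars h.h₁.toRingHom σ.a := by
  let _ : Algebra F.R₁.carrier F.R₂.carrier := F.l.toRingHom.toAlgebra
  let _ : Algebra F.R₁.carrier G.R₁.carrier := h.h₁.toRingHom.toAlgebra
  let _ : Algebra F.R₂.carrier G.R₂.carrier := h.h₂.toRingHom.toAlgebra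
  let _ : Algebra G.R₁.carrier G.R₂.carrier := G.l.toRingHom.toAlgebra
  let _ : Algebra F.R₁.carrier G.R₂.carrier := (h.h₂.toRingHom.comp F.l.toRingHom).toAlgebra
  let _ : Algebra F.R₃.carrier F.R₂.carrier := F.ι.toRingHom.toAlgebra
  let _ : Algebra F.R₃.carrier G.R₂.carrier := (h.h₂.toRingHom.comp F.ι.toRingHom).toAlgebra
  have : IsScalarTower F.R₁.carrier F.R₂.carrier G.R₂.carrier := .of_algebraMap_eq fun _ => rfl
  have : IsScalarTower F.R₁.carrier G.R₁.carrier G.R₂.carrier := .of_algebraMap_eq h.comm_l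
  have : IsScalarTower F.R₃.carrier F.R₂.carrier G.R₂.carrier := .of_algebraMap_eq fun _ => rfl
  let _ : Module F.R₁.carrier X.P.carrier := Module.compHom _ F.l.toRingHom
  let _ : Module F.R₃.carrier X.P.carrier := Module.compHom _ F.ι.toRingHom
  have : IsScalarTower F.R₁.carrier F.R₂.carrier X.P.carrier := ⟨fun r s n => mul_smul _ s n⟩
  have : IsScalarTower F.R₃.carrier F.R₂.carrier X.P.carrier := ⟨fun r s n => mul_smul _ s n⟩
  let _ : Module F.R₁.carrier Y.N.carrier := Module.compHom _ h.h₁.toRingHom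
  have : IsScalarTower F.R₁.carrier G.R₁.carrier Y.N.carrier := ⟨fun r s n => mul_smul _ s n⟩
  let _ : Module F.R₂.carrier Y.P.carrier := Module.compHom _ h.h₂.toRingHom
  let _ : Module G.R₁.carrier Y.P.carrier := Module.compHom _ G.l.toRingHom
  let _ : Module F.R₁.carrier Y.P.carrier :=
    Module.compHom _ (h.h₂.toRingHom.comp F.l.toRingHom)
  have : IsScalarTower F.R₂.carrier G.R₂.carrier Y.P.carrier := ⟨fun r s n => mul_smul _ s n⟩
  have : IsScalarTower G.R₁.carrier G.R₂.carrier Y.P.carrier := ⟨fun r s n => mul_smul _ s n⟩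
  have : IsScalarTower F.R₁.carrier F.R₂.carrier Y.P.carrier := .of_algebraMap_smul fun _ _ => rfl
  have : IsScalarTower F.R₁.carrier G.R₁.carrier Y.P.carrier := .of_algebraMap_smul fun r x => by
    change G.l.toRingHom (h.h₁.toRingHom r) • x = h.h₂.toRingHom (F.l.toRingHom r) • x
    rw [h.comm_l]
  have hsq : IsGluingSquare F.R₁.carrier F.R₂.carrier G.R₁.carrier G.R₂.carrier :=
    ⟨hh.injective, hh.exists_of_eq, hh.exists_add⟩
  have : IsLocalization E F.R₂.carrier := hh.isLocalization
  have : Module.Flat F.R₁.carrier F.R₂.carrier := IsLocalization.flat _ E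
  have : Module.Flat F.R₃.carrier G.R₂.carrier := hh.flat_comp
  let k : X.N.carrier →ₗ[F.R₁.carrier] X.P.carrier :=
    { toFun := X.k, map_add' := X.k.map_add, map_smul' := X.k.map_smulₛₗ }
  let m : X.V.carrier →ₗ[F.R₃.carrier] X.P.carrier :=
    { toFun := X.m, map_add' := X.m.map_add, map_smul' := X.m.map_smulₛₗ }
  let k' : Y.N.carrier →ₗ[G.R₁.carrier] Y.P.carrier :=
    { toFun := Y.k, map_add' := Y.k.map_add, map_smul' := Y.k.map_smulₛₗ }
  let α : X.N.carrier →ₗ[F.R₁.carrier] Y.N.carrier :=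
    { toFun := σ.a, map_add' := σ.a.map_add, map_smul' := σ.a.map_smulₛₗ }
  let β : X.P.carrier →ₗ[F.R₂.carrier] Y.P.carrier :=
    { toFun := σ.b, map_add' := σ.b.map_add, map_smul' := σ.b.map_smulₛₗ }
  have hk : IsBaseChange F.R₂.carrier k := hX.1
  have hm : IsBaseChange F.R₂.carrier m := hX.2
  have hβ : IsBaseChange G.R₂.carrier β := hσ
  exact hsq.isBaseChange E hk hm hβ k' (fun n => (σ.comm_k n).symm) hn

end RingFork.Hom.IsGluing

theorem IsExtensionOfScalars.of_bijective {R S M N : Type*} [CommRing R] [CommRing S]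
    [AddCommGroup M] [AddCommGroup N] [Module R M] [Module S N] {l : R →+* S} {f : M →ₛₗ[l] N}
    (hl : Function.Bijective l) (hf : Function.Bijective f) : IsExtensionOfScalars l f := by
  let _ : Algebra R S := l.toAlgebra
  let _ : Module R N := Module.compHom N l
  have : IsScalarTower R S N := ⟨fun r s n => mul_smul (l r) s n⟩
  let f₀ : M →ₗ[R] N := { toFun := f, map_add' := f.map_add, map_smul' := f.map_smulₛₗ }
  refine IsBaseChange.of_lift_unique f₀ fun Q _ _ _ _ g => ?_
  have hg : ∀ (r : R) (q : Q), r • q = l r • q := fun r q => (algebraMap_smul S r q).symm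
  let e : M ≃ₗ[R] N := LinearEquiv.ofBijective f₀ hf
  have hef : ∀ m, e m = f m := fun _ => rfl
  refine ⟨{ toFun := fun n => g (e.symm n), map_add' := by simp, map_smul' := fun s n => ?_ }, ?_,
    fun g' hg' => ?_⟩
  · obtain ⟨r, rfl⟩ := hl.2 s
    have h1 : l r • n = r • n := rfl
    rw [h1, map_smul, map_smul, hg]
    rfl
  · ext m
    exact congrArg g (e.symm_apply_apply m)
  · ext n
    obtain ⟨m, rfl⟩ := e.surjective n
    refine (LinearMap.congr_fun hg' m).trans ?_
    exact (congrArg g (e.symm_apply_apply m)).symm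

namespace RingFork.Hom.IsGluing

variable {F G : RingFork.{u}} {h : F.Hom G} {E : Submonoid F.R₁.carrier} (hh : h.IsGluing E)

include hh

/-- The fibre product of modules over a gluing of diagrams of rings. -/
theorem exists_isExtended {Y : ForkMod.{u, u} G} (hY : G.extended Y) :
    ∃ (X : ForkMod.{u, u} F) (σ : ForkMod.SemiHom h X Y), F.extended X ∧ σ.IsExtended := by
  -- The choices are forced: `V` because `C = C'`, then `P = B ⊗_C V` because `X` is to be extended,
  -- and `N` because it must be the fibre product of `Y.N` and `P` over `Y.P`. The map `β` from `P`
  -- to `Y.P` extends `Y.m`.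
  let V : GrMod.{u, u} F.R₃ := Y.V.restrict h.h₃
  let P : GrMod.{u, u} F.R₂ := V.extend F.ι
  let γ : V.carrier →ₛₗ[h.h₃.toRingHom] Y.V.carrier :=
    { toFun := fun x => x, map_add' := fun _ _ => rfl, map_smul' := fun _ _ => rfl }
  have hγ : IsExtensionOfScalars h.h₃.toRingHom γ :=
    .of_bijective hh.bijective Function.bijective_id
  have : RingHomCompTriple h.h₃.toRingHom G.ι.toRingHom (G.ι.toRingHom.comp h.h₃.toRingHom) := ⟨rfl⟩
  let δ : V.carrier →ₛₗ[G.ι.toRingHom.comp h.h₃.toRingHom] Y.P.carrier := Y.m.comp γ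
  have hδ : IsExtensionOfScalars (G.ι.toRingHom.comp h.h₃.toRingHom) δ :=
    (hγ.comp_iff (g := Y.m) (fun _ => rfl) fun _ => rfl).2 hY.2
  obtain ⟨β, hβ⟩ := (V.isExtensionOfScalars_toExtend F.ι).exists_lift_semilinear
    (l' := h.h₂.toRingHom) (fun r => (h.comm_ι r).symm) δ
  have hβ' : IsExtensionOfScalars h.h₂.toRingHom β :=
    ((V.isExtensionOfScalars_toExtend F.ι).comp_iff (fun r => (h.comm_ι r).symm)
      fun x => (hβ x).symm).1 hδ
  have hβm : ∀ i x, x ∈ P.piece i → β x ∈ Y.P.piece i := by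
    refine (V.isExtensionOfScalars_toExtend F.ι).mem_piece (V.toExtend_mem _) Y.P.internal
      β.toAddMonoidHom fun i j s x hs hx => ?_
    change β (s • V.toExtend F.ι x) ∈ _
    rw [map_smulₛₗ, hβ]
    exact Y.P.smul_mem _ _ _ _ (h.h₂.map_mem _ _ hs) (Y.m_mem _ _ hx)
  let M : GrMod.{u, u} F.R₁ := (Y.N.restrict h.h₁).prod (P.restrict F.l)
  have hY' : ∀ (r : F.R₁.carrier) (x : Y.N.carrier), Y.k (h.h₁.toRingHom r • x) =
      h.h₂.toRingHom (F.l.toRingHom r) • Y.k x := fun r x => by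
    rw [map_smulₛₗ, h.comm_l]
  let fst' : M.carrier →+ Y.N.carrier := AddMonoidHom.fst _ _
  let snd' : M.carrier →+ P.carrier := AddMonoidHom.snd _ _
  have hfst : ∀ (r : F.R₁.carrier) x, fst' (r • x) = h.h₁.toRingHom r • fst' x := fun _ _ => rfl
  have hsnd : ∀ (r : F.R₁.carrier) x, snd' (r • x) = F.l.toRingHom r • snd' x := fun _ _ => rfl
  let S : Submodule F.R₁.carrier M.carrier :=
    { carrier := {x | Y.k (fst' x) = β (snd' x)}
      zero_mem' := by simp
      add_mem' := fun {x y} (hx : _ = _) (hy : _ = _) => by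
        change Y.k (fst' (x + y)) = β (snd' (x + y))
        simp only [map_add, hx, hy]
      smul_mem' := fun r x (hx : _ = _) => by
        change Y.k (fst' (r • x)) = β (snd' (r • x))
        rw [hfst, hsnd, hY', hx, map_smulₛₗ] }
  have hS : ∀ x ∈ S, ∀ i, M.proj i x ∈ S := by
    intro x (hx : Y.k (fst' x) = β (snd' x)) i
    change Y.k (fst' (M.proj i x)) = β (snd' (M.proj i x))
    have h1 := gradedProj_map M.internal Y.P.internal (Y.k.toAddMonoidHom.comp fst')
      (fun i x hx => Y.k_mem i _ hx.1) i x
    have h2 := gradedProj_map M.internal Y.P.internal (β.toAddMonoidHom.comp snd')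
      (fun i x hx => hβm i _ hx.2) i x
    have h3 : (Y.k.toAddMonoidHom.comp fst') x = (β.toAddMonoidHom.comp snd') x := hx
    rw [h3] at h1
    exact h1.symm.trans h2
  let X : ForkMod.{u, u} F :=
    { N := M.sub S hS
      P := P
      V := V
      k :=
        { toFun := fun x => snd' x.1
          map_add' := fun _ _ => rfl
          map_smul' := fun _ _ => rfl }
      m := V.toExtend F.ι
      k_mem := fun i x hx => hx.2
      m_mem := V.toExtend_mem F.ι }
  let σ : ForkMod.SemiHom h X Y :=
    { a :=
        { toFun := fun x => fst' x.1
          map_add' := fun _ _ => rfl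
          map_smul' := fun _ _ => rfl }
      b := β
      c := γ
      a_mem := fun i x hx => hx.1
      b_mem := hβm
      c_mem := fun i x hx => hx
      comm_k := fun x => x.2.symm
      comm_m := hβ }
  -- The projection from `N` to `P` is a localization at `E` because `Y.k` is one at the image of
  -- `E`. For `p` in `P` some `e` moves `β p` to the image of some `n'`, and `(n', e p)` belongs to
  -- `N`; an element of `N` that vanishes in `P` has its first component killed by some `e`.
  have hX : F.extended X := by
    refine ⟨(isExtensionOfScalars_iff_of_isLocalization E hh.isLocalization).2 ⟨fun p => ?_,
      fun x hx => ?_⟩, V.isExtensionOfScalars_toExtend F.ι⟩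
    · obtain ⟨_, ⟨e, he, rfl⟩, n', hn'⟩ :=
        ((isExtensionOfScalars_iff_of_isLocalization _ hh.isLocalization_map).1 hY.1).1 (β p)
      have h1 : Y.k n' = β (F.l.toRingHom e • p) := by
        rw [map_smulₛₗ, ← hn', h.comm_l]
      exact ⟨e, he, ⟨(n', F.l.toRingHom e • p), h1⟩, rfl⟩
    · have h1 : Y.k (fst' x.1) = 0 := by
        have h2 : Y.k (fst' x.1) = β (snd' x.1) := x.2
        have h3 : snd' x.1 = 0 := hx
        rw [h2, h3, map_zero]
      obtain ⟨_, ⟨e, he, rfl⟩, hn'⟩ :=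
        ((isExtensionOfScalars_iff_of_isLocalization _ hh.isLocalization_map).1 hY.1).2 _ h1
      refine ⟨e, he, Subtype.ext (Prod.ext hn' ?_)⟩
      change F.l.toRingHom e • snd' x.1 = 0
      have h3 : snd' x.1 = 0 := hx
      rw [h3, smul_zero]
  refine ⟨X, σ, hX, ⟨hh.isExtensionOfScalars hX σ hβ' fun n' p hnp => ?_, hβ', hγ⟩⟩
  exact ⟨⟨(n', p), hnp⟩, ⟨rfl, rfl⟩, fun y hy => Subtype.ext (Prod.ext hy.1 hy.2)⟩

/-- Fullness, component by component: `c` is determined because `σ'.c` is bijective, `b` by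
extending `c`, and `a` by the fibre product property of `X'.N`. -/
theorem exists_hom {X X' : ForkMod.{u, u} F} {Y Y' : ForkMod.{u, u} G} (hX : F.extended X)
    (hX' : F.extended X') {σ : ForkMod.SemiHom h X Y}
    {σ' : ForkMod.SemiHom h X' Y'} (hσ' : σ'.IsExtended) (g : Y ⟶ Y') :
    ∃ f : X ⟶ X', (∀ x, ForkMod.Hom.a g (σ.a x) = σ'.a (ForkMod.Hom.a f x)) ∧
      (∀ x, ForkMod.Hom.b g (σ.b x) = σ'.b (ForkMod.Hom.b f x)) ∧
      ∀ x, ForkMod.Hom.c g (σ.c x) = σ'.c (ForkMod.Hom.c f x) := by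
  have hc := hσ'.c.bijective hh.bijective
  choose c₀ hc₀ using fun x => hc.2 (ForkMod.Hom.c g (σ.c x))
  let c : X.V.carrier →ₗ[F.R₃.carrier] X'.V.carrier :=
    { toFun := c₀
      map_add' := fun x y => hc.1 (by simp only [map_add, hc₀])
      map_smul' := fun r x => hc.1 (by simp only [map_smulₛₗ, hc₀, RingHom.id_apply]) }
  have hcc : ∀ x, σ'.c (c x) = ForkMod.Hom.c g (σ.c x) := hc₀
  obtain ⟨b, hb⟩ := hX.2.exists_lift (X'.m.comp c)
  have hb' : ∀ x, b (X.m x) = X'.m (c x) := hb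
  have hbb : ∀ x, ForkMod.Hom.b g (σ.b x) = σ'.b (b x) := by
    intro x
    induction x using IsExtensionOfScalars.induction hX.2 with
    | smul s v =>
      rw [map_smulₛₗ, map_smul, map_smul, map_smulₛₗ, hb', σ.comm_m, σ'.comm_m, hcc,
        ForkMod.Hom.comm_m g]
    | add x y hx hy => simp only [map_add, hx, hy]
  have hcm : ∀ i x, x ∈ X.V.piece i → c x ∈ X'.V.piece i := fun i x hx => by
    refine mem_of_map_mem X'.V.internal Y'.V.internal σ'.c.toAddMonoidHom σ'.c_mem hc.1 ?_
    change σ'.c (c x) ∈ _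
    rw [hcc]
    exact ForkMod.Hom.c_mem g _ _ (σ.c_mem _ _ hx)
  have hbm : ∀ i x, x ∈ X.P.piece i → b x ∈ X'.P.piece i := by
    refine hX.2.mem_piece X.m_mem X'.P.internal b.toAddMonoidHom fun i j s x hs hx => ?_
    change b (s • X.m x) ∈ _
    rw [map_smul, hb']
    exact X'.P.smul_mem _ _ _ _ hs (X'.m_mem _ _ (hcm _ _ hx))
  have hex := fun x : X.N.carrier => hh.existsUnique hX' hσ' (ForkMod.Hom.a g (σ.a x)) (b (X.k x))
    (by rw [← ForkMod.Hom.comm_k g, ← σ.comm_k, hbb])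
  choose a₀ ha₀ _ using hex
  have huniq : ∀ y z : X'.N.carrier, σ'.a y = σ'.a z → X'.k y = X'.k z → y = z := by
    intro y z h1 h2
    exact (hh.existsUnique hX' hσ' (σ'.a z) (X'.k z) (σ'.comm_k z).symm).unique ⟨h1, h2⟩ ⟨rfl, rfl⟩
  let a : X.N.carrier →ₗ[F.R₁.carrier] X'.N.carrier :=
    { toFun := a₀
      map_add' := fun x y => huniq _ _ (by simp only [map_add, ha₀]) (by simp only [map_add, ha₀])
      map_smul' := fun r x => huniq _ _ (by simp only [map_smulₛₗ, ha₀, RingHom.id_apply])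
        (by simp only [map_smulₛₗ, ha₀, RingHom.id_apply]) }
  have ha : ∀ x, σ'.a (a x) = ForkMod.Hom.a g (σ.a x) := fun x => (ha₀ x).1
  have hk : ∀ x, X'.k (a x) = b (X.k x) := fun x => (ha₀ x).2
  have ham : ∀ i x, x ∈ X.N.piece i → a x ∈ X'.N.piece i := by
    intro i x hx
    -- Neither `σ'.a` nor `X'.k` need be injective, but they are jointly so; homogeneity of `a x` is
    -- therefore tested on both images.
    have h1 : X'.N.proj i (a x) = a x := by
      apply huniq
      · have h2 := gradedProj_map X'.N.internal Y'.N.internal σ'.a.toAddMonoidHom σ'.a_mem i (a x)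
        refine h2.symm.trans (gradedProj_of_mem _ ?_)
        change σ'.a (a x) ∈ _
        rw [ha]
        exact ForkMod.Hom.a_mem g _ _ (σ.a_mem _ _ hx)
      · have h2 := gradedProj_map X'.N.internal X'.P.internal X'.k.toAddMonoidHom X'.k_mem i (a x)
        refine h2.symm.trans (gradedProj_of_mem _ ?_)
        change X'.k (a x) ∈ _
        rw [hk]
        exact hbm _ _ (X.k_mem _ _ hx)
    rw [← h1]
    exact gradedProj_mem _ _ _
  exact ⟨{ a := a, b := b, c := c, a_mem := ham, b_mem := hbm, c_mem := hcm
           comm_k := fun x => (hk x).symm, comm_m := hb' }, fun x => (ha x).symm, hbb,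
    fun x => (hcc x).symm⟩

/-- Extension of scalars is an equivalence between the categories of extended modules. -/
theorem nonempty_equivalence : Nonempty ((RingFork.extended.{u, u} F).FullSubcategory ≌
    (RingFork.extended.{u, u} G).FullSubcategory) := by
  obtain ⟨Φ, σ, hσ, hΦ⟩ := exists_extensionFunctor h
  have : Φ.Faithful := ⟨fun {X Y} f g hfg => by
    obtain ⟨fa, fb, fc⟩ := hΦ f
    obtain ⟨ga, gb, gc⟩ := hΦ g
    rw [hfg] at fa fb fc
    have hc : ForkMod.Hom.c f.hom = ForkMod.Hom.c g.hom := LinearMap.ext fun x =>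
      ((hσ Y).c.bijective hh.bijective).1 ((fc x).symm.trans (gc x))
    have hb : ForkMod.Hom.b f.hom = ForkMod.Hom.b g.hom := X.property.2.hom_ext fun x => by
      rw [ForkMod.Hom.comm_m f.hom, ForkMod.Hom.comm_m g.hom, hc]
    have ha : ForkMod.Hom.a f.hom = ForkMod.Hom.a g.hom := LinearMap.ext fun x =>
      (hh.existsUnique Y.property (hσ Y) ((σ Y).a (ForkMod.Hom.a g.hom x))
        (Y.obj.k (ForkMod.Hom.a g.hom x)) ((σ Y).comm_k _).symm).unique
        ⟨(fa x).symm.trans (ga x), by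
          rw [← ForkMod.Hom.comm_k f.hom, ← ForkMod.Hom.comm_k g.hom, hb]⟩ ⟨rfl, rfl⟩
    ext1
    exact ForkMod.Hom.ext ha hb hc⟩
  have : Φ.Full := ⟨fun {X Y} g => by
    obtain ⟨f, fa, fb, fc⟩ := hh.exists_hom X.property Y.property (σ := σ X) (hσ Y) g.hom
    obtain ⟨ga, gb, gc⟩ := hΦ (ObjectProperty.homMk f : X ⟶ Y)
    refine ⟨ObjectProperty.homMk f, ?_⟩
    ext1
    exact (hσ X).hom_ext (fun x => (ga x).trans (fa x).symm) (fun x => (gb x).trans (fb x).symm)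
      fun x => (gc x).trans (fc x).symm⟩
  have : Φ.EssSurj := ⟨fun Y => by
    obtain ⟨X, τ, hX, hτ⟩ := hh.exists_isExtended Y.property
    obtain ⟨e⟩ := (hσ ⟨X, hX⟩).nonempty_iso hτ
    exact ⟨⟨X, hX⟩, ⟨ObjectProperty.isoMk _ e⟩⟩⟩
  have : Φ.IsEquivalence := {}
  exact ⟨Φ.asEquivalence⟩

end RingFork.Hom.IsGluing

/-! ## Valuation rings containing a Dedekind domain -/

section Center

variable {R L : Type*} [CommRing R] [Field L] [Algebra R L] {V : ValuationSubring L}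
  (hR : ∀ r, algebraMap R L r ∈ V)

/-- The inclusion of a subring in a valuation ring. -/
def toValuationSubring : R →+* V := (algebraMap R L).codRestrict V.toSubring hR

/-- The center of a valuation ring on a subring. -/
def center : Ideal R := (IsLocalRing.maximalIdeal V).comap (toValuationSubring hR)

instance : (center hR).IsPrime := Ideal.comap_isPrime _ _

theorem mem_center {r : R} : r ∈ center hR ↔ algebraMap R L r ∈ V.nonunits := by
  rw [ValuationSubring.mem_nonunits_iff_exists_mem_maximalIdeal]
  exact ⟨fun h => ⟨hR r, h⟩, fun ⟨_, h⟩ => h⟩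

theorem notMem_center {r : R} : r ∉ center hR ↔ IsUnit (toValuationSubring hR r) := by
  rw [center, Ideal.mem_comap, IsLocalRing.mem_maximalIdeal, mem_nonunits_iff, not_not]

theorem inv_mem_of_notMem_center {r : R} (h : r ∉ center hR) : (algebraMap R L r)⁻¹ ∈ V := by
  obtain ⟨u, hu⟩ := (notMem_center hR).1 h
  have h1 : algebraMap R L r * ((u⁻¹ : Vˣ) : V) = 1 := by
    have h2 : ((u : V) : L) = algebraMap R L r := congrArg Subtype.val hu
    rw [← h2]
    exact congrArg Subtype.val u.mul_inv
  rw [inv_eq_of_mul_eq_one_right h1]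
  exact SetLike.coe_mem _

variable [IsDedekindDomain R] [IsFractionRing R L]

theorem center_ne_bot (hV : V ≠ ⊤) : center hR ≠ ⊥ := by
  intro h
  refine hV (top_unique fun x _ => ?_)
  obtain ⟨a, b, hb, rfl⟩ := IsFractionRing.div_surjective R x
  rw [div_eq_mul_inv]
  refine mul_mem (hR a) (inv_mem_of_notMem_center hR ?_)
  rw [h]
  exact nonZeroDivisors.ne_zero hb

/-- The localization of `R` at the center is a discrete valuation ring, so it contains `x` or `x⁻¹`.
If `x⁻¹ = r / s`, then `r` lies outside the center, since otherwise `s = x r` would be a nonunit of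
`V` too. -/
theorem exists_div_of_mem (hV : V ≠ ⊤) {x : L} (hx : x ∈ V) :
    ∃ r s : R, s ∉ center hR ∧ x = algebraMap R L r * (algebraMap R L s)⁻¹ := by
  by_cases hx0 : x = 0
  · exact ⟨0, 1, (Ideal.ne_top_iff_one _).1 Ideal.IsPrime.ne_top', by simp [hx0]⟩
  have hS : (center hR).primeCompl ≤ nonZeroDivisors R := Ideal.primeCompl_le_nonZeroDivisors _
  let U := Localization.subalgebra.ofField L (center hR).primeCompl hS
  have hU : IsLocalization.AtPrime U (center hR) :=
    Localization.subalgebra.isLocalization_ofField L (center hR).primeCompl hS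
  have : IsDiscreteValuationRing U :=
    IsLocalization.AtPrime.isDiscreteValuationRing_of_dedekind_domain R (center_ne_bot hR hV) U
  rcases ValuationRing.isInteger_or_isInteger U x with ⟨⟨_, r, s, hs, rfl⟩, rfl⟩ |
    ⟨⟨_, r, s, hs, rfl⟩, h⟩
  · exact ⟨r, s, hs, rfl⟩
  · have h' : algebraMap R L r * (algebraMap R L s)⁻¹ = x⁻¹ := h
    have hx' : x = algebraMap R L s * (algebraMap R L r)⁻¹ := by
      rw [← inv_inv x, ← h', mul_inv, inv_inv, mul_comm]
    by_cases hr : r ∈ center hR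
    · refine absurd ?_ hs
      have hr0 : algebraMap R L r ≠ 0 := fun hr0 => by
        rw [hr0, zero_mul] at h'
        exact hx0 (inv_eq_zero.1 h'.symm)
      have h1 : toValuationSubring hR s = ⟨x, hx⟩ * toValuationSubring hR r := by
        refine Subtype.ext ?_
        change algebraMap R L s = x * algebraMap R L r
        rw [hx', mul_assoc, inv_mul_cancel₀ hr0, mul_one]
      have h2 : toValuationSubring hR s ∈ IsLocalRing.maximalIdeal V := by
        rw [h1]
        exact Ideal.mul_mem_left _ _ hr
      exact h2
    · exact ⟨s, r, hr, hx'⟩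

theorem mem_iff_exists_div (hV : V ≠ ⊤) {x : L} : x ∈ V ↔
    ∃ r s : R, s ∉ center hR ∧ x = algebraMap R L r * (algebraMap R L s)⁻¹ := by
  refine ⟨exists_div_of_mem hR hV, ?_⟩
  rintro ⟨r, s, hs, rfl⟩
  exact mul_mem (hR r) (inv_mem_of_notMem_center hR hs)

include hR in
theorem isDiscreteValuationRing_of_center (hV : V ≠ ⊤) : IsDiscreteValuationRing V := by
  let _ : Algebra R V := (toValuationSubring hR).toAlgebra
  have : IsLocalization.AtPrime V (center hR) := by
    refine ⟨fun s => (notMem_center hR).1 s.2, fun x => ?_, fun {x y} h => ⟨1, ?_⟩⟩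
    · obtain ⟨r, s, hs, h⟩ := exists_div_of_mem hR hV x.2
      refine ⟨⟨r, ⟨s, hs⟩⟩, Subtype.ext ?_⟩
      change (x : L) * algebraMap R L s = algebraMap R L r
      have hs0 : algebraMap R L s ≠ 0 := fun h0 => hs (by
        rw [(IsFractionRing.injective R L) (h0.trans (map_zero _).symm)]
        exact zero_mem _)
      rw [h, mul_assoc, inv_mul_cancel₀ hs0, mul_one]
    · rw [IsFractionRing.injective R L (congrArg Subtype.val h)]
  exact IsLocalization.AtPrime.isDiscreteValuationRing_of_dedekind_domain R
    (center_ne_bot hR hV) V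

theorem eq_of_center_eq (hV : V ≠ ⊤) {V' : ValuationSubring L} (hR' : ∀ r, algebraMap R L r ∈ V')
    (hV' : V' ≠ ⊤) (h : center hR = center hR') : V = V' := by
  ext x
  rw [mem_iff_exists_div hR hV, mem_iff_exists_div hR' hV', h]

-- If `x = a / b` is not in `V`, the center of `V` is one of the finitely many primes dividing `b`,
-- and `V` is determined by its center.
variable (R) in
theorem finite_setOf_notMem (x : L) :
    {V : ValuationSubring L | V ≠ ⊤ ∧ (∀ r, algebraMap R L r ∈ V) ∧ x ∉ V}.Finite := by
  obtain ⟨a, b, hb, rfl⟩ := IsFractionRing.div_surjective R x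
  have hb0 : b ≠ 0 := nonZeroDivisors.ne_zero hb
  have hfin := Ideal.finite_factors (R := R) (I := Ideal.span {b}) (by simpa using hb0)
  refine Set.Finite.of_finite_image (f := fun V => {r : R | algebraMap R L r ∈ V.nonunits})
    ((hfin.image fun v => (v.asIdeal : Set R)).subset ?_) ?_
  · rintro _ ⟨V, ⟨hV, hR, hx⟩, rfl⟩
    refine ⟨⟨center hR, inferInstance, center_ne_bot hR hV⟩, ?_, ?_⟩
    · rw [Set.mem_ofPred_eq, Ideal.dvd_span_singleton]
      by_contra h
      rw [div_eq_mul_inv] at hx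
      exact hx (mul_mem (hR a) (inv_mem_of_notMem_center hR h))
    · ext r
      exact mem_center hR
  · rintro V ⟨hV, hR, -⟩ V' ⟨hV', hR', -⟩ h
    refine eq_of_center_eq hR hV hR' hV' (Ideal.ext fun r => ?_)
    rw [mem_center, mem_center]
    exact Set.ext_iff.1 h r

/-- Simultaneous approximation at finitely many valuation rings. -/
theorem exists_forall_sub_mem {ι : Type*} (s : Finset ι) (V : ι → ValuationSubring L)
    (hV : ∀ i, V i ≠ ⊤) (hR : ∀ i r, algebraMap R L r ∈ V i) (hinj : Function.Injective V)
    (y : ∀ i, V i) (e : ℕ) :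
    ∃ r : R, ∀ i ∈ s, toValuationSubring (hR i) r - y i ∈ IsLocalRing.maximalIdeal (V i) ^ e := by
  -- One valuation ring at a time: if `y = r / t` with `t` outside the center and `u` is an inverse
  -- of `t` modulo the `e`-th power of the center, then `r u` approximates `y`. The Chinese
  -- remainder theorem combines these approximations, as distinct valuation rings have distinct
  -- centers.
  have key : ∀ i, ∃ r : R, toValuationSubring (hR i) r - y i ∈
      IsLocalRing.maximalIdeal (V i) ^ e := by
    intro i
    obtain ⟨r, t, ht, h⟩ := exists_div_of_mem (hR i) (hV i) (y i).2
    have hmax : (center (hR i)).IsMaximal :=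
      Ideal.IsPrime.isMaximal inferInstance (center_ne_bot (hR i) (hV i))
    have hcop : IsCoprime (Ideal.span {t}) (center (hR i) ^ e) := by
      refine IsCoprime.pow_right (Ideal.isCoprime_iff_sup_eq.2 ?_)
      rw [sup_comm]
      refine hmax.1.2 _ (lt_of_le_of_ne le_sup_left fun h' => ht ?_)
      rw [h']
      exact Ideal.mem_sup_right (Ideal.mem_span_singleton_self t)
    obtain ⟨a, ha, b, hb, hab⟩ := Ideal.isCoprime_iff_exists.1 hcop
    obtain ⟨u, rfl⟩ := Ideal.mem_span_singleton'.1 ha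
    have hb' : toValuationSubring (hR i) b ∈ IsLocalRing.maximalIdeal (V i) ^ e := by
      have h1 := Ideal.mem_map_of_mem (toValuationSubring (hR i)) hb
      rw [Ideal.map_pow] at h1
      exact Ideal.pow_right_mono Ideal.map_comap_le e h1
    refine ⟨r * u, ?_⟩
    have h2 : toValuationSubring (hR i) (r * u) - y i = -(y i * toValuationSubring (hR i) b) := by
      refine Subtype.ext ?_
      change algebraMap R L (r * u) - (y i : L) = -((y i : L) * algebraMap R L b)
      have ht0 : algebraMap R L t ≠ 0 := fun h0 => ht (by
        rw [(IsFractionRing.injective R L) (h0.trans (map_zero _).symm)]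
        exact zero_mem _)
      have h3 := congrArg (algebraMap R L) hab
      rw [map_add, map_mul, map_one] at h3
      rw [h, eq_sub_of_add_eq' h3, map_mul]
      field_simp
      ring
    rw [h2]
    exact neg_mem (Ideal.mul_mem_left _ _ hb')
  choose r hr using key
  obtain ⟨z, hz⟩ := IsDedekindDomain.exists_forall_sub_mem_ideal (s := s)
    (fun i => center (hR i)) (fun _ => e)
    (fun i _ => Ideal.prime_of_isPrime (center_ne_bot (hR i) (hV i)) inferInstance)
    (fun i _ j _ hij h => hij (hinj (eq_of_center_eq (hR i) (hV i) (hR j) (hV j) h)))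
    (fun i => r i)
  refine ⟨z, fun i hi => ?_⟩
  have h1 := Ideal.mem_map_of_mem (toValuationSubring (hR i)) (hz i hi)
  rw [Ideal.map_pow, map_sub] at h1
  have h2 := add_mem (Ideal.pow_right_mono Ideal.map_comap_le e h1) (hr i)
  rwa [sub_add_sub_cancel] at h2

end Center

/-! ## Places of a function field -/

section FunctionField

variable {K : Type u} {L : Type v} [Field K] [Field L] [Algebra K L]

open scoped IntermediateField IntermediateField.algebraAdjoinAdjoin

theorem Place.mem_of_isIntegral (p : Place K L) {A : Type*} [CommRing A] [Algebra A L]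
    (hA : ∀ a, algebraMap A L a ∈ p.ring) {x : L} (hx : IsIntegral A x) : x ∈ p.ring := by
  have h1 : IsIntegral p.ring x := by
    let f : A →+* p.ring := (algebraMap A L).codRestrict p.ring.toSubring hA
    exact hx.map_of_comp_eq f (RingHom.id L) (by ext; rfl)
  obtain ⟨y, hy⟩ := IsIntegrallyClosed.algebraMap_eq_of_integral h1
  rw [← hy]
  exact y.2

theorem Place.mem_of_mem_adjoin (p : Place K L) {s : Set L} (hs : ∀ x ∈ s, x ∈ p.ring) {x : L}
    (hx : x ∈ Algebra.adjoin K s) : x ∈ p.ring := by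
  induction hx using Algebra.adjoin_induction with
  | mem x hx => exact hs x hx
  | algebraMap r => exact p.const_mem r
  | add x y _ _ hx hy => exact add_mem hx hy
  | mul x y _ _ hx hy => exact mul_mem hx hy

variable (K) in
/-- The integral closure of `K[w]` in an extension of `K(w)`. -/
abbrev integralRing (w : L) : Subalgebra (Algebra.adjoin K {w}) L :=
  integralClosure (Algebra.adjoin K {w}) L

theorem Place.integralRing_mem (p : Place K L) {w : L} (hw : w ∈ p.ring)
    (r : integralRing K w) : algebraMap (integralRing K w) L r ∈ p.ring :=
  p.mem_of_isIntegral (A := Algebra.adjoin K {w})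
    (fun a => p.mem_of_mem_adjoin (s := {w}) (by rintro _ rfl; exact hw) a.2) r.2

instance (w : L) : IsPrincipalIdealRing (Algebra.adjoin K {w}) := by
  have h : Function.Surjective (Polynomial.aeval w : Polynomial K →ₐ[K] L).rangeRestrict :=
    AlgHom.rangeRestrict_surjective _
  have h2 : IsPrincipalIdealRing (Polynomial.aeval w : Polynomial K →ₐ[K] L).range :=
    IsPrincipalIdealRing.of_surjective _ h
  rwa [← Algebra.adjoin_singleton_eq_range_aeval] at h2

variable [CharZero K]

/-- `K[w]` is a principal ideal domain, and the finite extension of `K(w)` is separable in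
characteristic `0`. -/
theorem isDedekindDomain_integralRing (w : L) [FiniteDimensional K⟮w⟯ L] :
    IsDedekindDomain (integralRing K w) :=
  integralClosure.isDedekindDomain (Algebra.adjoin K {w}) K⟮w⟯ L

theorem isFractionRing_integralRing (w : L) [FiniteDimensional K⟮w⟯ L] :
    IsFractionRing (integralRing K w) L :=
  integralClosure.isFractionRing_of_finite_extension K⟮w⟯ L

theorem Place.ring_injective : Function.Injective (Place.ring : Place K L → _) := by
  rintro ⟨r, _, _⟩ ⟨r', _, _⟩ rfl
  rfl

theorem Place.isDiscreteValuationRing_of_mem (p : Place K L) (w : L) [FiniteDimensional K⟮w⟯ L]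
    (hw : w ∈ p.ring) : IsDiscreteValuationRing p.ring := by
  have := isDedekindDomain_integralRing (K := K) w
  have := isFractionRing_integralRing (K := K) w
  exact isDiscreteValuationRing_of_center (p.integralRing_mem hw) p.ne_top

theorem Place.finite_setOf_mem_notMem (w : L) [FiniteDimensional K⟮w⟯ L] (x : L) :
    {p : Place K L | w ∈ p.ring ∧ x ∉ p.ring}.Finite := by
  have := isDedekindDomain_integralRing (K := K) w
  have := isFractionRing_integralRing (K := K) w
  refine Set.Finite.of_finite_image (f := Place.ring)
    ((finite_setOf_notMem (integralRing K w) x).subset ?_) Place.ring_injective.injOn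
  rintro _ ⟨p, ⟨hw, hx⟩, rfl⟩
  exact ⟨p.ne_top, p.integralRing_mem hw, hx⟩

theorem Place.exists_forall_sub_mem (w : L) [FiniteDimensional K⟮w⟯ L] (s : Set (Place K L))
    (hs : s.Finite) (hw : ∀ p ∈ s, w ∈ p.ring) (y : ∀ p : Place K L, p.ring) (e : ℕ) :
    ∃ r : integralRing K w, ∀ p ∈ s, ∃ h : (r : L) ∈ p.ring,
      (⟨r, h⟩ - y p : p.ring) ∈ IsLocalRing.maximalIdeal p.ring ^ e := by
  have := isDedekindDomain_integralRing (K := K) w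
  have := isFractionRing_integralRing (K := K) w
  have := hs.fintype
  obtain ⟨r, hr⟩ := EllipticModel.exists_forall_sub_mem (R := integralRing K w) (L := L)
    (Finset.univ : Finset s) (fun p => p.1.ring) (fun p => p.1.ne_top)
    (fun p => p.1.integralRing_mem (hw p.1 p.2))
    (fun p q h => Subtype.ext (Place.ring_injective h)) (fun p => y p.1) e
  exact ⟨r, fun p hp => ⟨p.integralRing_mem (hw p hp) r, hr ⟨p, hp⟩ (Finset.mem_univ _)⟩⟩

end FunctionField

/-! ## Places of the function field of an elliptic curve -/

section EllipticCurve

variable {K : Type u} [Field K] [CharZero K] (W : WeierstrassCurve K)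

open scoped IntermediateField

/-- The function `4 x³ + b₂ x² + 2 b₄ x + b₆`. -/
def psiF : FF W := 4 * xF W ^ 3 + algebraMap K (FF W) W.b₂ * xF W ^ 2 +
  2 * algebraMap K (FF W) W.b₄ * xF W + algebraMap K (FF W) W.b₆

/-- The function `2 y + a₁ x + a₃`. -/
def etaF : FF W := 2 * yF W + algebraMap K (FF W) W.a₁ * xF W + algebraMap K (FF W) W.a₃

theorem equationF : yF W ^ 2 + algebraMap K (FF W) W.a₁ * xF W * yF W +
    algebraMap K (FF W) W.a₃ * yF W = xF W ^ 3 + algebraMap K (FF W) W.a₂ * xF W ^ 2 +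
      algebraMap K (FF W) W.a₄ * xF W + algebraMap K (FF W) W.a₆ := by
  have h := equation_xF_yF W
  rw [WeierstrassCurve.Affine.equation_iff] at h
  exact h

theorem etaF_sq : etaF W ^ 2 = psiF W := by
  have h := equationF W
  simp only [etaF, psiF, WeierstrassCurve.b₂, WeierstrassCurve.b₄, WeierstrassCurve.b₆, map_add,
    map_mul, map_pow, map_ofNat]
  linear_combination 4 * h

/-- As a cubic in `x`, the function `ψ` has leading coefficient `4`, which is invertible in `K`;
dividing by it gives a monic equation for `x` over any `K`-algebra that contains `ψ`. -/
theorem isIntegral_xF {A : Type*} [CommRing A] [Algebra K A] [Algebra A (FF W)]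
    [IsScalarTower K A (FF W)] (h : ∃ a, algebraMap A (FF W) a = psiF W) :
    IsIntegral A (xF W) := by
  obtain ⟨a, ha⟩ := h
  refine ⟨Polynomial.X ^ 3 + Polynomial.C (algebraMap K A (W.b₂ / 4)) * Polynomial.X ^ 2 +
    Polynomial.C (algebraMap K A (W.b₄ / 2)) * Polynomial.X +
    Polynomial.C (algebraMap K A (1 / 4) * (algebraMap K A W.b₆ - a)), by monicity!, ?_⟩
  simp only [Polynomial.eval₂_add, Polynomial.eval₂_mul, Polynomial.eval₂_pow, Polynomial.eval₂_X,
    Polynomial.eval₂_C, Polynomial.eval₂_sub, map_mul, map_sub, ha]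
  simp only [← IsScalarTower.algebraMap_apply, map_div₀, map_ofNat, map_one, psiF]
  field_simp
  ring

theorem isIntegral_yF {A : Type*} [CommRing A] [Algebra K A] [Algebra A (FF W)]
    [IsScalarTower K A (FF W)] (h : ∃ a, algebraMap A (FF W) a = xF W) :
    IsIntegral A (yF W) := by
  obtain ⟨a, ha⟩ := h
  refine ⟨Polynomial.X ^ 2 + Polynomial.C (algebraMap K A W.a₁ * a + algebraMap K A W.a₃) *
    Polynomial.X - Polynomial.C (a ^ 3 + algebraMap K A W.a₂ * a ^ 2 + algebraMap K A W.a₄ * a +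
      algebraMap K A W.a₆), by monicity!, ?_⟩
  simp only [Polynomial.eval₂_add, Polynomial.eval₂_sub, Polynomial.eval₂_mul, Polynomial.eval₂_pow,
    Polynomial.eval₂_X, Polynomial.eval₂_C, map_mul, map_add, map_pow, ha,
    ← IsScalarTower.algebraMap_apply]
  linear_combination equationF W

theorem mem_of_xF_mem_of_yF_mem (S : Subfield (FF W)) (hK : ∀ a, algebraMap K (FF W) a ∈ S)
    (hx : xF W ∈ S) (hy : yF W ∈ S) (f : FF W) : f ∈ S := by
  have key : ∀ a : W.toAffine.CoordinateRing, algebraMap _ (FF W) a ∈ S := by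
    intro a
    obtain ⟨q, rfl⟩ := AdjoinRoot.mk_surjective a
    induction q using Polynomial.induction_on' with
    | add p q hp hq => rw [map_add, map_add]; exact add_mem hp hq
    | monomial n r =>
      rw [← Polynomial.C_mul_X_pow_eq_monomial, map_mul, map_mul, map_pow, map_pow]
      refine mul_mem ?_ (pow_mem hy n)
      induction r using Polynomial.induction_on' with
      | add p q hp hq => rw [map_add, map_add, map_add]; exact add_mem hp hq
      | monomial m r =>
        rw [← Polynomial.C_mul_X_pow_eq_monomial, map_mul, map_mul, map_mul, map_pow, map_pow,
          map_pow]
        refine mul_mem ?_ (pow_mem hx m)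
        have := hK r
        rwa [IsScalarTower.algebraMap_apply K W.toAffine.CoordinateRing (FF W)] at this
  obtain ⟨a, b, -, rfl⟩ := IsFractionRing.div_surjective W.toAffine.CoordinateRing f
  exact div_mem (key a) (key b)

theorem finiteDimensional_of_isIntegral_xF {M : Type*} [Field M] [Algebra K M] [Algebra M (FF W)]
    [IsScalarTower K M (FF W)] (hx : IsIntegral M (xF W)) : FiniteDimensional M (FF W) := by
  have hy : IsIntegral M (yF W) := by
    have h1 : IsIntegral (integralClosure M (FF W)) (yF W) := isIntegral_yF W ⟨⟨xF W, hx⟩, rfl⟩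
    exact isIntegral_trans _ h1
  have h1 : FiniteDimensional M (IntermediateField.adjoin M ({xF W, yF W} : Set (FF W))) :=
    IntermediateField.finiteDimensional_adjoin (by
      rintro _ (rfl | rfl)
      · exact hx
      · exact hy)
  have h2 : IntermediateField.adjoin M ({xF W, yF W} : Set (FF W)) = ⊤ := by
    refine top_unique fun f _ => mem_of_xF_mem_of_yF_mem W
      (IntermediateField.adjoin M ({xF W, yF W} : Set (FF W))).toSubfield (fun a => ?_) ?_ ?_ f
    · rw [IsScalarTower.algebraMap_apply K M (FF W)]
      exact (IntermediateField.adjoin M _).algebraMap_mem (algebraMap K M a)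
    · exact IntermediateField.subset_adjoin _ _ (by simp)
    · exact IntermediateField.subset_adjoin _ _ (by simp)
  rw [h2] at h1
  exact Module.Finite.equiv (IntermediateField.topEquiv (F := M) (E := FF W)).toLinearEquiv

instance finiteDimensional_xF : FiniteDimensional K⟮xF W⟯ (FF W) :=
  finiteDimensional_of_isIntegral_xF W
    (isIntegral_algebraMap (x := (⟨xF W, IntermediateField.mem_adjoin_simple_self K _⟩ : K⟮xF W⟯)))

/-- This prepares the second chart, of the places where `1 / ψ` is regular. It contains the identity
and, together with the chart of `x`, covers the curve. -/
instance finiteDimensional_inv_psiF : FiniteDimensional K⟮(psiF W)⁻¹⟯ (FF W) := by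
  refine finiteDimensional_of_isIntegral_xF W (isIntegral_xF W ⟨⟨psiF W, ?_⟩, rfl⟩)
  have := inv_mem (IntermediateField.mem_adjoin_simple_self K (psiF W)⁻¹)
  rwa [inv_inv] at this

variable {W}

namespace Place

variable (p : ClosedPoint W)

instance : Algebra K p.ring := p.const.toAlgebra

instance : IsScalarTower K p.ring (FF W) := .of_algebraMap_eq fun _ => rfl

theorem yF_mem (hx : xF W ∈ p.ring) : yF W ∈ p.ring :=
  p.mem_of_isIntegral (A := p.ring) (fun a => a.2) (isIntegral_yF W ⟨⟨xF W, hx⟩, rfl⟩)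

/-- If `1 / ψ` is not regular then `ψ` is, and `x` is integral over `K[ψ]`. Every place thus lies on
one of the two charts. -/
theorem xF_mem (h : (psiF W)⁻¹ ∉ p.ring) : xF W ∈ p.ring := by
  have h1 := (p.ring.mem_or_inv_mem (psiF W)).resolve_right h
  exact p.mem_of_isIntegral (A := p.ring) (fun a => a.2) (isIntegral_xF W ⟨⟨psiF W, h1⟩, rfl⟩)

instance : IsDiscreteValuationRing p.ring := by
  by_cases h : (psiF W)⁻¹ ∈ p.ring
  · exact p.isDiscreteValuationRing_of_mem _ h
  · exact p.isDiscreteValuationRing_of_mem _ (p.xF_mem h)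

theorem finite_setOf_notMem_ring (f : FF W) : {p : ClosedPoint W | f ∉ p.ring}.Finite := by
  refine ((finite_setOf_mem_notMem (K := K) (xF W) f).union
    (finite_setOf_mem_notMem (K := K) (psiF W)⁻¹ f)).subset fun p hp => ?_
  by_cases h : (psiF W)⁻¹ ∈ p.ring
  · exact .inr ⟨h, hp⟩
  · exact .inl ⟨p.xF_mem h, hp⟩

variable [W.IsElliptic]

/-- As `y` is integral over `K[x]`, the coordinates reduce to an affine point as soon as `x` is
regular. -/
theorem order_eq_one_iff : p.order = 1 ↔ xF W ∉ p.ring := by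
  classical
  rw [order, AddMonoid.addOrderOf_eq_one_iff, toPoint]
  constructor
  · intro h hx
    rw [dif_pos ⟨hx, p.yF_mem hx⟩] at h
    cases h
  · intro h
    rw [dif_neg fun h' => h h'.1]

/-- Here `η = 2 y + a₁ x + a₃`, a square root of `ψ`, is a nonunit, so `y` equals its own negation
in the residue field and the point is killed by `2`. This is why the chart around the identity uses
`1 / ψ` and not `1 / x`, whose poles may be points of infinite order. -/
theorem order_pos_of_inv_psiF_notMem (h : (psiF W)⁻¹ ∉ p.ring) : 0 < p.order := by
  classical
  have hx := p.xF_mem h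
  have hy := p.yF_mem hx
  let x : p.ring := ⟨xF W, hx⟩
  let y : p.ring := ⟨yF W, hy⟩
  let η : p.ring := 2 * y + p.const W.a₁ * x + p.const W.a₃
  have hη : (η : FF W) = etaF W := rfl
  have hη' : IsLocalRing.residue p.ring η = 0 := by
    rw [IsLocalRing.residue_eq_zero_iff, IsLocalRing.mem_maximalIdeal, mem_nonunits_iff]
    rintro hu
    apply h
    obtain ⟨v, hv⟩ := hu.exists_right_inv
    have hv' : etaF W * (v : FF W) = 1 := congrArg Subtype.val hv
    rw [← etaF_sq, ← inv_pow, inv_eq_of_mul_eq_one_right hv']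
    exact pow_mem v.2 2
  rw [order, addOrderOf_pos_iff, isOfFinAddOrder_iff_nsmul_eq_zero]
  refine ⟨2, two_pos, ?_⟩
  rw [two_nsmul, toPoint, dif_pos ⟨hx, hy⟩, WeierstrassCurve.Affine.Point.mk]
  refine WeierstrassCurve.Affine.Point.add_self_of_Y_eq ?_
  rw [WeierstrassCurve.Affine.negY]
  simp only [η, map_add, map_mul, map_ofNat] at hη'
  change IsLocalRing.residue p.ring y = -IsLocalRing.residue p.ring y -
    IsLocalRing.residue p.ring (p.const W.a₁) * IsLocalRing.residue p.ring x -
    IsLocalRing.residue p.ring (p.const W.a₃)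
  linear_combination hη'

end Place

end EllipticCurve

/-! ## Functions with poles at the torsion points -/

section Mero

variable {K : Type u} [Field K] [CharZero K] {W : WeierstrassCurve K} [W.IsElliptic]

theorem mem_mero_iff {f : FF W} : f ∈ mero W ↔ ∀ p : ClosedPoint W, f ∉ p.ring → 0 < p.order :=
  ⟨fun h => h.2, fun h => ⟨Place.finite_setOf_notMem_ring f, h⟩⟩

theorem integralRing_xF_mem_mero (r : integralRing K (xF W)) : (r : FF W) ∈ mero W := by
  refine mem_mero_iff.2 fun p hp => ?_
  have h := p.order_eq_one_iff.2 fun hx => hp (p.integralRing_mem hx r)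
  omega

theorem integralRing_inv_psiF_mem_mero (r : integralRing K (psiF W)⁻¹) : (r : FF W) ∈ mero W :=
  mem_mero_iff.2 fun p hp => p.order_pos_of_inv_psiF_notMem fun hx => hp (p.integralRing_mem hx r)

/-- All the points of order `n` lie on a single chart: that of `1 / ψ` if `n = 1`, and that of `x`
otherwise. Approximation in the ring of this chart produces a function in `𝒦`, as its poles lie off
the chart and hence at torsion points. -/
theorem exists_mem_mero_forall_sub_mem (n : ℕ) (hn : {p : ClosedPoint W | p.order = n}.Finite)
    (y : ∀ p : ClosedPoint W, p.ring) (e : ℕ) :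
    ∃ f ∈ mero W, ∀ p : ClosedPoint W, p.order = n → ∃ h : f ∈ p.ring,
      (⟨f, h⟩ - y p : p.ring) ∈ IsLocalRing.maximalIdeal p.ring ^ e := by
  by_cases h1 : n = 1
  · obtain ⟨r, hr⟩ := Place.exists_forall_sub_mem (K := K) (psiF W)⁻¹ _ hn (fun p hp => by
      by_contra h
      exact p.order_eq_one_iff.1 (hp.trans h1) (p.xF_mem h)) y e
    exact ⟨r, integralRing_inv_psiF_mem_mero r, hr⟩
  · obtain ⟨r, hr⟩ := Place.exists_forall_sub_mem (K := K) (xF W) _ hn (fun p hp => by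
      by_contra h
      exact h1 (hp.symm.trans (p.order_eq_one_iff.2 h))) y e
    exact ⟨r, integralRing_xF_mem_mero r, hr⟩

namespace CoordinateData

variable (D : CoordinateData W)

theorem t_mem {n : ℕ+} {p : ClosedPoint W} (hp : p.order = n) : D.t n ∈ p.ring :=
  (D.vanishing n p hp).1

theorem maximalIdeal_eq {n : ℕ+} {p : ClosedPoint W} (hp : p.order = n) :
    IsLocalRing.maximalIdeal p.ring = Ideal.span {⟨D.t n, D.t_mem hp⟩} :=
  (D.vanishing n p hp).2

theorem inv_t_notMem {n : ℕ+} {p : ClosedPoint W} (hp : p.order = n) : (D.t n)⁻¹ ∉ p.ring := by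
  intro h
  have h1 : (⟨D.t n, D.t_mem hp⟩ : p.ring) ∈ IsLocalRing.maximalIdeal p.ring := by
    rw [D.maximalIdeal_eq hp]
    exact Ideal.mem_span_singleton_self _
  exact h1 (IsUnit.of_mul_eq_one ⟨_, h⟩ (Subtype.ext (mul_inv_cancel₀ (D.t_ne_zero n))))

-- The points of exact order `n` are among the poles of `1 / tₙ`, so no count of torsion points is
-- needed.
include D in
theorem finite_setOf_order (n : ℕ+) : {p : ClosedPoint W | p.order = n}.Finite :=
  (Place.finite_setOf_notMem_ring (D.t n)⁻¹).subset fun _ hp => D.inv_t_notMem hp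

theorem exists_pow_mul_mem_ring {n : ℕ+} {p : ClosedPoint W} (hp : p.order = n) (f : FF W) :
    ∃ j, ∀ i ≥ j, D.t n ^ i * f ∈ p.ring := by
  have hirr : Irreducible (⟨D.t n, D.t_mem hp⟩ : p.ring) :=
    (IsDiscreteValuationRing.irreducible_iff_uniformizer _).2 (D.maximalIdeal_eq hp)
  suffices h : ∃ j, D.t n ^ j * f ∈ p.ring by
    obtain ⟨j, hj⟩ := h
    refine ⟨j, fun i hi => ?_⟩
    obtain ⟨k, rfl⟩ := Nat.exists_eq_add_of_le' hi
    rw [pow_add, mul_assoc]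
    exact mul_mem (pow_mem (D.t_mem hp) k) hj
  by_cases hf : f ∈ p.ring
  · exact ⟨0, by simpa using hf⟩
  · have hf' := (p.ring.mem_or_inv_mem f).resolve_left hf
    have hf0 : f ≠ 0 := fun h => hf (h ▸ zero_mem _)
    have h0 : (⟨f⁻¹, hf'⟩ : p.ring) ≠ 0 := fun h => inv_ne_zero hf0 (congrArg Subtype.val h)
    obtain ⟨j, u, hu⟩ := IsDiscreteValuationRing.eq_unit_mul_pow_irreducible h0 hirr
    refine ⟨j, ?_⟩
    have h2 : f⁻¹ = (u : p.ring) * D.t n ^ j := congrArg Subtype.val hu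
    have h3 : ((u : p.ring) : FF W) * ((u⁻¹ : p.ringˣ) : p.ring) = 1 :=
      congrArg Subtype.val u.mul_inv
    have h4 : D.t n ^ j * f = ((u⁻¹ : p.ringˣ) : p.ring) := by
      have h5 : ((u : p.ring) : FF W) * (D.t n ^ j * f) = 1 := by
        rw [← mul_assoc, ← h2, inv_mul_cancel₀ hf0]
      have h6 : ((u : p.ring) : FF W) ≠ 0 := left_ne_zero_of_mul_eq_one h3
      exact mul_left_cancel₀ h6 (h5.trans h3.symm)
    rw [h4]
    exact SetLike.coe_mem _

/-- High powers of `tₙ` clear the poles of finitely many functions at the points of exact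
order `n`. -/
theorem exists_pow_mul_mem_regularAt (n : ℕ+) {ι : Type*} (s : Finset ι)
    (f : ι → ClosedPoint W → FF W) :
    ∃ j, ∀ i ∈ s, ∀ p : ClosedPoint W, p.order = n → D.t n ^ j * f i p ∈ p.ring := by
  choose j hj using fun (p : {p : ClosedPoint W // p.order = n}) (i : ι) =>
    D.exists_pow_mul_mem_ring p.2 (f i p.1)
  have := (D.finite_setOf_order n).fintype
  let _ : Fintype {p : ClosedPoint W // p.order = n} := this
  refine ⟨Finset.univ.sup fun p => s.sup fun i => j p i, fun i hi p hp => hj ⟨p, hp⟩ i _ ?_⟩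
  let q : {p : ClosedPoint W // p.order = n} := ⟨p, hp⟩
  exact (Finset.le_sup (f := j q) hi).trans
    (Finset.le_sup (f := fun p => s.sup (j p)) (Finset.mem_univ q))

theorem mem_maximalIdeal_pow_iff {n : ℕ+} {p : ClosedPoint W} (hp : p.order = n) (e : ℕ)
    (x : p.ring) : x ∈ IsLocalRing.maximalIdeal p.ring ^ e ↔ (D.t n ^ e)⁻¹ * (x : FF W) ∈ p.ring := by
  have h0 : D.t n ^ e ≠ 0 := pow_ne_zero _ (D.t_ne_zero n)
  rw [D.maximalIdeal_eq hp, Ideal.span_singleton_pow, Ideal.mem_span_singleton]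
  constructor
  · rintro ⟨y, rfl⟩
    have h1 : (D.t n ^ e)⁻¹ * (D.t n ^ e * (y : FF W)) = y := inv_mul_cancel_left₀ h0 _
    exact h1 ▸ y.2
  · intro h
    exact ⟨⟨_, h⟩, Subtype.ext (mul_inv_cancel_left₀ h0 _).symm⟩

end CoordinateData

end Mero

/-! ## Completions of discrete valuation rings -/

section Completion

variable {R : Type*} [CommRing R] [IsDomain R] [IsDiscreteValuationRing R]

/-- The completion of a Noetherian ring is flat over it, so nonzero elements of the domain `R` stay
regular. -/
theorem algebraMap_mul_left_cancel {s : R} (hs : s ≠ 0)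
    {x y : AdicCompletion (IsLocalRing.maximalIdeal R) R}
    (h : algebraMap R _ s * x = algebraMap R _ s * y) : x = y := by
  have h1 := Module.Flat.isSMulRegular_of_nonZeroDivisors (R := R)
    (M := AdicCompletion (IsLocalRing.maximalIdeal R) R) (mem_nonZeroDivisors_of_ne_zero hs)
  refine h1 ?_
  simpa only [Algebra.smul_def] using h

/-- The ideal generated by `s` is a power of the maximal ideal, and modulo such a power `R` surjects
onto the quotient of its completion. -/
theorem exists_eq_algebraMap_add {s : R} (hs : s ≠ 0)
    (y : AdicCompletion (IsLocalRing.maximalIdeal R) R) :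
    ∃ r b, y = algebraMap R _ r + algebraMap R _ s * b := by
  obtain ⟨ϖ, hϖ⟩ := IsDiscreteValuationRing.exists_irreducible R
  obtain ⟨j, hj⟩ := IsDiscreteValuationRing.ideal_eq_span_pow_irreducible
    (s := Ideal.span {s}) (by simpa using hs) hϖ
  have hm : IsLocalRing.maximalIdeal R ^ j = Ideal.span {s} := by
    rw [hj, (IsDiscreteValuationRing.irreducible_iff_uniformizer ϖ).1 hϖ,
      Ideal.span_singleton_pow]
  obtain ⟨r, hr⟩ := Submodule.mkQ_surjective _
    (AdicCompletion.eval (IsLocalRing.maximalIdeal R) R j y)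
  have h1 : y - AdicCompletion.of (IsLocalRing.maximalIdeal R) R r ∈
      (AdicCompletion.eval (IsLocalRing.maximalIdeal R) R j).ker := by
    rw [LinearMap.mem_ker, map_sub, AdicCompletion.eval_of, hr, sub_self]
  rw [← AdicCompletion.pow_smul_top_eq_ker_eval (IsNoetherian.noetherian _), hm,
    Submodule.ideal_span_singleton_smul] at h1
  obtain ⟨b, -, hb⟩ := h1
  refine ⟨r, b, ?_⟩
  have hb' : s • b = y - AdicCompletion.of (IsLocalRing.maximalIdeal R) R r := hb
  rw [← Algebra.smul_def, hb', AdicCompletion.algebraMap_apply]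
  simp

theorem isUnit_of_algebraMap_mul_eq_one {s : R}
    {b : AdicCompletion (IsLocalRing.maximalIdeal R) R} (h : algebraMap R _ s * b = 1) :
    IsUnit s := by
  by_contra hs
  have h1 := congrArg (AdicCompletion.evalOneₐ (IsLocalRing.maximalIdeal R)) h
  have h2 : AdicCompletion.evalOneₐ (IsLocalRing.maximalIdeal R) (algebraMap R _ s) = 0 :=
    Ideal.Quotient.eq_zero_iff_mem.2 hs
  rw [map_mul, h2, zero_mul, map_one] at h1
  exact zero_ne_one h1

end Completion

/-! ## Families of functions at the torsion points -/

section Families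

variable {K : Type u} [Field K] [CharZero K] (W : WeierstrassCurve K) [W.IsElliptic]

/-- The families of functions that are regular at almost all the torsion points. -/
def almostRegular : Subring (TorsionPoint W → FF W) where
  carrier := {g | {p : TorsionPoint W | g p ∉ p.1.ring}.Finite}
  zero_mem' := Set.finite_empty.subset fun p hp => hp (zero_mem p.1.ring)
  one_mem' := Set.finite_empty.subset fun p hp => hp (one_mem p.1.ring)
  add_mem' := fun {g g'} hg hg' => (hg.union hg').subset fun p hp => by
    by_contra h
    rw [Set.mem_union, not_or] at h
    exact hp (add_mem (not_not.1 h.1) (not_not.1 h.2))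
  neg_mem' := fun {g} hg => hg.subset fun p hp h => hp (neg_mem h)
  mul_mem' := fun {g g'} hg hg' => (hg.union hg').subset fun p hp => by
    by_contra h
    rw [Set.mem_union, not_or] at h
    exact hp (mul_mem (not_not.1 h.1) (not_not.1 h.2))

/-- The families of functions that are regular at all the torsion points. -/
def everywhereRegular : Subring (TorsionPoint W → FF W) where
  carrier := {g | ∀ p : TorsionPoint W, g p ∈ p.1.ring}
  zero_mem' := fun p => zero_mem p.1.ring
  one_mem' := fun p => one_mem p.1.ring
  add_mem' := fun hg hg' p => add_mem (hg p) (hg' p)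
  neg_mem' := fun hg p => neg_mem (hg p)
  mul_mem' := fun hg hg' p => mul_mem (hg p) (hg' p)

variable {W}

theorem everywhereRegular_le_almostRegular : everywhereRegular W ≤ almostRegular W :=
  fun _ hg => Set.finite_empty.subset fun p hp => hp (hg p)

variable (W) in
/-- A regular family as a family of elements of the local rings. -/
def toRings : everywhereRegular W →+* ∀ p : TorsionPoint W, p.1.ring where
  toFun g p := ⟨g.1 p, g.2 p⟩
  map_zero' := rfl
  map_one' := rfl
  map_add' _ _ := rfl
  map_mul' _ _ := rfl

variable (W) in
/-- The completion of a regular family. -/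
def completeFamily : everywhereRegular W →+* CompletedRing W :=
  (toCompleted W).comp (toRings W)

theorem den_family_mem (g : almostRegular W) :
    (fun p => den (g.1 p) p) ∈ localEquations W := by
  refine ⟨fun p => ?_, g.2.subset fun p hp => ?_⟩
  · by_cases h : g.1 p ∈ p.1.ring
    · simp [den, h]
    · have h0 : g.1 p ≠ 0 := fun h0 => h (h0 ▸ zero_mem _)
      intro h1
      simp [den, h, Subtype.ext_iff, h0] at h1
  · intro h
    apply hp
    simp [den, h]

variable (W) in
/-- The ring `𝒦 ⊗_{𝒪_C} ∏ₙ Γ𝒪^∧_{C⟨n⟩}`. -/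
def MCR : Type u := MeroCompletedRing W

instance : CommRing (MCR W) := inferInstanceAs (CommRing (MeroCompletedRing W))

instance : Algebra (CompletedRing W) (MCR W) :=
  inferInstanceAs (Algebra (CompletedRing W) (MeroCompletedRing W))

instance : IsLocalization ((localEquations W).map (toCompleted W)) (MCR W) :=
  inferInstanceAs (IsLocalization ((localEquations W).map (toCompleted W)) (MeroCompletedRing W))

variable (W) in
/-- The localization map. -/
def toMero : CompletedRing W →+* MCR W := algebraMap _ _

/-- The fraction `a / s`. -/
def frac (a : ∀ p : TorsionPoint W, p.1.ring) (s : localEquations W) : MCR W := fraction a s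

theorem toMero_mul_frac (a : ∀ p : TorsionPoint W, p.1.ring) (s : localEquations W) :
    toMero W (toCompleted W s.1) * frac a s = toMero W (toCompleted W a) := by
  have h : frac a s = IsLocalization.mk' (MCR W) (toCompleted W a)
      (⟨toCompleted W s.1, Submonoid.mem_map_of_mem _ s.2⟩ :
        (localEquations W).map (toCompleted W)) := Localization.mk_eq_mk'_apply _ _
  rw [h]
  exact IsLocalization.mk'_spec' (MCR W) (toCompleted W a)
    (⟨toCompleted W s.1, Submonoid.mem_map_of_mem _ s.2⟩ : (localEquations W).map (toCompleted W))

theorem isUnit_toCompleted (s : localEquations W) : IsUnit (toMero W (toCompleted W s.1)) :=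
  IsLocalization.map_units (MCR W) (⟨toCompleted W s.1, Submonoid.mem_map_of_mem _ s.2⟩ :
    (localEquations W).map (toCompleted W))

theorem frac_eq {a a' : ∀ p : TorsionPoint W, p.1.ring} {s s' : localEquations W}
    (h : ∀ p, (a p * s'.1 p : FF W) = a' p * s.1 p) : frac a s = frac a' s' := fraction_eq h

theorem frac_mul (a a' : ∀ p : TorsionPoint W, p.1.ring) (s s' : localEquations W) :
    frac a s * frac a' s' = frac (a * a') (s * s') := by
  apply (isUnit_toCompleted (s * s')).mul_left_cancel
  rw [toMero_mul_frac]
  simp only [Submonoid.coe_mul, map_mul]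
  rw [← toMero_mul_frac a s, ← toMero_mul_frac a' s']
  ring

theorem frac_add (a a' : ∀ p : TorsionPoint W, p.1.ring) (s s' : localEquations W) :
    frac a s + frac a' s' = frac (s.1 * a' + s'.1 * a) (s * s') := by
  apply (isUnit_toCompleted (s * s')).mul_left_cancel
  rw [toMero_mul_frac]
  simp only [Submonoid.coe_mul, map_mul, map_add]
  rw [← toMero_mul_frac a s, ← toMero_mul_frac a' s']
  ring

theorem frac_one (a : ∀ p : TorsionPoint W, p.1.ring) : frac a 1 = toMero W (toCompleted W a) := by
  rw [← toMero_mul_frac a 1]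
  simp

variable (W) in
/-- The expansion of a family of functions at the torsion points. -/
def expandFamily : almostRegular W →+* MCR W where
  toFun g := frac (fun p => num (g.1 p) p) ⟨fun p => den (g.1 p) p, den_family_mem g⟩
  map_one' := by
    have h : frac (W := W) 1 1 = 1 := by rw [frac_one, map_one, map_one]
    rw [← h]
    refine frac_eq fun p => ?_
    simp [coe_num]
  map_zero' := by
    have h : frac (W := W) 0 1 = 0 := by rw [frac_one, map_zero, map_zero]
    rw [← h]
    refine frac_eq fun p => ?_
    simp [coe_num]
  map_mul' f g := by
    rw [frac_mul]
    refine frac_eq fun p => ?_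
    simp [coe_num]
    ring
  map_add' f g := by
    rw [frac_add]
    refine frac_eq fun p => ?_
    simp [coe_num]
    ring

theorem frac_eq_expandFamily (a : ∀ p : TorsionPoint W, p.1.ring) (s : localEquations W)
    (g : almostRegular W) (h : ∀ p, (a p : FF W) = g.1 p * s.1 p) :
    frac a s = expandFamily W g := by
  refine frac_eq fun p => ?_
  simp only [h, coe_num]
  ring

theorem expandFamily_completeFamily (g : everywhereRegular W) :
    expandFamily W ⟨g.1, everywhereRegular_le_almostRegular g.2⟩ =
      toMero W (completeFamily W g) := by
  rw [completeFamily, RingHom.comp_apply, ← frac_one]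
  exact (frac_eq_expandFamily _ _ _ fun p => (mul_one _).symm).symm

/-- The constant family given by a function. -/
def constFamily (f : mero W) : almostRegular W :=
  ⟨fun _ => f, (f.2.1.preimage (Subtype.val_injective.injOn
      (s := Subtype.val ⁻¹' {p : ClosedPoint W | (f : FF W) ∉ p.ring})))⟩

variable (W) in
/-- The expansion of a function at the torsion points. -/
def expand : mero W →+* MCR W := expansion W

theorem expandFamily_constFamily (f : mero W) : expandFamily W (constFamily f) = expand W f := rfl

theorem mul_left_cancel_localEquations {s : ∀ p : TorsionPoint W, p.1.ring}
    (hs : s ∈ localEquations W) {x y : CompletedRing W}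
    (h : toCompleted W s * x = toCompleted W s * y) : x = y := by
  funext p
  exact algebraMap_mul_left_cancel (hs.1 p) (congrFun h p)

theorem algebraMap_completedRing_injective :
    Function.Injective (toMero W) := by
  refine IsLocalization.injective (MCR W)
    (M := (localEquations W).map (toCompleted W)) ?_
  rintro _ ⟨s, hs, rfl⟩
  refine mem_nonZeroDivisors_iff_right.2 fun x hx => ?_
  refine mul_left_cancel_localEquations hs ?_
  rw [mul_comm, hx, mul_zero]

/-- If `g` has a pole at `p`, its numerator there is `1` and its denominator is `(g p)⁻¹`. An
expansion in the completed ring makes this denominator a unit of the completion, hence of the local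
ring, so `g p` would be regular. This is the fibre product property before Laurent polynomials
enter. -/
theorem mem_everywhereRegular_of_eq {g : almostRegular W} {a : CompletedRing W}
    (h : toMero W a = expandFamily W g) :
    ∃ hg : g.1 ∈ everywhereRegular W, completeFamily W ⟨g.1, hg⟩ = a := by
  have hg : g.1 ∈ everywhereRegular W := by
    intro p
    by_contra hp
    have h1 : toCompleted W (fun p => den (g.1 p) p) * a =
        toCompleted W (fun p => num (g.1 p) p) := by
      apply algebraMap_completedRing_injective
      rw [map_mul, h]
      exact toMero_mul_frac (fun p => num (g.1 p) p) ⟨_, den_family_mem g⟩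
    have h2 : algebraMap p.1.ring p.1.completion (den (g.1 p) p) * a p = 1 := by
      refine (congrFun h1 p).trans ?_
      change algebraMap p.1.ring p.1.completion (num (g.1 p) p) = 1
      simp [num, hp]
    have h3 := isUnit_of_algebraMap_mul_eq_one h2
    obtain ⟨v, hv⟩ := h3.exists_right_inv
    have h4 : ((den (g.1 p) p : p.1.ring) : FF W) = (g.1 p)⁻¹ := by simp [den, hp]
    have h5 : (g.1 p)⁻¹ * (v : FF W) = 1 := by
      rw [← h4]
      exact congrArg Subtype.val hv
    have h6 : (v : FF W) = g.1 p := by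
      rw [← inv_inv (g.1 p)]
      exact eq_inv_of_mul_eq_one_right h5
    exact hp (h6 ▸ v.2)
  refine ⟨hg, algebraMap_completedRing_injective ?_⟩
  rw [h, ← expandFamily_completeFamily]

theorem exists_eq_mk (x : MCR W) : ∃ a, ∃ s : localEquations W,
    toMero W (toCompleted W s.1) * x =
      toMero W a := by
  obtain ⟨⟨a, ⟨_, s, hs, rfl⟩⟩, h⟩ :=
    IsLocalization.surj ((localEquations W).map (toCompleted W)) x
  exact ⟨a, ⟨s, hs⟩, (mul_comm _ _).trans h⟩

/-- Up to a regular summand, every element is the expansion of a family of functions that vanish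
at almost all the torsion points. -/
theorem exists_eq_add_expandFamily (x : MCR W) : ∃ a, ∃ g : almostRegular W,
    {p | g.1 p ≠ 0}.Finite ∧
      x = toMero W a + expandFamily W g := by
  obtain ⟨a, s, h⟩ := exists_eq_mk x
  -- Choosing `r = 0` wherever `s` is a unit makes the principal part `r / s` vanish at almost all
  -- points.
  have key : ∀ p : TorsionPoint W, ∃ (r : p.1.ring) (b : p.1.completion), (IsUnit (s.1 p) → r = 0) ∧
      a p = algebraMap _ _ r + algebraMap _ _ (s.1 p) * b := by
    intro p
    by_cases hp : IsUnit (s.1 p)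
    · obtain ⟨v, hv⟩ := hp.exists_right_inv
      refine ⟨0, algebraMap _ _ v * a p, fun _ => rfl, ?_⟩
      rw [← mul_assoc, ← map_mul, hv, map_one, one_mul, map_zero, zero_add]
    · obtain ⟨r, b, hrb⟩ := exists_eq_algebraMap_add (s.2.1 p) (a p)
      exact ⟨r, b, fun h => absurd h hp, hrb⟩
  choose r b hr hrb using key
  let g₀ : TorsionPoint W → FF W := fun p => (r p : FF W) / s.1 p
  have hg₀ : {p | g₀ p ≠ 0}.Finite := s.2.2.subset fun p hp h => hp (by simp [g₀, hr p h])
  let g : almostRegular W := ⟨g₀, hg₀.subset fun p hp h => hp (by rw [h]; exact zero_mem _)⟩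
  refine ⟨b, g, hg₀, (isUnit_toCompleted s).mul_left_cancel ?_⟩
  have h0 : ∀ p, (s.1 p : FF W) ≠ 0 := fun p h => s.2.1 p (Subtype.ext h)
  have h1 : expandFamily W g = frac r s :=
    (frac_eq_expandFamily r s g fun p => (div_mul_cancel₀ _ (h0 p)).symm).symm
  have h3 : a = toCompleted W r + toCompleted W s.1 * b := funext hrb
  rw [h, h1, mul_add, toMero_mul_frac, h3, map_add, map_mul, add_comm]

end Families

/-! ## Laurent polynomials -/

section Laurent

theorem coeff_mapRingHom {A B : Type*} [CommRing A] [CommRing B] (f : A →+* B) (x : A[T;T⁻¹])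
    (j : ℤ) : (AddMonoidAlgebra.mapRingHom ℤ f x : B[T;T⁻¹]).coeff j = f (x.coeff j) := rfl

theorem laurent_ext {A : Type*} [CommRing A] {x y : A[T;T⁻¹]} (h : ∀ j, x.coeff j = y.coeff j) :
    x = y :=
  AddMonoidAlgebra.coeff_injective (Finsupp.ext h)

theorem laurent_ext_pi {ι : Type*} {A : ι → Type*} [∀ i, CommRing (A i)] {x y : (∀ i, A i)[T;T⁻¹]}
    (h : ∀ i, AddMonoidAlgebra.mapRingHom ℤ (Pi.evalRingHom A i) x =
      AddMonoidAlgebra.mapRingHom ℤ (Pi.evalRingHom A i) y) : x = y :=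
  laurent_ext fun j => funext fun i =>
    congrArg (fun z : (A i)[T;T⁻¹] => z.coeff j) (h i)

theorem laurent_eq_sum {A : Type*} [CommRing A] (f : A[T;T⁻¹]) :
    f = ∑ j ∈ f.coeff.support, LaurentPolynomial.C (f.coeff j) * LaurentPolynomial.T j := by
  simp only [← LaurentPolynomial.single_eq_C_mul_T]
  exact (AddMonoidAlgebra.sum_coeff_single f).symm

theorem coeff_C_mul_T {A : Type*} [CommRing A] (a : A) (i j : ℤ) :
    (LaurentPolynomial.C a * LaurentPolynomial.T i : A[T;T⁻¹]).coeff j = if i = j then a else 0 := by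
  rw [← LaurentPolynomial.single_eq_C_mul_T, AddMonoidAlgebra.coeff_single, Finsupp.single_apply]

theorem coeff_C_mul_T_mul {A : Type*} [CommRing A] (a : A) (i j : ℤ) (f : A[T;T⁻¹]) :
    (LaurentPolynomial.C a * LaurentPolynomial.T i * f : A[T;T⁻¹]).coeff j =
      a * f.coeff (j - i) := by
  rw [← LaurentPolynomial.single_eq_C_mul_T]
  rw [AddMonoidAlgebra.coeff_single_mul_apply, neg_add_eq_sub]

/-- A ring homomorphism to Laurent polynomials lifts to a subring of the coefficients. -/
theorem exists_laurent_lift {R A : Type*} [CommRing R] [CommRing A] (S : Subring A)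
    (f : R →+* A[T;T⁻¹]) (hf : ∀ r j, (f r).coeff j ∈ S) :
    ∃ f' : R →+* S[T;T⁻¹], ∀ r j, ((f' r).coeff j : A) = (f r).coeff j := by
  let i : S[T;T⁻¹] →+* A[T;T⁻¹] := AddMonoidAlgebra.mapRingHom ℤ S.subtype
  have hi : Function.Injective i := fun x y h => laurent_ext fun j => Subtype.ext
    (congrArg (fun z : A[T;T⁻¹] => z.coeff j) h)
  have hr : ∀ r, ∃ x, i x = f r := by
    intro r
    refine ⟨∑ j ∈ (f r).coeff.support, LaurentPolynomial.C ⟨(f r).coeff j, hf r j⟩ *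
      LaurentPolynomial.T j, ?_⟩
    conv_rhs => rw [laurent_eq_sum (f r)]
    rw [map_sum]
    refine Finset.sum_congr rfl fun j _ => laurent_ext fun k => ?_
    rw [coeff_mapRingHom, coeff_C_mul_T, coeff_C_mul_T]
    split_ifs <;> rfl
  choose g hg using hr
  refine ⟨{ toFun := g
            map_one' := hi (by rw [hg, map_one, map_one])
            map_zero' := hi (by rw [hg, map_zero, map_zero])
            map_mul' := fun x y => hi (by rw [map_mul, hg, hg, hg, map_mul])
            map_add' := fun x y => hi (by rw [map_add, hg, hg, hg, map_add]) }, fun r j => ?_⟩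
  exact congrArg (fun z : A[T;T⁻¹] => z.coeff j) (hg r)

end Laurent

/-! ## Euler classes -/

section EulerClasses

/-- The element `c^v` of `(∏ₙ ℚ)[c, c⁻¹]`. -/
def cpow (v : ℕ+ →₀ ℤ) : FinSub[T;T⁻¹] :=
  -- The exponent `0` is inserted because it is the value of `v` outside its support.
  ∑ j ∈ insert 0 (v.support.image v),
    LaurentPolynomial.C (fun n => if v n = j then 1 else 0) * LaurentPolynomial.T j

theorem coeff_cpow (v : ℕ+ →₀ ℤ) (j : ℤ) (n : ℕ+) :
    (cpow v).coeff j n = if v n = j then 1 else 0 := by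
  have h1 : (cpow v).coeff j = ∑ i ∈ insert 0 (v.support.image v),
      if i = j then (fun n => if v n = i then 1 else 0 : FinSub) else 0 := by
    rw [cpow, AddMonoidAlgebra.coeff_sum, Finsupp.finsetSum_apply]
    exact Finset.sum_congr rfl fun i _ => coeff_C_mul_T _ _ _
  rw [h1, Finset.sum_ite_eq']
  split_ifs with h2 h3 h3
  · exact if_pos h3
  · exact if_neg h3
  · exfalso
    apply h2
    subst h3
    by_cases h0 : v n = 0
    · rw [h0]
      exact Finset.mem_insert_self _ _
    · exact Finset.mem_insert_of_mem (Finset.mem_image_of_mem _ (Finsupp.mem_support_iff.2 h0))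
  · rfl

theorem eval_cpow (v : ℕ+ →₀ ℤ) (n : ℕ+) :
    AddMonoidAlgebra.mapRingHom ℤ (Pi.evalRingHom (fun _ => ℚ) n) (cpow v) =
      LaurentPolynomial.T (v n) := by
  refine laurent_ext fun j => ?_
  rw [coeff_mapRingHom, LaurentPolynomial.T_apply]
  exact coeff_cpow v j n

theorem cpow_add (v v' : ℕ+ →₀ ℤ) : cpow (v + v') = cpow v * cpow v' := by
  refine laurent_ext_pi fun n => ?_
  rw [map_mul, eval_cpow, eval_cpow, eval_cpow, ← LaurentPolynomial.T_add, Finsupp.add_apply]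

theorem cpow_zero : cpow 0 = 1 := by
  refine laurent_ext_pi fun n => ?_
  rw [map_one, eval_cpow, Finsupp.zero_apply, LaurentPolynomial.T_zero]

theorem inLattice_cpow {v : ℕ+ →₀ ℤ} {w : ℕ+ →₀ ℕ} (h : ∀ n, -(w n : ℤ) ≤ v n) :
    InLattice w (cpow v) := by
  intro j n hj
  rw [coeff_cpow] at hj
  split_ifs at hj with h1
  · rw [← h1]
    exact h n
  · exact absurd rfl hj

theorem cpow_mem_EOFSub (v : ℕ+ →₀ ℤ) : cpow v ∈ EOFSub :=
  ⟨v.mapRange Int.natAbs rfl, inLattice_cpow fun n => by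
    rw [Finsupp.mapRange_apply]
    omega⟩

theorem cpow_mem_OFSub {v : ℕ+ →₀ ℤ} (hv : 0 ≤ v) : cpow v ∈ OFSub :=
  inLattice_cpow fun n => by simpa using hv n

/-- The multiplicative set of the Euler classes `c^v`. -/
def eulerClasses : Submonoid OF.carrier where
  carrier := {a : OFSub | ∃ v : ℕ+ →₀ ℤ, 0 ≤ v ∧ (a : FinSub[T;T⁻¹]) = cpow v}
  one_mem' := ⟨0, le_rfl, cpow_zero.symm⟩
  mul_mem' := by
    rintro a b ⟨v, hv, ha⟩ ⟨v', hv', hb⟩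
    refine ⟨v + v', add_nonneg hv hv', ?_⟩
    rw [cpow_add, ← ha, ← hb]
    rfl

/-- The element `c^v` of `𝓔⁻¹𝒪_𝓕`. -/
def cpowE (v : ℕ+ →₀ ℤ) : EOF.carrier := (⟨cpow v, cpow_mem_EOFSub v⟩ : EOFSub)

theorem cpowE_add (v v' : ℕ+ →₀ ℤ) : cpowE (v + v') = cpowE v * cpowE v' :=
  Subtype.ext (cpow_add v v')

theorem cpowE_zero : cpowE 0 = 1 := Subtype.ext cpow_zero

theorem cpowE_mul_neg (v : ℕ+ →₀ ℤ) : cpowE v * cpowE (-v) = 1 := by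
  rw [← cpowE_add, add_neg_cancel, cpowE_zero]

/-- The element `c^v` of `𝒪_𝓕`. -/
def cpowO (v : ℕ+ →₀ ℤ) (hv : 0 ≤ v) : OF.carrier := (⟨cpow v, cpow_mem_OFSub hv⟩ : OFSub)

theorem cpowO_mem (v : ℕ+ →₀ ℤ) (hv : 0 ≤ v) : cpowO v hv ∈ eulerClasses := ⟨v, hv, rfl⟩

theorem exists_eq_cpowO {a : OF.carrier} (ha : a ∈ eulerClasses) : ∃ v hv, a = cpowO v hv := by
  obtain ⟨v, hv, h⟩ := ha
  exact ⟨v, hv, Subtype.ext h⟩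

theorem exists_cpow_mul_mem_OFSub {f : FinSub[T;T⁻¹]} (hf : f ∈ EOFSub) :
    ∃ v : ℕ+ →₀ ℤ, 0 ≤ v ∧ cpow v * f ∈ OFSub := by
  obtain ⟨w, hw⟩ := hf
  refine ⟨w.mapRange (fun n : ℕ => (n : ℤ)) rfl, fun n => by simp, fun j n hj => ?_⟩
  have h1 : (cpow (w.mapRange (fun n : ℕ => (n : ℤ)) rfl) * f).coeff j n = f.coeff (j - w n) n := by
    have h2 : (cpow (w.mapRange (fun n : ℕ => (n : ℤ)) rfl) * f).coeff j n =
        (AddMonoidAlgebra.mapRingHom ℤ (Pi.evalRingHom (fun _ => ℚ) n)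
          (cpow (w.mapRange (fun n : ℕ => (n : ℤ)) rfl) * f)).coeff j := rfl
    rw [h2, map_mul, eval_cpow]
    have h3 := coeff_C_mul_T_mul (1 : ℚ) (w n) j
      (AddMonoidAlgebra.mapRingHom ℤ (Pi.evalRingHom (fun _ => ℚ) n) f)
    rw [map_one, one_mul, one_mul] at h3
    exact h3
  rw [h1] at hj
  have := hw _ n hj
  simp
  omega

/-- `𝓔⁻¹𝒪_𝓕` is the localization of `𝒪_𝓕` at the Euler classes. -/
theorem isLocalization_eulerClasses :
    letI : Algebra OF.carrier EOF.carrier := sphereFork.l.toRingHom.toAlgebra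
    IsLocalization eulerClasses EOF.carrier := by
  let _ : Algebra OF.carrier EOF.carrier := sphereFork.l.toRingHom.toAlgebra
  refine ⟨fun a => ?_, fun x => ?_, fun {x y} h => ⟨1, ?_⟩⟩
  · obtain ⟨v, hv, h⟩ := exists_eq_cpowO a.2
    rw [h]
    exact IsUnit.of_mul_eq_one (cpowE (-v)) (cpowE_mul_neg v)
  · obtain ⟨v, hv, h⟩ := exists_cpow_mul_mem_OFSub x.2
    refine ⟨⟨(⟨_, h⟩ : OFSub), ⟨cpowO v hv, cpowO_mem v hv⟩⟩, Subtype.ext (mul_comm _ _)⟩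
  · have hxy : x = y := Subtype.ext (congrArg (Subtype.val : EOFSub → _) h)
    rw [hxy]

end EulerClasses

/-! ## The kernel of the principal part map as a localization base -/

section KernelLocalization

theorem eval₂_mapRingHom {A B S : Type*} [CommRing A] [CommRing B] [CommRing S] (φ : B →+* S)
    (g : A →+* B) (u : Sˣ) (f : A[T;T⁻¹]) :
    LaurentPolynomial.eval₂ (φ.comp g) u f =
      LaurentPolynomial.eval₂ φ u (AddMonoidAlgebra.mapRingHom ℤ g f) := by
  induction f using LaurentPolynomial.induction_on' with
  | add p q hp hq => rw [map_add, hp, hq, map_add, map_add]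
  | C_mul_T n a =>
    have h : (AddMonoidAlgebra.mapRingHom ℤ g (LaurentPolynomial.C a * LaurentPolynomial.T n) :
        B[T;T⁻¹]) = LaurentPolynomial.C (g a) * LaurentPolynomial.T n := by
      refine laurent_ext fun k => ?_
      rw [coeff_mapRingHom, coeff_C_mul_T, coeff_C_mul_T]
      split_ifs
      · rfl
      · exact map_zero g
    rw [h, LaurentPolynomial.eval₂_C_mul_T, LaurentPolynomial.eval₂_C_mul_T]
    rfl

variable {K : Type u} [Field K] [CharZero K] {W : WeierstrassCurve K} [W.IsElliptic]

namespace CoordinateData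

variable (D : CoordinateData W)

theorem lam_ne_zero : algebraMap K (FF W) D.lam ≠ 0 := by simp

/-- The minus sign in the exponent of `T` reflects that `tₙ / Dt` is a section of `Ω⁻¹`, while `T`
stands for `ω`. -/
theorem euler_zpow (n : ℕ+) (k : ℤ) : ((D.euler n ^ k : (FF W)[T;T⁻¹]ˣ) : (FF W)[T;T⁻¹]) =
    LaurentPolynomial.C ((D.t n / algebraMap K (FF W) D.lam) ^ k) * LaurentPolynomial.T (-k) := by
  have h0 : D.t n / algebraMap K (FF W) D.lam ≠ 0 := div_ne_zero (D.t_ne_zero n) D.lam_ne_zero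
  induction k with
  | zero => simp
  | succ k ih =>
    rw [zpow_add_one, Units.val_mul, ih, zpow_add_one₀ h0, map_mul, neg_add, LaurentPolynomial.T_add]
    change _ * (LaurentPolynomial.C _ * LaurentPolynomial.T (-1)) = _
    ring
  | pred k ih =>
    rw [zpow_sub_one, Units.val_mul, ih, zpow_sub_one₀ h0, map_mul, neg_sub,
      sub_eq_add_neg, LaurentPolynomial.T_add, inv_div]
    change _ * (LaurentPolynomial.C _ * LaurentPolynomial.T 1) = _
    ring

theorem evalEuler_apply (n : ℕ+) (f : FinSub[T;T⁻¹]) : (D.evalEuler n).toRingHom f =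
    LaurentPolynomial.eval₂ (algebraMap ℚ (FF W)[T;T⁻¹]) (D.euler n)
      (AddMonoidAlgebra.mapRingHom ℤ (Pi.evalRingHom (fun _ => ℚ) n) f) :=
  eval₂_mapRingHom _ _ _ f

theorem evalEuler_cpow (n : ℕ+) (v : ℕ+ →₀ ℤ) : (D.evalEuler n).toRingHom (cpow v) =
    ((D.euler n ^ v n : (FF W)[T;T⁻¹]ˣ) : (FF W)[T;T⁻¹]) := by
  rw [evalEuler_apply, eval_cpow, LaurentPolynomial.eval₂_T]

theorem evalAt_tmul (n : ℕ+) (g : EOF.carrier) (f : (PK W).carrier) :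
    (D.evalAt n).toRingHom (g ⊗ₜ[ℚ] f) =
      (D.evalEuler n).toRingHom (Subtype.val (p := (· ∈ EOFSub)) g) *
        (GrRing.laurentMap (mero W).val.toRingHom 2).toRingHom f := rfl

theorem evalAt_left (n : ℕ+) (g : EOF.carrier) :
    (D.evalAt n).toRingHom ((GrRing.tensorLeft EOF (PK W)).toRingHom g) =
      (D.evalEuler n).toRingHom (Subtype.val (p := (· ∈ EOFSub)) g) := by
  change (D.evalEuler n).toRingHom (Subtype.val (p := (· ∈ EOFSub)) g) *
    (GrRing.laurentMap (mero W).val.toRingHom 2).toRingHom 1 = _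
  rw [map_one, mul_one]

theorem evalAt_right (n : ℕ+) (f : (PK W).carrier) :
    (D.evalAt n).toRingHom ((GrRing.tensorRight EOF (PK W)).toRingHom f) =
      (GrRing.laurentMap (mero W).val.toRingHom 2).toRingHom f := by
  change ((D.evalEuler n).comp (GrRing.subHom _ _ _)).toRingHom 1 *
    (GrRing.laurentMap (mero W).val.toRingHom 2).toRingHom f = _
  rw [map_one, one_mul]

variable (W) in
/-- The element `c^v ⊗ 1`. -/
def cpowB (v : ℕ+ →₀ ℤ) : (EOF.tensor (PK W)).carrier :=
  (GrRing.tensorLeft EOF (PK W)).toRingHom (cpowE v)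

omit D in
theorem cpowB_mul_neg (v : ℕ+ →₀ ℤ) : cpowB W v * cpowB W (-v) = 1 := by
  rw [cpowB, cpowB, ← map_mul, cpowE_mul_neg, map_one]

theorem coeff_evalAt_cpowB_mul (n : ℕ+) (v : ℕ+ →₀ ℤ) (z : (EOF.tensor (PK W)).carrier) (j : ℤ) :
    ((D.evalAt n).toRingHom (cpowB W v * z) : (FF W)[T;T⁻¹]).coeff j =
      (D.t n / algebraMap K (FF W) D.lam) ^ v n *
        ((D.evalAt n).toRingHom z : (FF W)[T;T⁻¹]).coeff (j + v n) := by
  rw [map_mul, cpowB, evalAt_left]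
  have h : (D.evalEuler n).toRingHom (Subtype.val (p := (· ∈ EOFSub)) (cpowE v)) =
      ((D.euler n ^ v n : (FF W)[T;T⁻¹]ˣ) : (FF W)[T;T⁻¹]) := D.evalEuler_cpow n v
  rw [h, euler_zpow]
  refine (coeff_C_mul_T_mul _ _ _ _).trans ?_
  rw [sub_neg_eq_add]

theorem evalAt_cpowB_mem (n : ℕ+) {v : ℕ+ →₀ ℤ} (hv : 0 ≤ v n) :
    (D.evalAt n).toRingHom (cpowB W v) ∈ regularSections W n := by
  rw [cpowB, evalAt_left]
  have h : (D.evalEuler n).toRingHom (Subtype.val (p := (· ∈ EOFSub)) (cpowE v)) =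
      ((D.euler n ^ v n : (FF W)[T;T⁻¹]ˣ) : (FF W)[T;T⁻¹]) := D.evalEuler_cpow n v
  rw [h]
  obtain ⟨m, hm⟩ := Int.eq_ofNat_of_zero_le hv
  rw [hm, zpow_natCast, Units.val_pow_eq_pow_val]
  exact pow_mem (D.euler_mem n) m

/-- At almost all orders the principal part vanishes. -/
theorem finite_setOf_notMem_regularSections (z : (EOF.tensor (PK W)).carrier) :
    {n | (D.evalAt n).toRingHom z ∉ regularSections W n}.Finite := by
  induction z using TensorProduct.induction_on with
  | zero =>
    refine Set.finite_empty.subset fun n hn => hn ?_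
    have : (D.evalAt n).toRingHom 0 ∈ regularSections W n := by
      rw [map_zero]
      exact zero_mem _
    exact this
  | add x y hx hy =>
    refine (hx.union hy).subset fun n hn => ?_
    by_contra h
    rw [Set.mem_union, not_or] at h
    refine hn ?_
    have h1 : (D.evalAt n).toRingHom (x + y) = (D.evalAt n).toRingHom x +
      (D.evalAt n).toRingHom y := (D.evalAt n).toRingHom.map_add x y
    rw [h1]
    exact add_mem (not_not.1 h.1) (not_not.1 h.2)
  | tmul g f =>
    -- The finitely many exceptional orders are those in the support of `v`, where `g` may have
    -- denominators, and the orders of the poles of the finitely many coefficients of `f`.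
    obtain ⟨v, hv, hg⟩ := exists_cpow_mul_mem_OFSub (f := Subtype.val (p := (· ∈ EOFSub)) g) g.2
    have hfin : (⋃ j ∈ (f : (mero W)[T;T⁻¹]).coeff.support, {p : ClosedPoint W |
        (((f : (mero W)[T;T⁻¹]).coeff j : mero W) : FF W) ∉ p.ring}).Finite :=
      Set.Finite.biUnion (Finset.finite_toSet _) fun j _ => ((f : (mero W)[T;T⁻¹]).coeff j).2.1
    refine ((Finset.finite_toSet v.support).union ((hfin.image Place.order).preimage
      (PNat.coe_injective.injOn))).subset fun n hn => ?_
    by_contra h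
    rw [Set.mem_union, not_or] at h
    refine hn ?_
    rw [evalAt_tmul]
    refine mul_mem ?_ ?_
    · have h1 := D.principalPart_eq_zero_iff.1 (D.left_mem_NCSub ⟨_, hg⟩ n)
      have h2 : (D.evalEuler n).toRingHom (cpow v * Subtype.val (p := (· ∈ EOFSub)) g) ∈
          regularSections W n :=
        (congrArg (· ∈ regularSections W n) (D.evalAt_left n
          (sphereFork.l.toRingHom (⟨_, hg⟩ : OFSub)))).mp h1
      have h3 : v n = 0 := by simpa using h.1
      have h4 : (D.evalEuler n).toRingHom (cpow v) = 1 := by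
        rw [evalEuler_cpow, h3, zpow_zero, Units.val_one]
        rfl
      have h5 : (D.evalEuler n).toRingHom (cpow v * Subtype.val (p := (· ∈ EOFSub)) g) =
        (D.evalEuler n).toRingHom (cpow v) *
          (D.evalEuler n).toRingHom (Subtype.val (p := (· ∈ EOFSub)) g) := map_mul _ _ _
      rwa [h5, h4, one_mul] at h2
    · intro j
      refine mem_regularAt.2 fun p hp => ?_
      by_contra hj
      refine h.2 ⟨p, ?_, hp⟩
      refine Set.mem_biUnion (x := j) ?_ hj
      refine Finsupp.mem_support_iff.2 fun h0 => hj ?_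
      have h1 : (((f : (mero W)[T;T⁻¹]).coeff j : mero W) : FF W) ∈ p.ring := by
        rw [h0]
        exact zero_mem p.ring
      exact h1

/-- Only finitely many orders carry a nonzero principal part. At each of these, one power of `tₙ`
clears the poles of all the coefficients, and these powers assemble into a single `c^v`. -/
theorem exists_cpowB_mul_mem (z : (EOF.tensor (PK W)).carrier) :
    ∃ v : ℕ+ →₀ ℤ, 0 ≤ v ∧ cpowB W v * z ∈ D.NCSub := by
  classical
  choose e he using fun n : ℕ+ => D.exists_pow_mul_mem_regularAt n
    ((D.evalAt n).toRingHom z : (FF W)[T;T⁻¹]).coeff.support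
    fun i _ => ((D.evalAt n).toRingHom z : (FF W)[T;T⁻¹]).coeff i
  let s := (D.finite_setOf_notMem_regularSections z).toFinset
  let v : ℕ+ →₀ ℤ := Finsupp.onFinset s (fun n => if n ∈ s then (e n : ℤ) else 0)
    fun n hn => by
      by_contra h
      exact hn (if_neg h)
  have hv : 0 ≤ v := fun n => by
    change 0 ≤ if n ∈ s then (e n : ℤ) else 0
    split_ifs <;> simp
  refine ⟨v, hv, fun n => D.principalPart_eq_zero_iff.2 ?_⟩
  by_cases hn : n ∈ s
  · intro j
    rw [coeff_evalAt_cpowB_mul, mem_regularAt]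
    intro p hp
    have hvn : v n = e n := if_pos hn
    rw [hvn, zpow_natCast, div_pow, div_mul_eq_mul_div, div_eq_mul_inv, ← map_pow, ← map_inv₀]
    refine mul_mem ?_ (p.const_mem _)
    by_cases hj : ((D.evalAt n).toRingHom z : (FF W)[T;T⁻¹]).coeff (j + e n) = 0
    · rw [hj, mul_zero]
      exact zero_mem _
    · exact he n _ (Finsupp.mem_support_iff.2 hj) p hp
  · rw [map_mul]
    refine mul_mem (D.evalAt_cpowB_mem n (hv n)) ?_
    by_contra h
    exact hn ((D.finite_setOf_notMem_regularSections z).mem_toFinset.2 h)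

/-- The Euler classes in `NC`. -/
def eulerNC : Submonoid D.NC.carrier := eulerClasses.map D.unit.h₁.toRingHom

/-- `c^v ⊗ 1` has the inverse `c^{-v} ⊗ 1`, Euler classes clear denominators by
`exists_cpowB_mul_mem`, and `NC` is a subring, so nothing is killed. -/
theorem isLocalization_eulerNC :
    letI : Algebra D.NC.carrier (EOF.tensor (PK W)).carrier := D.ECa.l.toRingHom.toAlgebra
    IsLocalization D.eulerNC (EOF.tensor (PK W)).carrier := by
  let _ : Algebra D.NC.carrier (EOF.tensor (PK W)).carrier := D.ECa.l.toRingHom.toAlgebra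
  refine ⟨?_, fun z => ?_, fun {x y} h => ⟨1, ?_⟩⟩
  · rintro ⟨_, a, ha, rfl⟩
    obtain ⟨v, hv, rfl⟩ := exists_eq_cpowO ha
    exact IsUnit.of_mul_eq_one (cpowB W (-v)) (cpowB_mul_neg v)
  · obtain ⟨v, hv, h⟩ := D.exists_cpowB_mul_mem z
    exact ⟨⟨(⟨_, h⟩ : D.NCSub), ⟨_, _, cpowO_mem v hv, rfl⟩⟩, mul_comm _ _⟩
  · have hxy : x = y := Subtype.ext h
    rw [hxy]

end CoordinateData

end KernelLocalization

/-! ## The map of diagrams of rings -/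

section ForkMap

variable {K : Type u} [Field K] [CharZero K] {W : WeierstrassCurve K} [W.IsElliptic]

/-- The exact order of a torsion point. -/
def TorsionPoint.ord (p : TorsionPoint W) : ℕ+ := ⟨p.1.order, p.2⟩

namespace CoordinateData

variable (D : CoordinateData W)

/-- The value `(tₙ / Dt)^j` at the points of exact order `n`, weighted by `a`. -/
def eulerFamily (a : FinSub) (j : ℤ) : TorsionPoint W → FF W := fun p =>
  algebraMap ℚ (FF W) (a (TorsionPoint.ord p)) *
    (D.t (TorsionPoint.ord p) / algebraMap K (FF W) D.lam) ^ j

theorem evalEuler_C_mul_T (n : ℕ+) (a : FinSub) (j : ℤ) :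
    (D.evalEuler n).toRingHom (LaurentPolynomial.C a * LaurentPolynomial.T j : FinSub[T;T⁻¹]) =
      LaurentPolynomial.C (algebraMap ℚ (FF W) (a n) *
        (D.t n / algebraMap K (FF W) D.lam) ^ j) * LaurentPolynomial.T (-j) := by
  have h : (D.evalEuler n).toRingHom (LaurentPolynomial.C a * LaurentPolynomial.T j : FinSub[T;T⁻¹]) =
      algebraMap ℚ (FF W)[T;T⁻¹] (a n) * ((D.euler n ^ j : (FF W)[T;T⁻¹]ˣ) : (FF W)[T;T⁻¹]) :=
    LaurentPolynomial.eval₂_C_mul_T _ _ _ _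
  rw [h, euler_zpow, LaurentPolynomial.algebraMap_apply, map_mul]
  exact (mul_assoc _ _ _).symm

/-- The values for all `n` fit into one Laurent polynomial because the exponents of `T` are bounded
uniformly in `n`: on a monomial the exponent does not depend on `n` at all. -/
theorem exists_family_evalEuler (g : FinSub[T;T⁻¹]) : ∃ F : (TorsionPoint W → FF W)[T;T⁻¹],
    ∀ p, AddMonoidAlgebra.mapRingHom ℤ (Pi.evalRingHom (fun _ => FF W) p) F =
      (D.evalEuler (TorsionPoint.ord p)).toRingHom g := by
  induction g using LaurentPolynomial.induction_on' with
  | add x y hx hy =>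
    obtain ⟨F, hF⟩ := hx
    obtain ⟨G, hG⟩ := hy
    refine ⟨F + G, fun p => ?_⟩
    rw [map_add, hF, hG]
    exact ((D.evalEuler (TorsionPoint.ord p)).toRingHom.map_add x y).symm
  | C_mul_T j a =>
    refine ⟨LaurentPolynomial.C (D.eulerFamily a j) * LaurentPolynomial.T (-j), fun p => ?_⟩
    rw [D.evalEuler_C_mul_T]
    refine laurent_ext fun k => ?_
    refine Eq.trans ?_ (coeff_C_mul_T _ (-j) k).symm
    rw [coeff_mapRingHom, coeff_C_mul_T]
    split_ifs <;> rfl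

theorem exists_family_evalAt (z : (EOF.tensor (PK W)).carrier) :
    ∃ F : (TorsionPoint W → FF W)[T;T⁻¹],
      ∀ p, AddMonoidAlgebra.mapRingHom ℤ (Pi.evalRingHom (fun _ => FF W) p) F =
        (D.evalAt (TorsionPoint.ord p)).toRingHom z := by
  induction z using TensorProduct.induction_on with
  | zero =>
    refine ⟨0, fun p => ?_⟩
    rw [map_zero]
    exact (map_zero (D.evalAt (TorsionPoint.ord p)).toRingHom).symm
  | add x y hx hy =>
    obtain ⟨F, hF⟩ := hx
    obtain ⟨G, hG⟩ := hy
    refine ⟨F + G, fun p => ?_⟩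
    rw [map_add, hF, hG]
    exact ((D.evalAt (TorsionPoint.ord p)).toRingHom.map_add x y).symm
  | tmul g f =>
    obtain ⟨F, hF⟩ := D.exists_family_evalEuler (Subtype.val (p := (· ∈ EOFSub)) g)
    let c : mero W →+* (TorsionPoint W → FF W) := RingHom.pi fun _ => (mero W).val.toRingHom
    refine ⟨F * AddMonoidAlgebra.mapRingHom ℤ c f, fun p => ?_⟩
    rw [map_mul, hF, evalAt_tmul]
    exact congrArg (fun y : (PFF W).carrier => (D.evalEuler (TorsionPoint.ord p)).toRingHom _ * y)
      (laurent_ext (A := FF W) fun j => rfl)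

/-- The ring homomorphism that expands `c^v ⊗ f` at all the torsion points, to the family of
functions `(tₙ / Dt)^{v(n)} f`. -/
def evalFamily : (EOF.tensor (PK W)).carrier →+* (TorsionPoint W → FF W)[T;T⁻¹] where
  -- A Laurent polynomial over a product is determined by its components, so the choice is unique
  -- and respects the ring operations.
  toFun z := (D.exists_family_evalAt z).choose
  map_zero' := laurent_ext_pi fun p => by
    rw [(D.exists_family_evalAt 0).choose_spec p, map_zero, map_zero]
    rfl
  map_one' := laurent_ext_pi fun p => by
    rw [(D.exists_family_evalAt 1).choose_spec p, map_one, map_one]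
    rfl
  map_add' x y := laurent_ext_pi fun p => by
    rw [(D.exists_family_evalAt _).choose_spec p, map_add, map_add,
      (D.exists_family_evalAt x).choose_spec p, (D.exists_family_evalAt y).choose_spec p]
    rfl
  map_mul' x y := laurent_ext_pi fun p => by
    rw [(D.exists_family_evalAt _).choose_spec p, map_mul, map_mul,
      (D.exists_family_evalAt x).choose_spec p, (D.exists_family_evalAt y).choose_spec p]
    rfl

theorem coeff_evalFamily (z : (EOF.tensor (PK W)).carrier) (j : ℤ) (p : TorsionPoint W) :
    (D.evalFamily z).coeff j p =
      ((D.evalAt (TorsionPoint.ord p)).toRingHom z : (FF W)[T;T⁻¹]).coeff j :=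
  congrArg (fun x : (FF W)[T;T⁻¹] => x.coeff j) ((D.exists_family_evalAt z).choose_spec p)

/-- Poles occur at finitely many orders only, and there are finitely many points of each order. -/
theorem coeff_evalFamily_mem_almostRegular (z : (EOF.tensor (PK W)).carrier) (j : ℤ) :
    (D.evalFamily z).coeff j ∈ almostRegular W := by
  have hfin : (⋃ n ∈ {n | (D.evalAt n).toRingHom z ∉ regularSections W n},
      {p : TorsionPoint W | p.1.order = n}).Finite :=
    (D.finite_setOf_notMem_regularSections z).biUnion fun n _ =>
      (D.finite_setOf_order n).preimage Subtype.val_injective.injOn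
  refine hfin.subset fun p hp => Set.mem_biUnion (x := TorsionPoint.ord p) (fun h => hp ?_) rfl
  rw [coeff_evalFamily]
  exact mem_regularAt.1 (h j) p.1 rfl

/-- A point of exact order `n` is a torsion point, so vanishing of all principal parts is regularity
at every torsion point. This makes `NC` a preimage of `everywhereRegular W` coefficientwise, which
is what the fibre square needs. -/
theorem mem_NCSub_iff (z : (EOF.tensor (PK W)).carrier) :
    z ∈ D.NCSub ↔ ∀ j, (D.evalFamily z).coeff j ∈ everywhereRegular W := by
  constructor
  · intro h j p
    rw [coeff_evalFamily]
    exact mem_regularAt.1 (D.principalPart_eq_zero_iff.1 (h (TorsionPoint.ord p)) j) p.1 rfl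
  · intro h n
    refine D.principalPart_eq_zero_iff.2 fun j => mem_regularAt.2 fun p hp => ?_
    have h1 := h j ⟨p, hp ▸ n.pos⟩
    rw [coeff_evalFamily] at h1
    have h2 : TorsionPoint.ord ⟨p, hp ▸ n.pos⟩ = n := PNat.eq hp
    rw [h2] at h1
    exact h1

theorem exists_evalAlmost : ∃ f : (EOF.tensor (PK W)).carrier →+* (almostRegular W)[T;T⁻¹],
    ∀ z j, ((f z).coeff j : TorsionPoint W → FF W) = (D.evalFamily z).coeff j :=
  exists_laurent_lift _ _ D.coeff_evalFamily_mem_almostRegular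

theorem exists_evalEverywhere : ∃ f : D.NC.carrier →+* (everywhereRegular W)[T;T⁻¹],
    ∀ z j, ((f z).coeff j : TorsionPoint W → FF W) =
      (D.evalFamily (D.ECa.l.toRingHom z)).coeff j :=
  exists_laurent_lift _ (D.evalFamily.comp D.ECa.l.toRingHom) fun z j =>
    (D.mem_NCSub_iff _).1 z.2 j

/-- The map `𝓔⁻¹𝒪_𝓕 ⊗ P𝒦 → P(𝒦 ⊗_{𝒪_C} ∏ₙ Γ𝒪^∧_{C⟨n⟩})`. -/
def toMCR : (EOF.tensor (PK W)).carrier →+* (MCR W)[T;T⁻¹] :=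
  (AddMonoidAlgebra.mapRingHom ℤ (expandFamily W)).comp D.exists_evalAlmost.choose

/-- The map `NC → P(∏ₙ Γ𝒪^∧_{C⟨n⟩})`. -/
def toCR : D.NC.carrier →+* (CompletedRing W)[T;T⁻¹] :=
  (AddMonoidAlgebra.mapRingHom ℤ (completeFamily W)).comp D.exists_evalEverywhere.choose

theorem coeff_toMCR (z : (EOF.tensor (PK W)).carrier) (j : ℤ) : (D.toMCR z).coeff j =
    expandFamily W ⟨(D.evalFamily z).coeff j, D.coeff_evalFamily_mem_almostRegular z j⟩ :=
  congrArg (expandFamily W) (Subtype.ext (D.exists_evalAlmost.choose_spec z j))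

theorem coeff_toCR (z : D.NC.carrier) (j : ℤ) : (D.toCR z).coeff j =
    completeFamily W ⟨(D.evalFamily (D.ECa.l.toRingHom z)).coeff j,
      (D.mem_NCSub_iff _).1 z.2 j⟩ :=
  congrArg (completeFamily W) (Subtype.ext (D.exists_evalEverywhere.choose_spec z j))

theorem toMCR_l (z : D.NC.carrier) : D.toMCR (D.ECa.l.toRingHom z) =
    AddMonoidAlgebra.mapRingHom ℤ (toMero W) (D.toCR z) := by
  refine laurent_ext fun j => ?_
  refine (D.coeff_toMCR _ j).trans (Eq.trans ?_ (congrArg (toMero W) (D.coeff_toCR z j)).symm)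
  exact expandFamily_completeFamily ⟨_, (D.mem_NCSub_iff _).1 z.2 j⟩

theorem toMCR_right (f : (PK W).carrier) :
    D.toMCR ((GrRing.tensorRight EOF (PK W)).toRingHom f) =
      AddMonoidAlgebra.mapRingHom ℤ (expand W) f := by
  refine laurent_ext fun j => ?_
  refine (D.coeff_toMCR _ j).trans (Eq.trans ?_
    (expandFamily_constFamily ((f : (mero W)[T;T⁻¹]).coeff j)))
  refine congrArg (expandFamily W) (Subtype.ext (funext fun p => ?_))
  refine (D.coeff_evalFamily _ j p).trans ?_
  exact congrArg (fun y : (FF W)[T;T⁻¹] => y.coeff j) (D.evalAt_right _ f)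

theorem evalFamily_coeff_eq_zero {i : ℤ} {z : (EOF.tensor (PK W)).carrier}
    (hz : z ∈ (EOF.tensor (PK W)).piece i) {j : ℤ} (hj : 2 * j ≠ i) :
    (D.evalFamily z).coeff j = 0 := by
  funext p
  rw [coeff_evalFamily]
  by_contra h
  exact hj ((D.evalAt (TorsionPoint.ord p)).map_mem i z hz j h)

/-- The map of diagrams of rings from `EC_a` to the diagram of the curve. -/
def toCurve : D.ECa.Hom (curveFork W) where
  h₁ :=
    { toRingHom := D.toCR
      map_mem := by
        intro i z hz j hj
        by_contra h
        apply hj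
        refine (D.coeff_toCR z j).trans ?_
        exact (congrArg (completeFamily W) (Subtype.ext
          (D.evalFamily_coeff_eq_zero (z := D.ECa.l.toRingHom z) hz h))).trans (map_zero _) }
  h₂ :=
    { toRingHom := D.toMCR
      map_mem := by
        intro i z hz j hj
        by_contra h
        apply hj
        refine (D.coeff_toMCR z j).trans ?_
        exact (congrArg (expandFamily W) (Subtype.ext
          (D.evalFamily_coeff_eq_zero hz h))).trans (map_zero _) }
  h₃ := ⟨RingHom.id _, fun _ _ h => h⟩
  comm_l := D.toMCR_l
  comm_ι := D.toMCR_right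

end CoordinateData

end ForkMap

/-! ## The gluing property of the map of diagrams of rings -/

theorem exists_mapRingHom_eq {A B : Type*} [CommRing A] [CommRing B] (f : A →+* B) (y : B[T;T⁻¹])
    (h : ∀ j, ∃ a, f a = y.coeff j) : ∃ x : A[T;T⁻¹], AddMonoidAlgebra.mapRingHom ℤ f x = y := by
  choose a ha using h
  refine ⟨∑ j ∈ y.coeff.support, LaurentPolynomial.C (a j) * LaurentPolynomial.T j, ?_⟩
  conv_rhs => rw [laurent_eq_sum y]
  rw [map_sum]
  refine Finset.sum_congr rfl fun j _ => laurent_ext fun k => ?_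
  rw [coeff_mapRingHom, coeff_C_mul_T, coeff_C_mul_T, ← ha]
  split_ifs
  · rfl
  · exact map_zero f

theorem mapRingHom_injective {A B : Type*} [CommRing A] [CommRing B] {f : A →+* B}
    (hf : Function.Injective f) : Function.Injective (AddMonoidAlgebra.mapRingHom ℤ f) :=
  fun _ _ h => laurent_ext fun j => hf (congrArg (fun z : B[T;T⁻¹] => z.coeff j) h)

-- `B[T;T⁻¹]` is the base change of `B` along `A → A[T;T⁻¹]`.
open scoped AlgebraMonoidAlgebra in
theorem flat_mapRingHom {A B : Type u} [CommRing A] [CommRing B] {f : A →+* B} (hf : f.Flat) :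
    (AddMonoidAlgebra.mapRingHom ℤ f : A[T;T⁻¹] →+* B[T;T⁻¹]).Flat := by
  let _ : Algebra A B := f.toAlgebra
  let _ : Algebra A[T;T⁻¹] B[T;T⁻¹] := AddMonoidAlgebra.algebraAddMonoidAlgebra
  exact RingHom.Flat.isStableUnderBaseChange A B A[T;T⁻¹] B[T;T⁻¹] hf

/-- Such an `f` is a localization followed by a map out of the fraction field of `A`. -/
theorem flat_of_isUnit {A B : Type*} [CommRing A] [IsDomain A] [CommRing B] (f : A →+* B)
    (hf : ∀ a, a ≠ 0 → IsUnit (f a)) : f.Flat := by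
  let g : FractionRing A →+* B := IsLocalization.lift (M := nonZeroDivisors A) (g := f)
    fun a => hf a (nonZeroDivisors.ne_zero a.2)
  have h : f = g.comp (algebraMap A (FractionRing A)) :=
    RingHom.ext fun a => (IsLocalization.lift_eq _ a).symm
  rw [h]
  exact (RingHom.flat_algebraMap_iff.2 (IsLocalization.flat _ (nonZeroDivisors A))).comp
    (RingHom.Flat.of_isField (Field.toIsField _) g)

theorem isLocalization_toAlgebra {R S : Type*} [CommRing R] [CommRing S] (l : R →+* S)
    (E : Submonoid R) (hE : ∀ e ∈ E, IsUnit (l e)) (hsurj : ∀ y, ∃ e ∈ E, ∃ x, y * l e = l x)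
    (hinj : Function.Injective l) : letI := l.toAlgebra; IsLocalization E S := by
  let _ := l.toAlgebra
  refine ⟨fun e => hE e e.2, fun y => ?_, fun {x y} h => ⟨1, ?_⟩⟩
  · obtain ⟨e, he, x, h⟩ := hsurj y
    exact ⟨⟨x, e, he⟩, h⟩
  · rw [hinj h]

section Gluing

variable {K : Type u} [Field K] [CharZero K] {W : WeierstrassCurve K} [W.IsElliptic]

/-- The inverse of `f` need not lie in `𝒦`, since `f` may vanish at points of infinite order. But it
has finitely many poles, so it defines an almost regular family at the torsion points, and nothing
else is expanded. -/
theorem isUnit_expand {f : mero W} (hf : f ≠ 0) : IsUnit (expand W f) := by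
  have h0 : (f : FF W) ≠ 0 := fun h => hf (Subtype.ext h)
  let g : almostRegular W := ⟨fun _ => (f : FF W)⁻¹,
    (Place.finite_setOf_notMem_ring (f : FF W)⁻¹).preimage Subtype.val_injective.injOn⟩
  refine IsUnit.of_mul_eq_one (expandFamily W g) ?_
  rw [← expandFamily_constFamily, ← map_mul]
  refine (congrArg (expandFamily W) (Subtype.ext (funext fun p => ?_))).trans (map_one _)
  exact mul_inv_cancel₀ h0

namespace CoordinateData

variable (D : CoordinateData W)

theorem single_mem_EOFSub (n : ℕ+) (j : ℕ) :
    (LaurentPolynomial.C (Pi.single n 1 : FinSub) * LaurentPolynomial.T (-j : ℤ) : FinSub[T;T⁻¹]) ∈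
      EOFSub := by
  refine ⟨Finsupp.single n j, fun i m h => ?_⟩
  rw [coeff_C_mul_T] at h
  split_ifs at h with h1
  · by_cases hm : m = n
    · subst hm
      rw [Finsupp.single_eq_same, h1]
    · exact absurd (Pi.single_eq_of_ne hm _) h
  · exact absurd rfl h

/-- The factor `c^{-j}` at order `n` contributes `T^j`, so the other factor carries `T^(k - j)` to
place the result in exponent `k`. -/
theorem coeff_evalFamily_single_tmul (n : ℕ+) (j : ℕ) (f : mero W) (k i : ℤ) (p : TorsionPoint W) :
    (D.evalFamily ((⟨_, single_mem_EOFSub n j⟩ : EOFSub) ⊗ₜ[ℚ]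
      (LaurentPolynomial.C f * LaurentPolynomial.T (k - j) : (mero W)[T;T⁻¹]))).coeff i p =
      if i = k ∧ TorsionPoint.ord p = n then
        (D.t n / algebraMap K (FF W) D.lam) ^ (-j : ℤ) * f else 0 := by
  refine (D.coeff_evalFamily _ i p).trans ?_
  have h1 : AddMonoidAlgebra.mapRingHom ℤ (mero W).val.toRingHom
      (LaurentPolynomial.C f * LaurentPolynomial.T (k - j) : (mero W)[T;T⁻¹]) =
      LaurentPolynomial.C (f : FF W) * LaurentPolynomial.T (k - j) := by
    refine laurent_ext fun m => ?_
    rw [coeff_mapRingHom, coeff_C_mul_T, coeff_C_mul_T]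
    split_ifs <;> rfl
  have h2 := congrArg₂ (fun x y : (FF W)[T;T⁻¹] => x * y) (D.evalEuler_C_mul_T
    (TorsionPoint.ord p) (Pi.single n 1) (-j : ℤ)) h1
  refine (congrArg (fun y : (FF W)[T;T⁻¹] => y.coeff i) h2).trans
    ((coeff_C_mul_T_mul _ _ _ _).trans ?_)
  rw [coeff_C_mul_T]
  by_cases hp : TorsionPoint.ord p = n
  · rw [hp, Pi.single_eq_same, map_one, one_mul]
    by_cases hi : i = k
    · rw [if_pos (by omega), if_pos ⟨hi, rfl⟩]
    · rw [if_neg (by omega), if_neg (fun h => hi h.1), mul_zero]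
  · rw [Pi.single_eq_of_ne hp, map_zero, zero_mul, zero_mul, if_neg (fun h => hp h.2)]

/-- With `tₙ^j g` regular, choose `f` in `𝒦` congruent to `lam^{-j} tₙ^j g` modulo the `j`-th power
of the maximal ideal at all points of order `n`. Then `(lam / tₙ)^j f` differs from `g` by a regular
function, while at other orders the family is zero. -/
theorem exists_sub_mem_of_order (n : ℕ+) (k : ℤ) (g : ClosedPoint W → FF W) :
    ∃ b : (EOF.tensor (PK W)).carrier, ∀ (i : ℤ) (p : TorsionPoint W), (D.evalFamily b).coeff i p -
      (if i = k ∧ TorsionPoint.ord p = n then g p.1 else 0) ∈ p.1.ring := by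
  classical
  obtain ⟨j, hj⟩ := D.exists_pow_mul_mem_regularAt n (Finset.univ : Finset Unit) fun _ => g
  have hj' : ∀ p : ClosedPoint W, p.order = n →
      (algebraMap K (FF W) D.lam ^ j)⁻¹ * (D.t n ^ j * g p) ∈ p.ring := fun p hp => by
    refine mul_mem ?_ (hj () (Finset.mem_univ _) p hp)
    rw [← map_pow, ← map_inv₀]
    exact p.const_mem _
  obtain ⟨f, hf, h⟩ := exists_mem_mero_forall_sub_mem n (D.finite_setOf_order n)
    (fun p => if hp : p.order = n then ⟨_, hj' p hp⟩ else 0) j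
  refine ⟨(⟨_, single_mem_EOFSub n j⟩ : EOFSub) ⊗ₜ[ℚ]
      (LaurentPolynomial.C ⟨f, hf⟩ * LaurentPolynomial.T (k - j) : (mero W)[T;T⁻¹]),
    fun i p => ?_⟩
  rw [coeff_evalFamily_single_tmul]
  split_ifs with hi
  · have hp : p.1.order = n := congrArg PNat.val hi.2
    obtain ⟨hfp, h1⟩ := h p.1 hp
    rw [dif_pos hp, D.mem_maximalIdeal_pow_iff hp] at h1
    have h2 := mul_mem (p.1.const_mem (D.lam ^ j : K)) h1
    have ht := pow_ne_zero j (D.t_ne_zero n)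
    have hl := pow_ne_zero j D.lam_ne_zero
    convert h2 using 1
    change _ = _ * (_ * (f - _))
    rw [zpow_neg, zpow_natCast, div_pow, map_pow]
    field_simp
  · rw [sub_zero]
    exact zero_mem _

theorem exists_sub_mem (g : ℤ → TorsionPoint W → FF W)
    (hg : {q : ℤ × TorsionPoint W | g q.1 q.2 ≠ 0}.Finite) :
    ∃ b : (EOF.tensor (PK W)).carrier, ∀ i, (D.evalFamily b).coeff i - g i ∈ everywhereRegular W := by
  classical
  let g' : ℤ → ClosedPoint W → FF W := fun k p => if hp : 0 < p.order then g k ⟨p, hp⟩ else 0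
  choose b hb using fun q : ℕ+ × ℤ => D.exists_sub_mem_of_order q.1 q.2 (g' q.2)
  let S : Finset (ℕ+ × ℤ) := hg.toFinset.image fun q => (TorsionPoint.ord q.2, q.1)
  refine ⟨∑ q ∈ S, b q, fun i p => ?_⟩
  have h := sum_mem (S := p.1.ring) fun q (_ : q ∈ S) => hb q i p
  convert h using 1
  rw [Finset.sum_sub_distrib, map_sum, Pi.sub_apply]
  congr 1
  · rw [AddMonoidAlgebra.coeff_sum, Finsupp.finsetSum_apply, Finset.sum_apply]
  · have h1 : ∀ q : ℕ+ × ℤ, (if i = q.2 ∧ TorsionPoint.ord p = q.1 then g' q.2 p.1 else 0) =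
        if (TorsionPoint.ord p, i) = q then g i p else 0 := by
      rintro ⟨n, k⟩
      by_cases hi : i = k
      · subst hi
        simp [g', p.2]
      · simp [hi]
    rw [Finset.sum_congr rfl fun q _ => h1 q, Finset.sum_ite_eq]
    split_ifs with hS
    · rfl
    · by_contra h0
      exact hS (Finset.mem_image.2 ⟨(i, p), hg.mem_toFinset.2 h0, rfl⟩)

/-- Partial fractions: modulo the completed ring only finitely many principal parts are left, and
`exists_sub_mem` realizes them up to a regular family, which is absorbed in the first summand. -/
theorem exists_eq_map_add_toMCR (x : (MCR W)[T;T⁻¹]) :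
    ∃ (a : (CompletedRing W)[T;T⁻¹]) (b : (EOF.tensor (PK W)).carrier),
      x = AddMonoidAlgebra.mapRingHom ℤ (toMero W) a + D.toMCR b := by
  -- Requiring `g = 0` for vanishing coefficients makes the support finite in the exponent and the
  -- point together.
  have h0 : ∀ j, ∃ a, ∃ g : almostRegular W, {p | g.1 p ≠ 0}.Finite ∧
      (x.coeff j = 0 → g = 0) ∧ x.coeff j = toMero W a + expandFamily W g := fun j => by
    by_cases hj : x.coeff j = 0
    · exact ⟨0, 0, Set.finite_empty.subset fun p hp => hp rfl, fun _ => rfl, by simp [hj]⟩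
    · obtain ⟨a, g, hg, h⟩ := exists_eq_add_expandFamily (x.coeff j)
      exact ⟨a, g, hg, fun h => absurd h hj, h⟩
  choose a g hg hg0 h using h0
  obtain ⟨b, hb⟩ := D.exists_sub_mem (fun j => (g j).1) <| by
    refine ((x.coeff.support.finite_toSet.biUnion fun j _ =>
      (hg j).image fun p => (j, p))).subset fun q hq => ?_
    refine Set.mem_biUnion (x := q.1) (Finsupp.mem_support_iff.2 fun h => hq ?_) ⟨q.2, hq, rfl⟩
    rw [hg0 _ h]
    rfl
  obtain ⟨a', ha'⟩ := exists_mapRingHom_eq (toMero W) (x - D.toMCR b) fun j => by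
    refine ⟨a j - completeFamily W ⟨_, hb j⟩, ?_⟩
    have h1 : (x - D.toMCR b).coeff j = x.coeff j - (D.toMCR b).coeff j := rfl
    rw [h1, coeff_toMCR, map_sub, ← expandFamily_completeFamily, h, add_sub_assoc, ← map_sub,
      sub_eq_add_neg, ← map_neg]
    congr 2
    exact Subtype.ext (neg_sub _ _)
  exact ⟨a', b, by rw [ha', sub_add_cancel]⟩

theorem exists_NC_of_eq (a : (CompletedRing W)[T;T⁻¹]) (b : (EOF.tensor (PK W)).carrier)
    (h : AddMonoidAlgebra.mapRingHom ℤ (toMero W) a = D.toMCR b) :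
    ∃ z : D.NC.carrier, D.toCR z = a ∧ D.ECa.l.toRingHom z = b := by
  have h1 : ∀ j, toMero W (a.coeff j) = expandFamily W
      ⟨(D.evalFamily b).coeff j, D.coeff_evalFamily_mem_almostRegular b j⟩ := fun j =>
    (congrArg (fun y : (MCR W)[T;T⁻¹] => y.coeff j) h).trans (D.coeff_toMCR b j)
  have hb : b ∈ D.NCSub := (D.mem_NCSub_iff b).2 fun j => (mem_everywhereRegular_of_eq (h1 j)).1
  refine ⟨⟨b, hb⟩, laurent_ext fun j => ?_, rfl⟩
  exact (D.coeff_toCR _ j).trans (mem_everywhereRegular_of_eq (h1 j)).2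

theorem isUnit_toMCR_l (e : D.NC.carrier) (he : e ∈ D.eulerNC) :
    IsUnit (D.toMCR (D.ECa.l.toRingHom e)) := by
  let _ : Algebra D.NC.carrier (EOF.tensor (PK W)).carrier := D.ECa.l.toRingHom.toAlgebra
  have := D.isLocalization_eulerNC
  exact (IsLocalization.map_units (EOF.tensor (PK W)).carrier (⟨e, he⟩ : D.eulerNC)).map D.toMCR

/-- Writing `y` as a regular part plus the image of some `b`, an Euler class that moves `b` into
`NC` also clears the denominators of `y`. Hence inverting the Euler classes already inverts all the
local equations. -/
theorem exists_mul_eq_map (y : (MCR W)[T;T⁻¹]) : ∃ e ∈ D.eulerNC, ∃ a : (CompletedRing W)[T;T⁻¹],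
    y * AddMonoidAlgebra.mapRingHom ℤ (toMero W) (D.toCR e) =
      AddMonoidAlgebra.mapRingHom ℤ (toMero W) a := by
  let _ : Algebra D.NC.carrier (EOF.tensor (PK W)).carrier := D.ECa.l.toRingHom.toAlgebra
  have := D.isLocalization_eulerNC
  obtain ⟨a, b, rfl⟩ := D.exists_eq_map_add_toMCR y
  obtain ⟨⟨z, ⟨e, he⟩⟩, h⟩ := IsLocalization.surj D.eulerNC b
  refine ⟨e, he, a * D.toCR e + D.toCR z, ?_⟩
  have h1 : D.toMCR b * D.toMCR (D.ECa.l.toRingHom e) = D.toMCR (D.ECa.l.toRingHom z) :=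
    (map_mul D.toMCR b _).symm.trans (congrArg D.toMCR h)
  rw [add_mul, map_add, map_mul, ← D.toMCR_l z, ← h1, ← D.toMCR_l e]

theorem isUnit_map_of_mem {e : (curveFork W).R₁.carrier}
    (he : e ∈ D.eulerNC.map D.toCurve.h₁.toRingHom) : IsUnit ((curveFork W).l.toRingHom e) := by
  obtain ⟨e, he, rfl⟩ := he
  have h := D.isUnit_toMCR_l e he
  rw [toMCR_l] at h
  exact h

theorem isLocalization_map_eulerNC :
    letI := (curveFork W).l.toRingHom.toAlgebra
    IsLocalization (D.eulerNC.map D.toCurve.h₁.toRingHom) (curveFork W).R₂.carrier :=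
  isLocalization_toAlgebra _ _ (fun e he => D.isUnit_map_of_mem he) (fun y => by
    obtain ⟨e, he, a, h⟩ := D.exists_mul_eq_map y
    exact ⟨_, ⟨e, he, rfl⟩, a, h⟩)
    (mapRingHom_injective algebraMap_completedRing_injective)

variable (W) in
theorem flat_curveFork_ι : (curveFork W).ι.toRingHom.Flat := by
  have h : (expand W).Flat := flat_of_isUnit (expand W) fun _ => isUnit_expand
  exact flat_mapRingHom (A := mero W) (B := MCR W) (f := expand W) h

theorem isGluing_toCurve : D.toCurve.IsGluing D.eulerNC where
  injective := Subtype.val_injective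
  exists_of_eq := D.exists_NC_of_eq
  exists_add := D.exists_eq_map_add_toMCR
  isLocalization := D.isLocalization_eulerNC
  isLocalization_map := D.isLocalization_map_eulerNC
  flat := flat_curveFork_ι W
  bijective := Function.bijective_id

end CoordinateData

end Gluing

/-! ## Modules over `EC_a` -/

/-- For a pushout `B` of `S` and `A` over `R`, the modules `S ⊗[R] M` and `B ⊗[A] M` agree,
compatibly with the maps to `P`. -/
theorem isBaseChange_iff_of_isPushout {R S A B M P : Type*} [CommRing R] [CommRing S] [CommRing A]
    [CommRing B] [Algebra R S] [Algebra R A] [Algebra R B] [Algebra S B] [Algebra A B]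
    [IsScalarTower R S B] [IsScalarTower R A B] [Algebra.IsPushout R S A B]
    [AddCommGroup M] [AddCommGroup P] [Module R M] [Module A M] [IsScalarTower R A M]
    [Module R P] [Module S P] [Module A P] [Module B P] [IsScalarTower R S P] [IsScalarTower R A P]
    [IsScalarTower S B P] [IsScalarTower A B P] (f : M →ₗ[A] P) :
    IsBaseChange S (f.restrictScalars R) ↔ IsBaseChange B f := by
  have h : ∀ x, TensorProduct.lift (((Algebra.linearMap S <| Module.End S (M →ₗ[R] P)).flip
      (f.restrictScalars R)).restrictScalars R) x =
      TensorProduct.lift (((Algebra.linearMap B <| Module.End B (M →ₗ[A] P)).flip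
        f).restrictScalars A) ((Algebra.IsPushout.cancelBaseChange R S A B M).symm x) := by
    intro x
    induction x using TensorProduct.induction_on with
    | zero => rw [map_zero, map_zero, map_zero]
    | add x y hx hy => rw [map_add, map_add, map_add, hx, hy]
    | tmul s m =>
      rw [Algebra.IsPushout.cancelBaseChange_symm_tmul]
      exact (algebraMap_smul B s (f m)).symm
  change Function.Bijective _ ↔ Function.Bijective _
  rw [funext h]
  exact Function.Bijective.of_comp_iff _
    (Algebra.IsPushout.cancelBaseChange R S A B M).symm.bijective

/-! ### Extension of scalars to a tensor product of rings -/

section IncludeRight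

attribute [local instance] Algebra.TensorProduct.rightAlgebra

/-- The hypotheses `hM` and `hP` say that the structures over `R` and `S` are restricted from those
over `A` and the tensor product, as happens for a module restricted along the unit. -/
theorem isExtensionOfScalars_includeRight_iff {R S A M P : Type*} [CommRing R] [CommRing S]
    [CommRing A] [Algebra R S] [Algebra R A] [AddCommGroup M] [AddCommGroup P] [Module R M]
    [Module A M] [Module S P] [Module (S ⊗[R] A) P] (hM : ∀ (r : R) (m : M), r • m = algebraMap R A r • m)
    (hP : ∀ (s : S) (p : P), s • p = (s ⊗ₜ[R] (1 : A)) • p)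
    (f₀ : M →ₛₗ[algebraMap R S] P)
    (f : M →ₛₗ[(Algebra.TensorProduct.includeRight : A →ₐ[R] S ⊗[R] A).toRingHom] P)
    (hf : ∀ m, f₀ m = f m) :
    IsExtensionOfScalars (algebraMap R S) f₀ ↔ IsExtensionOfScalars
      (Algebra.TensorProduct.includeRight : A →ₐ[R] S ⊗[R] A).toRingHom f := by
  let _ : Module R P := Module.compHom P (algebraMap R S)
  let _ : Module A P := Module.compHom P
    (Algebra.TensorProduct.includeRight : A →ₐ[R] S ⊗[R] A).toRingHom
  have : IsScalarTower R A M := ⟨fun r a m => by rw [hM, smul_smul, Algebra.smul_def]⟩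
  have : IsScalarTower R S P := ⟨fun r s p => by
    rw [Algebra.smul_def, mul_smul]
    rfl⟩
  have : IsScalarTower S (S ⊗[R] A) P := ⟨fun s x p => by
    rw [hP, smul_smul, Algebra.smul_def]
    rfl⟩
  have : IsScalarTower A (S ⊗[R] A) P := ⟨fun s x p => by
    rw [Algebra.smul_def, mul_smul]
    rfl⟩
  have : IsScalarTower R A P := ⟨fun r a p => by
    change ((1 : S) ⊗ₜ[R] (r • a)) • p = algebraMap R S r • (((1 : S) ⊗ₜ[R] a) • p)
    rw [hP, smul_smul, Algebra.TensorProduct.tmul_mul_tmul, mul_one, one_mul,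
      Algebra.algebraMap_eq_smul_one, TensorProduct.smul_tmul]⟩
  let g : M →ₗ[A] P := { toFun := f, map_add' := f.map_add, map_smul' := f.map_smulₛₗ }
  exact (isExtensionOfScalars_iff rfl (g.restrictScalars R) hf).trans
    ((isBaseChange_iff_of_isPushout (B := S ⊗[R] A) g).trans
      (isExtensionOfScalars_iff (f := f) rfl g fun _ => rfl).symm)

theorem flat_includeRight {R S A : Type*} [CommRing R] [CommRing S] [CommRing A] [Algebra R S]
    [Algebra R A] [Module.Flat R S] :
    (Algebra.TensorProduct.includeRight : A →ₐ[R] S ⊗[R] A).toRingHom.Flat := by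
  have : Algebra.IsPushout R A S (S ⊗[R] A) := .symm inferInstance
  exact RingHom.flat_algebraMap_iff.2 (Module.Flat.isBaseChange R A S _ this.out)

end IncludeRight

theorem isExtensionOfScalars_ringHom {R S : Type*} [CommRing R] [CommRing S] (l : R →+* S)
    (f : R →ₛₗ[l] S) (hf : ∀ r, f r = l r) : IsExtensionOfScalars l f := by
  let _ : Algebra R S := l.toAlgebra
  exact (isExtensionOfScalars_iff rfl (Algebra.linearMap R S) hf).2 (IsBaseChange.linearMap R S)

theorem flat_of_isLocalization {R S : Type*} [CommRing R] [CommRing S] {l : R →+* S}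
    (E : Submonoid R) (hE : letI := l.toAlgebra; IsLocalization E S) : l.Flat := by
  let _ := l.toAlgebra
  have : IsLocalization E S := hE
  exact IsLocalization.flat S E

theorem RingFork.extended_self (F : RingFork.{u}) : F.extended (ForkMod.self F) :=
  ⟨isExtensionOfScalars_ringHom F.l.toRingHom _ fun _ => rfl,
    isExtensionOfScalars_ringHom F.ι.toRingHom _ fun _ => rfl⟩

/-- Both maps are localizations, at `E` and at its image. Elements of `E` act on the restricted
module through their images, so the localization criterion reads the same on the two sides. -/
theorem ForkMod.isExtensionOfScalars_restrict_k_iff {F : RingFork.{u}} {G : RingFork.{v}}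
    (X : ForkMod.{v, w} G) (h : F.Hom G) (E : Submonoid F.R₁.carrier)
    (hE : letI := F.l.toRingHom.toAlgebra; IsLocalization E F.R₂.carrier)
    (hE' : letI := G.l.toRingHom.toAlgebra;
      IsLocalization (E.map h.h₁.toRingHom) G.R₂.carrier) :
    IsExtensionOfScalars F.l.toRingHom (X.restrict h).k ↔
      IsExtensionOfScalars G.l.toRingHom X.k := by
  rw [isExtensionOfScalars_iff_of_isLocalization E hE,
    isExtensionOfScalars_iff_of_isLocalization _ hE']
  refine and_congr (forall_congr' fun y => ?_) (forall_congr' fun x => forall_congr' fun _ => ?_)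
  · constructor
    · rintro ⟨e, he, x, hx⟩
      refine ⟨_, ⟨e, he, rfl⟩, x, Eq.trans ?_ hx⟩
      rw [← h.comm_l]
      rfl
    · rintro ⟨_, ⟨e, he, rfl⟩, x, hx⟩
      refine ⟨e, he, x, Eq.trans ?_ hx⟩
      rw [← h.comm_l]
      rfl
  · constructor
    · rintro ⟨e, he, hx⟩
      exact ⟨_, ⟨e, he, rfl⟩, hx⟩
    · rintro ⟨_, ⟨e, he, rfl⟩, hx⟩
      exact ⟨e, he, hx⟩

/-! ### Modules over `EC_a` in `𝒜(𝕋)` as extended modules -/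

section Modules

variable {K : Type u} [Field K] [CharZero K] {W : WeierstrassCurve K} [W.IsElliptic]

namespace CoordinateData

variable (D : CoordinateData W)

theorem isExtensionOfScalars_restrict_k_iff (X : ForkMod.{u, w} D.ECa) :
    IsExtensionOfScalars sphereFork.l.toRingHom (X.restrict D.unit).k ↔
      IsExtensionOfScalars D.ECa.l.toRingHom X.k :=
  X.isExtensionOfScalars_restrict_k_iff D.unit eulerClasses isLocalization_eulerClasses
    D.isLocalization_eulerNC

theorem isExtensionOfScalars_restrict_m_iff (X : ForkMod.{u, w} D.ECa) :
    IsExtensionOfScalars sphereFork.ι.toRingHom (X.restrict D.unit).m ↔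
      IsExtensionOfScalars D.ECa.ι.toRingHom X.m :=
  let _ : Module (PK W).carrier (X.restrict D.unit).V.carrier := X.V.module
  let _ : Module (EOF.carrier ⊗[ℚ] (PK W).carrier) (X.restrict D.unit).P.carrier := X.P.module
  let _ : Module ℚ (X.restrict D.unit).V.carrier := (X.restrict D.unit).V.module
  let _ : Module EOF.carrier (X.restrict D.unit).P.carrier := (X.restrict D.unit).P.module
  isExtensionOfScalars_includeRight_iff (R := ℚ) (S := EOF.carrier) (A := (PK W).carrier)
    (M := (X.restrict D.unit).V.carrier) (P := (X.restrict D.unit).P.carrier)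
    (fun _ _ => rfl) (fun _ _ => rfl) (X.restrict D.unit).m X.m fun _ => rfl

/-- This removes `𝒜(𝕋)` from the problem: what remains concerns extended modules over the two
diagrams `EC_a` and `curveFork W`. -/
theorem extended_restrict_unit_iff (X : ForkMod.{u, w} D.ECa) :
    sphereFork.extended (X.restrict D.unit) ↔ D.ECa.extended X :=
  and_congr (D.isExtensionOfScalars_restrict_k_iff X) (D.isExtensionOfScalars_restrict_m_iff X)

theorem extended_restrict_unit_eq :
    (fun X : ForkMod.{u, w} D.ECa => sphereFork.extended (X.restrict D.unit)) =
      RingFork.extended.{u, w} D.ECa :=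
  funext fun X => propext (D.extended_restrict_unit_iff X)

theorem flat_ECa_l : D.ECa.l.toRingHom.Flat :=
  flat_of_isLocalization D.eulerNC D.isLocalization_eulerNC

theorem flat_ECa_ι : D.ECa.ι.toRingHom.Flat :=
  flat_includeRight (R := ℚ) (S := EOF.carrier) (A := (PK W).carrier)

include D in
theorem flat_curveFork_l : (curveFork W).l.toRingHom.Flat :=
  flat_of_isLocalization _ D.isLocalization_map_eulerNC

theorem nonempty_abelian_ECaMod : Nonempty (Abelian (ECaMod.{u, w} D)) := by
  unfold ECaMod
  rw [extended_restrict_unit_eq]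
  exact nonempty_abelian_extended D.flat_ECa_l D.flat_ECa_ι

theorem nonempty_equivalence_ECaMod_APC : Nonempty (ECaMod.{u, u} D ≌ APC.{u, u} W) := by
  unfold ECaMod
  rw [extended_restrict_unit_eq]
  exact D.isGluing_toCurve.nonempty_equivalence

end CoordinateData

end Modules

end EllipticModel

end

theorem mainTheorem8 {K : Type u} [Field K] [CharZero K] (W : WeierstrassCurve K) [W.IsElliptic]
    (D : EllipticModel.CoordinateData W) :
    EllipticModel.sphereFork.extended
        ((EllipticModel.ForkMod.self D.ECa).restrict D.unit) ∧
      Nonempty (CategoryTheory.Abelian (EllipticModel.CoordinateData.ECaMod.{u, u} D)) ∧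
      Nonempty (CategoryTheory.Abelian (EllipticModel.APC.{u, u} W)) ∧
      Nonempty (CategoryTheory.Equivalence
        (EllipticModel.CoordinateData.ECaMod.{u, u} D) (EllipticModel.APC.{u, u} W)) :=
  ⟨(D.extended_restrict_unit_iff _).2 (EllipticModel.RingFork.extended_self D.ECa),
    D.nonempty_abelian_ECaMod,
    EllipticModel.nonempty_abelian_extended D.flat_curveFork_l
      (EllipticModel.CoordinateData.flat_curveFork_ι W),
    D.nonempty_equivalence_ECaMod_APC⟩
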